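/- Let $\mathfrak g$ be a finite-dimensional complex simple Lie algebra of simply-laced type with Cartan subalgebra $\mathfrak h$, root system $\Delta$, simple roots $\alpha_1,\dots,\alpha_s$, longest (highest) root $\theta$ and height function $ht$, and let $(\cdot|\cdot)$ be a nonzero symmetric invariant bilinear form on $\mathfrak g$. The extended double affine Lie algebra is $$\mathfrak T=\mathfrak g\otimes\mathbb C[t_1^{\pm1},t_2^{\pm1}]\oplus\mathbb Cc_1\oplus\mathbb Cc_2\oplus\mathbb Cd_1\oplus\mathbb Cd_2,$$ where, writing $x(m_1,m_2)=x\otimes t_1^{m_1}t_2^{m_2}$, $$[x(m_1,m_2),y(n_1,n_2)]=[x,y](m_1+n_1,m_2+n_2)+(x|y)\,\delta_{m_1,-n_1}\delta_{m_2,-n_2}(m_1c_1+m_2c_2),$$ $$[d_i,x(m_1,m_2)]=m_i\,x(m_1,m_2),\qquad [d_1,d_2]=0,\qquad c_1,c_2\ \text{central}.$$ Put $\hat{\mathfrak h}=\mathfrak h\oplus\mathbb Cc_1\oplus\mathbb Cc_2\oplus\mathbb Cd_1\oplus\mathbb Cd_2$. For $\beta\in\hat{\mathfrak h}^*$ let $\mathfrak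 T_\beta=\{x\in\mathfrak T: [h,x]=\beta(h)x\ \forall h\in\hat{\mathfrak h}\}$, and let $\Delta_{\mathfrak T}$ be the set of nonzero $\beta$ with $\mathfrak T_\beta\ne0$. Extend the roots of $\mathfrak g$ to $\hat{\mathfrak h}$ by zero on $c_j,d_j$, and let $\delta_i\in\hat{\mathfrak h}^*$ be given by $\delta_i(\mathfrak h)=\delta_i(c_j)=0$, $\delta_i(d_j)=\delta_{ij}$. Put $\alpha_0=\delta_1-\theta$ and $\alpha_{-1}=\delta_2-\theta$. Let $\varphi$ be the linear functional on the span of $\alpha_{-1},\alpha_0,\alpha_1,\dots,\alpha_s$ with $\varphi(\alpha_i)=1$ for $i=0,\dots,s$ and $\varphi(\alpha_{-1})=-ht(\theta)$ (so $\varphi(\delta_2)=0$). Let $$\mathcal I=\{\beta\in\Delta_{\mathfrak T}:\varphi(\beta)>0\}\cup\{n\delta_2:n=1,2,3,\dots\},\qquad \mathfrak T_{\mathcal I}=\bigoplus_{\beta\in\mathcal I}\mathfrak T_\beta,\qquad \mathfrak b_{\mathcal I}=\hat{\mathfrak h}\oplus\mathfrak T_{\mathcal I}.$$ For $\lambda\in\hat{\mathfrak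 h}^*$ let $\mathbb C1_\lambda$ be the one-dimensional $\mathfrak b_{\mathcal I}$-module with $(h+x)1_\lambda=\lambda(h)1_\lambda$ for $h\in\hat{\mathfrak h}$, $x\in\mathfrak T_{\mathcal I}$, and let $$\overline M(\lambda)=U(\mathfrak T)\otimes_{U(\mathfrak b_{\mathcal I})}\mathbb C1_\lambda$$ be the imaginary Verma module. **Theorem.** For every $\lambda\in\hat{\mathfrak h}^*$, the $\mathfrak T$-module $\overline M(\lambda)$ is irreducible if and only if $\lambda(c_2)\neq0$. -/

import Mathlib

open scoped TensorProduct

noncomputable section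

/-! ### Invariant forms and the extended double affine Lie algebra -/

/-- A nonzero symmetric invariant bilinear form on a complex Lie algebra. (On a simple Lie algebra
it is automatically nondegenerate and unique up to a nonzero scalar.) -/
structure InvariantForm (𝔤 : Type*) [LieRing 𝔤] [LieAlgebra ℂ 𝔤] where
  /-- The bilinear form `(x|y)`. -/
  form : LinearMap.BilinForm ℂ 𝔤
  symm : ∀ x y, form x y = form y x
  invariant : ∀ x y z, form ⁅x, y⁆ z = form x ⁅y, z⁆
  ne_zero : form ≠ 0

/-- The 2-loop space `𝔤 ⊗ ℂ[t₁^±1, t₂^±1]`, written as Laurent polynomials in `t₁, t₂` with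
coefficients in `𝔤`; the element `x(m,n) = x ⊗ t₁^m t₂^n` is `Finsupp.single (m, n) x`. -/
abbrev TwoLoop (𝔤 : Type*) [LieRing 𝔤] : Type _ := (ℤ × ℤ) →₀ 𝔤

namespace TwoLoop

variable {𝔤 : Type*} [LieRing 𝔤] [LieAlgebra ℂ 𝔤]
variable {N : Type*} [AddCommGroup N] [Module ℂ N]

/-- The bilinear map on the 2-loop space with prescribed values `(x(m), y(n)) ↦ F m n x y`. -/
def bilin (F : ℤ × ℤ → ℤ × ℤ → 𝔤 →ₗ[ℂ] 𝔤 →ₗ[ℂ] N) :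
    TwoLoop 𝔤 →ₗ[ℂ] TwoLoop 𝔤 →ₗ[ℂ] N :=
  Finsupp.lsum ℂ fun m => (Finsupp.lsum ℂ fun n => (F m n).flip).flip

@[simp] lemma bilin_single (F : ℤ × ℤ → ℤ × ℤ → 𝔤 →ₗ[ℂ] 𝔤 →ₗ[ℂ] N) (m n : ℤ × ℤ) (x y : 𝔤) :
    bilin F (Finsupp.single m x) (Finsupp.single n y) = F m n x y := by
  simp [bilin]

/-- `[x(m), y(n)] = [x,y](m+n)`. -/
def bracket : TwoLoop 𝔤 →ₗ[ℂ] TwoLoop 𝔤 →ₗ[ℂ] TwoLoop 𝔤 :=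
  bilin fun m n => (LieModule.toEnd ℂ 𝔤 𝔤 : 𝔤 →ₗ[ℂ] 𝔤 →ₗ[ℂ] 𝔤).compr₂ (Finsupp.lsingle (m + n))

@[simp] lemma bracket_single (m n : ℤ × ℤ) (x y : 𝔤) :
    bracket (Finsupp.single m x) (Finsupp.single n y) = Finsupp.single (m + n) ⁅x, y⁆ := by
  simp [bracket]

/-- The central term of `[x(m), y(n)]`: the pair of coefficients of `c₁, c₂`, that is
`(x|y) δ_{m+n,0} (m₁, m₂)`. -/
def cocycle (B : InvariantForm 𝔤) : TwoLoop 𝔤 →ₗ[ℂ] TwoLoop 𝔤 →ₗ[ℂ] ℂ × ℂ :=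
  bilin fun m n => if m + n = 0 then
    B.form.compr₂ (LinearMap.toSpanSingleton ℂ (ℂ × ℂ) ((m.1 : ℂ), (m.2 : ℂ))) else 0

@[simp] lemma cocycle_single (B : InvariantForm 𝔤) (m n : ℤ × ℤ) (x y : 𝔤) :
    cocycle B (Finsupp.single m x) (Finsupp.single n y) =
      if m + n = 0 then B.form x y • ((m.1 : ℂ), (m.2 : ℂ)) else 0 := by
  rw [cocycle, bilin_single]
  split_ifs <;> simp

/-- The action of `a d₁ + b d₂`: `x(m₁,m₂) ↦ (a m₁ + b m₂) x(m₁,m₂)`. -/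
def deriv : ℂ × ℂ →ₗ[ℂ] TwoLoop 𝔤 →ₗ[ℂ] TwoLoop 𝔤 :=
  LinearMap.mk₂ ℂ
    (fun d f => Finsupp.lsum ℂ
      (fun m : ℤ × ℤ => (d.1 * m.1 + d.2 * m.2) • (Finsupp.lsingle m : 𝔤 →ₗ[ℂ] TwoLoop 𝔤)) f)
    (fun d e f => by
      simp only [Finsupp.lsum_apply, Finsupp.sum, ← Finset.sum_add_distrib]
      refine Finset.sum_congr rfl fun m _ => ?_
      simp only [LinearMap.smul_apply, ← add_smul, Prod.fst_add, Prod.snd_add]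
      congr 1; ring)
    (fun c d f => by
      simp only [Finsupp.lsum_apply, Finsupp.sum, Finset.smul_sum]
      refine Finset.sum_congr rfl fun m _ => ?_
      simp only [LinearMap.smul_apply, smul_smul, Prod.smul_fst, Prod.smul_snd, smul_eq_mul]
      congr 1; ring)
    (fun d f g => map_add _ f g)
    (fun c d f => map_smul _ c f)

@[simp] lemma deriv_single (d : ℂ × ℂ) (m : ℤ × ℤ) (x : 𝔤) :
    deriv d (Finsupp.single m x) = Finsupp.single m ((d.1 * m.1 + d.2 * m.2) • x) := by
  simp [deriv]

lemma bracket_self (f : TwoLoop 𝔤) : bracket f f = 0 := by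
  have key : ∀ f g : TwoLoop 𝔤, bracket f g + bracket g f = 0 := by
    intro f g
    induction f using Finsupp.induction_linear with
    | zero => simp
    | add f₁ f₂ h₁ h₂ =>
      simp only [map_add, LinearMap.add_apply]
      rw [add_add_add_comm, h₁, h₂, add_zero]
    | single m x =>
      induction g using Finsupp.induction_linear with
      | zero => simp
      | add g₁ g₂ h₁ h₂ =>
        simp only [map_add, LinearMap.add_apply]
        rw [add_add_add_comm, h₁, h₂, add_zero]
      | single n y =>
        rw [bracket_single, bracket_single, add_comm n m, ← Finsupp.single_add,
          ← lie_skew x y, neg_add_cancel, Finsupp.single_zero]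
  have h := key f f
  rw [← two_smul ℂ] at h
  exact (smul_eq_zero.mp h).resolve_left two_ne_zero

lemma cocycle_self (B : InvariantForm 𝔤) (f : TwoLoop 𝔤) : cocycle B f f = 0 := by
  have key : ∀ f g : TwoLoop 𝔤, cocycle B f g + cocycle B g f = 0 := by
    intro f g
    induction f using Finsupp.induction_linear with
    | zero => simp
    | add f₁ f₂ h₁ h₂ =>
      simp only [map_add, LinearMap.add_apply]
      rw [add_add_add_comm, h₁, h₂, add_zero]
    | single m x =>
      induction g using Finsupp.induction_linear with
      | zero => simp
      | add g₁ g₂ h₁ h₂ =>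
        simp only [map_add, LinearMap.add_apply]
        rw [add_add_add_comm, h₁, h₂, add_zero]
      | single n y =>
        rw [cocycle_single, cocycle_single, add_comm n m]
        split_ifs with h
        · obtain rfl := eq_neg_of_add_eq_zero_left h
          rw [B.symm x y]
          ext <;> simp
        · simp
  have h := key f f
  rw [← two_smul ℂ] at h
  exact (smul_eq_zero.mp h).resolve_left two_ne_zero

lemma bracket_leibniz (f g h : TwoLoop 𝔤) :
    bracket f (bracket g h) = bracket (bracket f g) h + bracket g (bracket f h) := by
  induction f using Finsupp.induction_linear with
  | zero => simp
  | add f₁ f₂ h₁ h₂ => simp only [map_add, LinearMap.add_apply, h₁, h₂]; abel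
  | single m x =>
    induction g using Finsupp.induction_linear with
    | zero => simp
    | add g₁ g₂ h₁ h₂ => simp only [map_add, LinearMap.add_apply, h₁, h₂]; abel
    | single n y =>
      induction h using Finsupp.induction_linear with
      | zero => simp
      | add h₁ h₂ e₁ e₂ => simp only [map_add, e₁, e₂]; abel
      | single p z =>
        simp only [bracket_single]
        rw [leibniz_lie x y z, Finsupp.single_add, add_assoc, add_left_comm n m p]

lemma deriv_bracket (d : ℂ × ℂ) (f g : TwoLoop 𝔤) :
    deriv d (bracket f g) = bracket (deriv d f) g + bracket f (deriv d g) := by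
  induction f using Finsupp.induction_linear with
  | zero => simp
  | add f₁ f₂ h₁ h₂ => simp only [map_add, LinearMap.add_apply, h₁, h₂]; abel
  | single m x =>
    induction g using Finsupp.induction_linear with
    | zero => simp
    | add g₁ g₂ h₁ h₂ => simp only [map_add, h₁, h₂]; abel
    | single n y =>
      simp only [bracket_single, deriv_single]
      rw [← Finsupp.single_add, smul_lie, lie_smul, ← add_smul]
      congr 2
      simp only [Prod.fst_add, Prod.snd_add, Int.cast_add]; ring

lemma deriv_comm (d e : ℂ × ℂ) (f : TwoLoop 𝔤) : deriv d (deriv e f) = deriv e (deriv d f) := by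
  induction f using Finsupp.induction_linear with
  | zero => simp
  | add f₁ f₂ h₁ h₂ => simp only [map_add, h₁, h₂]
  | single m x => simp only [deriv_single, smul_smul, mul_comm]

lemma cocycle_deriv (B : InvariantForm 𝔤) (d : ℂ × ℂ) (f g : TwoLoop 𝔤) :
    cocycle B (deriv d f) g + cocycle B f (deriv d g) = 0 := by
  induction f using Finsupp.induction_linear with
  | zero => simp
  | add f₁ f₂ h₁ h₂ =>
    simp only [map_add, LinearMap.add_apply]
    rw [add_add_add_comm, h₁, h₂, add_zero]
  | single m x =>
    induction g using Finsupp.induction_linear with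
    | zero => simp
    | add g₁ g₂ h₁ h₂ =>
      simp only [map_add]
      rw [add_add_add_comm, h₁, h₂, add_zero]
    | single n y =>
      simp only [deriv_single, cocycle_single]
      split_ifs with h
      · obtain rfl := eq_neg_of_add_eq_zero_left h
        ext <;> simp <;> ring
      · simp

lemma cocycle_leibniz (B : InvariantForm 𝔤) (f g h : TwoLoop 𝔤) :
    cocycle B f (bracket g h) = cocycle B (bracket f g) h + cocycle B g (bracket f h) := by
  induction f using Finsupp.induction_linear with
  | zero => simp
  | add f₁ f₂ h₁ h₂ => simp only [map_add, LinearMap.add_apply, h₁, h₂]; abel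
  | single m x =>
    induction g using Finsupp.induction_linear with
    | zero => simp
    | add g₁ g₂ h₁ h₂ => simp only [map_add, LinearMap.add_apply, h₁, h₂]; abel
    | single n y =>
      induction h using Finsupp.induction_linear with
      | zero => simp
      | add h₁ h₂ e₁ e₂ => simp only [map_add, e₁, e₂]; abel
      | single p z =>
        simp only [bracket_single, cocycle_single]
        rw [show n + (m + p) = m + (n + p) by abel, show m + n + p = m + (n + p) by abel]
        split_ifs with h
        · have e : B.form y ⁅x, z⁆ = - B.form x ⁅y, z⁆ := by
            rw [← B.invariant, ← lie_skew, map_neg, LinearMap.neg_apply, B.invariant]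
          rw [e, B.invariant]
          ext <;> simp <;> ring
        · simp

end TwoLoop

/-- The extended double affine Lie algebra
`𝔗 = 𝔤 ⊗ ℂ[t₁^±1, t₂^±1] ⊕ ℂc₁ ⊕ ℂc₂ ⊕ ℂd₁ ⊕ ℂd₂`. An element is a triple: its 2-loop part, its
coordinates along `c₁, c₂`, and its coordinates along `d₁, d₂`. -/
def ExtDoubleAffine {𝔤 : Type*} [LieRing 𝔤] [LieAlgebra ℂ 𝔤] (_B : InvariantForm 𝔤) : Type _ :=
  TwoLoop 𝔤 × (ℂ × ℂ) × (ℂ × ℂ)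

namespace ExtDoubleAffine

variable {𝔤 : Type*} [LieRing 𝔤] [LieAlgebra ℂ 𝔤] {B : InvariantForm 𝔤}

instance : AddCommGroup (ExtDoubleAffine B) :=
  inferInstanceAs (AddCommGroup (TwoLoop 𝔤 × (ℂ × ℂ) × (ℂ × ℂ)))

instance : Module ℂ (ExtDoubleAffine B) :=
  inferInstanceAs (Module ℂ (TwoLoop 𝔤 × (ℂ × ℂ) × (ℂ × ℂ)))

/-- The 2-loop part. -/
def loop : ExtDoubleAffine B →ₗ[ℂ] TwoLoop 𝔤 := LinearMap.fst ℂ _ _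

/-- The coordinates along `c₁` and `c₂`. -/
def cen : ExtDoubleAffine B →ₗ[ℂ] ℂ × ℂ := LinearMap.fst ℂ _ _ ∘ₗ LinearMap.snd ℂ _ _

/-- The coordinates along `d₁` and `d₂`. -/
def der : ExtDoubleAffine B →ₗ[ℂ] ℂ × ℂ := LinearMap.snd ℂ _ _ ∘ₗ LinearMap.snd ℂ _ _

/-- The element with given 2-loop part, central part and derivation part. -/
def mk (f : TwoLoop 𝔤) (c d : ℂ × ℂ) : ExtDoubleAffine B := (f, c, d)

@[simp] lemma loop_mk (f : TwoLoop 𝔤) (c d : ℂ × ℂ) : loop (mk f c d : ExtDoubleAffine B) = f := rfl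
@[simp] lemma cen_mk (f : TwoLoop 𝔤) (c d : ℂ × ℂ) : cen (mk f c d : ExtDoubleAffine B) = c := rfl
@[simp] lemma der_mk (f : TwoLoop 𝔤) (c d : ℂ × ℂ) : der (mk f c d : ExtDoubleAffine B) = d := rfl

@[ext] lemma ext {u v : ExtDoubleAffine B} (h₁ : loop u = loop v) (h₂ : cen u = cen v)
    (h₃ : der u = der v) : u = v :=
  Prod.ext h₁ (Prod.ext h₂ h₃)

/-- The Lie bracket:
`[x(m), y(n)] = [x,y](m+n) + (x|y) δ_{m+n,0} (m₁c₁ + m₂c₂)`, `[dᵢ, x(m)] = mᵢ x(m)`, the `cᵢ` are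
central, and `d₁, d₂` commute. -/
instance : Bracket (ExtDoubleAffine B) (ExtDoubleAffine B) where
  bracket u v := mk
    (TwoLoop.bracket (loop u) (loop v) + TwoLoop.deriv (der u) (loop v)
      - TwoLoop.deriv (der v) (loop u))
    (TwoLoop.cocycle B (loop u) (loop v))
    0

@[simp] lemma loop_lie (u v : ExtDoubleAffine B) : loop ⁅u, v⁆ =
    TwoLoop.bracket (loop u) (loop v) + TwoLoop.deriv (der u) (loop v)
      - TwoLoop.deriv (der v) (loop u) := rfl
@[simp] lemma cen_lie (u v : ExtDoubleAffine B) :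
    cen ⁅u, v⁆ = TwoLoop.cocycle B (loop u) (loop v) := rfl
@[simp] lemma der_lie (u v : ExtDoubleAffine B) : der ⁅u, v⁆ = 0 := rfl

instance : LieRing (ExtDoubleAffine B) where
  add_lie u v w := by
    ext1 <;> simp only [loop_lie, cen_lie, der_lie, map_add, LinearMap.add_apply, add_zero]
    abel
  lie_add u v w := by
    ext1 <;> simp only [loop_lie, cen_lie, der_lie, map_add, LinearMap.add_apply, add_zero]
    abel
  lie_self u := by
    ext1
    · simp [TwoLoop.bracket_self]
    · simp [TwoLoop.cocycle_self]
    · simp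
  leibniz_lie u v w := by
    have skew : ∀ f g : TwoLoop 𝔤, TwoLoop.bracket f g = - TwoLoop.bracket g f := by
      intro f g
      have h := TwoLoop.bracket_self (f + g)
      simp only [map_add, LinearMap.add_apply, TwoLoop.bracket_self, zero_add, add_zero] at h
      exact eq_neg_of_add_eq_zero_right h
    have cskew : ∀ f g : TwoLoop 𝔤, TwoLoop.cocycle B f g = - TwoLoop.cocycle B g f := by
      intro f g
      have h := TwoLoop.cocycle_self B (f + g)
      simp only [map_add, LinearMap.add_apply, TwoLoop.cocycle_self, zero_add, add_zero] at h
      exact eq_neg_of_add_eq_zero_right h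
    ext1
    · simp only [loop_lie, der_lie, map_add, map_sub, map_zero, LinearMap.add_apply,
        LinearMap.sub_apply, LinearMap.zero_apply, TwoLoop.deriv_bracket]
      rw [TwoLoop.bracket_leibniz, TwoLoop.deriv_comm (der v) (der w),
        TwoLoop.deriv_comm (der u) (der w), TwoLoop.deriv_comm (der u) (der v),
        skew (TwoLoop.deriv (der w) (loop u)) (loop v)]
      rw [skew (loop v) (TwoLoop.deriv (der w) (loop u))]
      abel
    · simp only [loop_lie, cen_lie, map_add, map_sub, LinearMap.add_apply, LinearMap.sub_apply]
      have h₁ := TwoLoop.cocycle_deriv B (der u) (loop v) (loop w)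
      have h₂ := TwoLoop.cocycle_deriv B (der v) (loop u) (loop w)
      have h₃ := TwoLoop.cocycle_deriv B (der w) (loop u) (loop v)
      rw [TwoLoop.cocycle_leibniz, eq_neg_of_add_eq_zero_left h₁,
        eq_neg_of_add_eq_zero_left h₂,
        cskew (loop v) (TwoLoop.deriv (der w) (loop u)), eq_neg_of_add_eq_zero_left h₃]
      abel
    · simp

instance : LieAlgebra ℂ (ExtDoubleAffine B) where
  lie_smul c u v := by
    ext1 <;> simp [smul_add, smul_sub]

/-- The element `x(m,n) = x ⊗ t₁^m t₂^n`. -/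
def elt (B : InvariantForm 𝔤) (m n : ℤ) : 𝔤 →ₗ[ℂ] ExtDoubleAffine B where
  toFun x := mk (Finsupp.single (m, n) x) 0 0
  map_add' x y := by ext1 <;> simp
  map_smul' c x := by ext1 <;> simp

/-- The element `c₁`. -/
def c₁ (B : InvariantForm 𝔤) : ExtDoubleAffine B := mk 0 (1, 0) 0
/-- The element `c₂`. -/
def c₂ (B : InvariantForm 𝔤) : ExtDoubleAffine B := mk 0 (0, 1) 0
/-- The element `d₁`. -/
def d₁ (B : InvariantForm 𝔤) : ExtDoubleAffine B := mk 0 0 (1, 0)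
/-- The element `d₂`. -/
def d₂ (B : InvariantForm 𝔤) : ExtDoubleAffine B := mk 0 0 (0, 1)

/-! ### Cartan subalgebra, roots, and the closed subset `𝓘` -/

variable (B) (H : LieSubalgebra ℂ 𝔤)

/-- The Cartan subalgebra `𝔥^ = 𝔥 ⊕ ℂc₁ ⊕ ℂc₂ ⊕ ℂd₁ ⊕ ℂd₂` of `𝔗`, with `𝔥 = 𝔥 ⊗ 1`. -/
def cartan : Submodule ℂ (ExtDoubleAffine B) :=
  (H.toSubmodule.map (elt B 0 0)) ⊔ Submodule.span ℂ {c₁ B, c₂ B, d₁ B, d₂ B}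

lemma elt_mem_cartan (x : H) : elt B 0 0 (x : 𝔤) ∈ cartan B H :=
  Submodule.mem_sup_left (Submodule.mem_map_of_mem x.2)

lemma c₁_mem_cartan : c₁ B ∈ cartan B H :=
  Submodule.mem_sup_right (Submodule.subset_span (by simp))
lemma c₂_mem_cartan : c₂ B ∈ cartan B H :=
  Submodule.mem_sup_right (Submodule.subset_span (by simp))
lemma d₁_mem_cartan : d₁ B ∈ cartan B H :=
  Submodule.mem_sup_right (Submodule.subset_span (by simp))
lemma d₂_mem_cartan : d₂ B ∈ cartan B H :=
  Submodule.mem_sup_right (Submodule.subset_span (by simp))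

variable {B H}

/-- The restriction of a functional on `𝔥^` to `𝔥`. -/
def restrict : Module.Dual ℂ (cartan B H) →ₗ[ℂ] Module.Dual ℂ H :=
  Module.Dual.transpose
    (((elt B 0 0).domRestrict H.toSubmodule).codRestrict (cartan B H) (elt_mem_cartan B H))

/-- The functional `δ₂`: zero on `𝔥`, `c₁`, `c₂`, `d₁`, and `δ₂(d₂) = 1`. -/
def δ₂ : Module.Dual ℂ (cartan B H) :=
  LinearMap.snd ℂ ℂ ℂ ∘ₗ der ∘ₗ (cartan B H).subtype

/-- The root space `𝔗_β = {x | [h, x] = β(h) x for all h ∈ 𝔥^}`. -/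
def rootSpace (β : Module.Dual ℂ (cartan B H)) : Submodule ℂ (ExtDoubleAffine B) where
  carrier := {x | ∀ h : cartan B H, ⁅(h : ExtDoubleAffine B), x⁆ = β h • x}
  add_mem' {x y} hx hy h := by rw [lie_add, hx h, hy h, smul_add]
  zero_mem' h := by simp
  smul_mem' c x hx h := by rw [lie_smul, hx h, smul_comm]

lemma lie_mem_rootSpace {β γ : Module.Dual ℂ (cartan B H)} {x y : ExtDoubleAffine B}
    (hx : x ∈ rootSpace β) (hy : y ∈ rootSpace γ) : ⁅x, y⁆ ∈ rootSpace (β + γ) := by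
  intro h
  rw [leibniz_lie, hx h, hy h, smul_lie, lie_smul, ← add_smul, LinearMap.add_apply]

lemma exists_of_mem_cartan {x : ExtDoubleAffine B} (hx : x ∈ cartan B H) :
    ∃ a : H, ∃ c d : ℂ × ℂ, x = mk (Finsupp.single 0 (a : 𝔤)) c d := by
  obtain ⟨_, ⟨a, ha, rfl⟩, w, hw, rfl⟩ := Submodule.mem_sup.mp hx
  have hw' : w ∈ LinearMap.ker (loop (B := B)) := by
    refine Submodule.span_le.mpr ?_ hw
    rintro _ (rfl | rfl | rfl | rfl) <;> simp [c₁, c₂, d₁, d₂]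
  refine ⟨⟨a, ha⟩, cen w, der w, ?_⟩
  ext1
  · rw [map_add, LinearMap.mem_ker.mp hw', add_zero]; rfl
  · simp [elt]
  · simp [elt]

lemma delta_two_ne_zero : (δ₂ : Module.Dual ℂ (cartan B H)) ≠ 0 := by
  intro h
  have := LinearMap.congr_fun h ⟨d₂ B, d₂_mem_cartan B H⟩
  simp [δ₂, d₂] at this

variable (B H) in
/-- The root system `Δ_𝔗`: all nonzero `β` with `𝔗_β ≠ 0`. -/
def roots : Set (Module.Dual ℂ (cartan B H)) := {β | β ≠ 0 ∧ rootSpace β ≠ ⊥}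

end ExtDoubleAffine

section RootData

open LieAlgebra.IsKilling

variable {𝔤 : Type*} [LieRing 𝔤] [LieAlgebra ℂ 𝔤] [FiniteDimensional ℂ 𝔤]
  [LieAlgebra.IsSimple ℂ 𝔤] {B : InvariantForm 𝔤}
  {H : LieSubalgebra ℂ 𝔤} [H.IsCartanSubalgebra]

/-- The root `θ` is the longest (that is, highest) root with respect to the base `b`. -/
def IsLongestRoot (b : (rootSystem H).Base) (θ : H.root) : Prop :=
  ∀ α : H.root, b.height α ≤ b.height θ

namespace ExtDoubleAffine

/-- The functionals `α_i^*`, `i = 1, …, s`, on the span of `α_{-1} = δ₂ - θ`, `α_0 = δ₁ - θ`,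
`α_1, …, α_s`, dual to these roots, extended to `𝔥^*` by zero on the directions dual to `c₁, c₂`. -/
def dualSimple (b : (rootSystem H).Base) (θ : H.root) (i : b.support) :
    Module.Dual ℂ (cartan B H) →ₗ[ℂ] ℂ :=
  b.toWeightBasis.coord i ∘ₗ restrict
    + b.toWeightBasis.coord i ((rootSystem H).root θ) •
      (Module.Dual.eval ℂ _ ⟨d₁ B, d₁_mem_cartan B H⟩
        + Module.Dual.eval ℂ _ ⟨d₂ B, d₂_mem_cartan B H⟩)

variable (B H) in
/-- The functional `α_0^*`; it is evaluation at `d₁`. -/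
def dualSimpleZero : Module.Dual ℂ (cartan B H) →ₗ[ℂ] ℂ :=
  Module.Dual.eval ℂ _ ⟨d₁ B, d₁_mem_cartan B H⟩

variable (B H) in
/-- The functional `α_{-1}^*`; it is evaluation at `d₂`. -/
def dualSimpleNegOne : Module.Dual ℂ (cartan B H) →ₗ[ℂ] ℂ :=
  Module.Dual.eval ℂ _ ⟨d₂ B, d₂_mem_cartan B H⟩

/-- `φ = ∑_{i=0}^s α_i^* - ht(θ) α_{-1}^*`. -/
def phi (b : (rootSystem H).Base) (θ : H.root) : Module.Dual ℂ (cartan B H) →ₗ[ℂ] ℂ :=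
  dualSimpleZero B H + ∑ i : b.support, dualSimple b θ i
    - (b.height θ : ℂ) • dualSimpleNegOne B H

open scoped ComplexOrder in
variable (B) in
/-- The closed subset `𝓘 = {β ∈ Δ_𝔗 | φ(β) > 0} ∪ {n δ₂ | n = 1, 2, …}`. (The values of `φ` on
roots are integers; `0 < z` in `ℂ` means that `z` is a positive real number.) -/
def closedSubset (b : (rootSystem H).Base) (θ : H.root) : Set (Module.Dual ℂ (cartan B H)) :=
  {β | β ∈ roots B H ∧ 0 < phi b θ β} ∪ {β | ∃ n : ℕ, 0 < n ∧ β = (n : ℂ) • δ₂}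

variable (B) in
/-- `𝔗_𝓘 = ⨁_{β ∈ 𝓘} 𝔗_β`. -/
def posPart (b : (rootSystem H).Base) (θ : H.root) : Submodule ℂ (ExtDoubleAffine B) :=
  ⨆ β ∈ closedSubset B b θ, rootSpace β

/-! ### The imaginary Borel subalgebra and its character -/

variable (b : (rootSystem H).Base) (θ : H.root)

lemma lie_cartan_cartan {x y : ExtDoubleAffine B} (hx : x ∈ cartan B H) (hy : y ∈ cartan B H) :
    ⁅x, y⁆ = 0 := by
  obtain ⟨a, c, d, rfl⟩ := exists_of_mem_cartan hx
  obtain ⟨a', c', d', rfl⟩ := exists_of_mem_cartan hy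
  have h : ⁅(a : 𝔤), (a' : 𝔤)⁆ = 0 := by
    rw [← LieSubalgebra.coe_bracket, trivial_lie_zero, ZeroMemClass.coe_zero]
  ext1 <;> simp [h]

lemma cartan_le_rootSpace_zero : cartan B H ≤ rootSpace (0 : Module.Dual ℂ (cartan B H)) := by
  intro x hx h
  rw [lie_cartan_cartan h.2 hx, LinearMap.zero_apply, zero_smul]

lemma sum_coord_root :
    ∑ i : b.support, b.toWeightBasis.repr ((rootSystem H).root θ) i = (b.height θ : ℂ) := by
  obtain ⟨f, hf⟩ := b.exists_root_eq_sum_int θ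
  rw [b.height_eq_sum hf.2.2, hf.2.2, ← Finset.sum_coe_sort b.support f,
    ← Finset.sum_coe_sort b.support (fun j => f j • (rootSystem H).root j), Int.cast_sum]
  have h : ∑ j : b.support, f j • (rootSystem H).root j =
      ∑ j : b.support, (f j : ℂ) • b.toWeightBasis j :=
    Finset.sum_congr rfl fun j _ => by rw [b.toWeightBasis_apply, Int.cast_smul_eq_zsmul]
  refine Finset.sum_congr rfl fun i _ => ?_
  rw [h]
  exact congrFun (b.toWeightBasis.repr_sum_self (fun j => (f j : ℂ))) i

lemma phi_delta_two : phi b θ (δ₂ : Module.Dual ℂ (cartan B H)) = 0 := by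
  have h : restrict (δ₂ : Module.Dual ℂ (cartan B H)) = 0 := by
    ext x
    change (der (elt B 0 0 (x : 𝔤))).2 = 0
    simp [elt]
  have h₁ : (δ₂ : Module.Dual ℂ (cartan B H)) ⟨d₁ B, d₁_mem_cartan B H⟩ = 0 := rfl
  have h₂ : (δ₂ : Module.Dual ℂ (cartan B H)) ⟨d₂ B, d₂_mem_cartan B H⟩ = 1 := rfl
  simpa [phi, dualSimple, dualSimpleZero, dualSimpleNegOne, h, h₁, h₂, sub_eq_zero]
    using sum_coord_root b θ

open scoped ComplexOrder in
lemma phi_nonneg {β : Module.Dual ℂ (cartan B H)} (h : β ∈ closedSubset B b θ) :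
    0 ≤ phi b θ β := by
  rcases h with h | ⟨n, _, rfl⟩
  · exact h.2.le
  · simp [phi_delta_two]

lemma zero_notMem_closedSubset : (0 : Module.Dual ℂ (cartan B H)) ∉ closedSubset B b θ := by
  rintro (h | ⟨n, hn, h⟩)
  · exact h.1.1 rfl
  · rcases smul_eq_zero.mp h.symm with h | h
    · exact hn.ne' (by exact_mod_cast h)
    · exact delta_two_ne_zero h

open scoped ComplexOrder in
lemma lie_mem_posPart_of_rootSpace {β γ : Module.Dual ℂ (cartan B H)}
    (hβ : β ∈ closedSubset B b θ) (hγ : γ ∈ closedSubset B b θ) {x y : ExtDoubleAffine B}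
    (hx : x ∈ rootSpace β) (hy : y ∈ rootSpace γ) : ⁅x, y⁆ ∈ posPart B b θ := by
  have hxy := lie_mem_rootSpace hx hy
  by_cases h0 : rootSpace (β + γ) = ⊥
  · rw [h0, Submodule.mem_bot] at hxy
    rw [hxy]; exact zero_mem _
  suffices β + γ ∈ closedSubset B b θ from
    Submodule.mem_iSup_of_mem (β + γ) (Submodule.mem_iSup_of_mem this hxy)
  have key : 0 < phi b θ (β + γ) → β + γ ∈ closedSubset B b θ := fun h =>
    Or.inl ⟨⟨fun h' => by simp [h'] at h, h0⟩, h⟩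
  have hβ' := phi_nonneg b θ hβ
  have hγ' := phi_nonneg b θ hγ
  rcases hβ with hβ | ⟨m, hm, rfl⟩
  · exact key (by rw [map_add]; exact add_pos_of_pos_of_nonneg hβ.2 hγ')
  rcases hγ with hγ | ⟨n, hn, rfl⟩
  · exact key (by rw [map_add]; exact add_pos_of_nonneg_of_pos hβ' hγ.2)
  exact Or.inr ⟨m + n, by omega, by push_cast; rw [add_smul]⟩

lemma lie_posPart_posPart {x y : ExtDoubleAffine B} (hx : x ∈ posPart B b θ)
    (hy : y ∈ posPart B b θ) : ⁅x, y⁆ ∈ posPart B b θ := by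
  have h₁ : ∀ β ∈ closedSubset B b θ, ∀ u ∈ rootSpace β,
      posPart B b θ ≤ (posPart B b θ).comap (LieAlgebra.ad ℂ _ u : Module.End ℂ _) :=
    fun β hβ u hu => iSup₂_le fun γ hγ v hv => lie_mem_posPart_of_rootSpace b θ hβ hγ hu hv
  have h₂ : posPart B b θ ≤ (posPart B b θ).comap (LieAlgebra.ad ℂ _ y : Module.End ℂ _) := by
    refine iSup₂_le fun β hβ u hu => ?_
    change ⁅y, u⁆ ∈ posPart B b θ
    rw [← lie_skew]
    exact neg_mem (h₁ β hβ u hu hy)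
  rw [← lie_skew]
  exact neg_mem (h₂ hx)

lemma lie_cartan_posPart {x y : ExtDoubleAffine B} (hx : x ∈ cartan B H)
    (hy : y ∈ posPart B b θ) : ⁅x, y⁆ ∈ posPart B b θ := by
  have hle : posPart B b θ ≤ (posPart B b θ).comap (LieAlgebra.ad ℂ _ x : Module.End ℂ _) := by
    refine iSup₂_le fun γ hγ v hv => ?_
    have := lie_mem_rootSpace (cartan_le_rootSpace_zero hx) hv
    rw [zero_add] at this
    exact Submodule.mem_iSup_of_mem γ (Submodule.mem_iSup_of_mem hγ this)
  exact hle hy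

lemma lie_mem_posPart {x y : ExtDoubleAffine B} (hx : x ∈ cartan B H ⊔ posPart B b θ)
    (hy : y ∈ cartan B H ⊔ posPart B b θ) : ⁅x, y⁆ ∈ posPart B b θ := by
  obtain ⟨h, hh, u, hu, rfl⟩ := Submodule.mem_sup.mp hx
  obtain ⟨k, hk, v, hv, rfl⟩ := Submodule.mem_sup.mp hy
  rw [add_lie, lie_add, lie_add, lie_cartan_cartan hh hk, zero_add, ← lie_skew u k]
  exact add_mem (lie_cartan_posPart b θ hh hv)
    (add_mem (neg_mem (lie_cartan_posPart b θ hk hu)) (lie_posPart_posPart b θ hu hv))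

lemma disjoint_cartan_posPart : Disjoint (cartan B H) (posPart B b θ) := by
  let f : cartan B H → Module.End ℂ (ExtDoubleAffine B) := fun h => LieAlgebra.ad ℂ _ h
  have hcomm : ∀ i j, Commute (f i) (f j) := by
    intro i j
    refine LinearMap.ext fun v => ?_
    change ⁅(i : ExtDoubleAffine B), ⁅(j : ExtDoubleAffine B), v⁆⁆ =
      ⁅(j : ExtDoubleAffine B), ⁅(i : ExtDoubleAffine B), v⁆⁆
    rw [leibniz_lie, lie_cartan_cartan i.2 j.2, zero_lie, zero_add]
  have ind := Module.End.independent_iInf_maxGenEigenspace_of_forall_mapsTo f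
    fun i j μ => Module.End.mapsTo_maxGenEigenspace_of_comm (hcomm j i) μ
  have hle : ∀ β : Module.Dual ℂ (cartan B H),
      rootSpace β ≤ ⨅ i, (f i).maxGenEigenspace (β i) := by
    intro β v hv
    rw [Submodule.mem_iInf]
    intro i
    refine (Module.End.genEigenspace (f i) (β i)).monotone (show (1 : ℕ∞) ≤ ⊤ from le_top) ?_
    exact Module.End.mem_eigenspace_iff.mpr (hv i)
  have hinj : Function.Injective
      (fun (β : Module.Dual ℂ (cartan B H)) (i : cartan B H) => β i) := DFunLike.coe_injective
  have ind' : iSupIndep (rootSpace : Module.Dual ℂ (cartan B H) → _) :=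
    (ind.comp hinj).mono hle
  exact (ind'.disjoint_biSup (zero_notMem_closedSubset b θ)).mono_left cartan_le_rootSpace_zero

variable (B) in
/-- The imaginary Borel subalgebra `𝔟_𝓘 = 𝔥^ ⊕ 𝔗_𝓘`. -/
def borel : LieSubalgebra ℂ (ExtDoubleAffine B) where
  __ := cartan B H ⊔ posPart B b θ
  lie_mem' hx hy := Submodule.mem_sup_right (lie_mem_posPart b θ hx hy)

lemma borelCharacter_aux (lam : Module.Dual ℂ (cartan B H)) (h : cartan B H)
    (x : posPart B b θ) (hx : (h : ExtDoubleAffine B) = x) :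
    lam h = (0 : posPart B b θ →ₗ[ℂ] ℂ) x := by
  have h0 : (h : ExtDoubleAffine B) = 0 :=
    Submodule.disjoint_def.mp (disjoint_cartan_posPart b θ) _ h.2 (hx ▸ x.2)
  have : h = 0 := Subtype.ext h0
  simp [this]

/-- The linear functional `h + x ↦ λ(h)` on `𝔟_𝓘` (`h ∈ 𝔥^`, `x ∈ 𝔗_𝓘`): the common extension of
`λ` on `𝔥^` and zero on `𝔗_𝓘`. -/
def borelCharacter (lam : Module.Dual ℂ (cartan B H)) : borel B b θ →ₗ[ℂ] ℂ :=
  ((LinearPMap.mk (cartan B H) lam).sup (LinearPMap.mk (posPart B b θ) 0)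
    (borelCharacter_aux b θ lam)).toFun

lemma borelCharacter_apply (lam : Module.Dual ℂ (cartan B H)) {h x : ExtDoubleAffine B}
    (hh : h ∈ cartan B H) (hx : x ∈ posPart B b θ) :
    borelCharacter b θ lam
      ⟨h + x, add_mem (Submodule.mem_sup_left hh) (Submodule.mem_sup_right hx)⟩ =
      lam ⟨h, hh⟩ := by
  have h := LinearPMap.sup_apply (f := LinearPMap.mk (cartan B H) lam)
    (g := LinearPMap.mk (posPart B b θ) 0) (borelCharacter_aux b θ lam) ⟨h, hh⟩ ⟨x, hx⟩
    ⟨h + x, add_mem (Submodule.mem_sup_left hh) (Submodule.mem_sup_right hx)⟩ rfl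
  exact h.trans (add_zero _)

lemma borelCharacter_lie (lam : Module.Dual ℂ (cartan B H)) (x y : borel B b θ) :
    borelCharacter b θ lam ⁅x, y⁆ = 0 := by
  have h := borelCharacter_apply b θ lam (zero_mem _) (lie_mem_posPart b θ x.2 y.2)
  simp only [zero_add] at h
  exact h.trans (map_zero lam)

/-- The one-dimensional space `ℂ1_λ`. -/
def OneDim (_b : (rootSystem H).Base) (_θ : H.root) (_lam : Module.Dual ℂ (cartan B H)) : Type := ℂ

variable {b θ}

instance (lam : Module.Dual ℂ (cartan B H)) : AddCommGroup (OneDim b θ lam) :=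
  inferInstanceAs (AddCommGroup ℂ)

instance (lam : Module.Dual ℂ (cartan B H)) : Module ℂ (OneDim b θ lam) :=
  inferInstanceAs (Module ℂ ℂ)

/-- `𝔟_𝓘` acts on `ℂ1_λ` by `(h + x) 1_λ = λ(h) 1_λ` for `h ∈ 𝔥^`, `x ∈ 𝔗_𝓘`. -/
instance (lam : Module.Dual ℂ (cartan B H)) : LieRingModule (borel B b θ) (OneDim b θ lam) where
  bracket x z := borelCharacter b θ lam x • z
  add_lie x y z := by
    change borelCharacter b θ lam (x + y) • z = _
    rw [map_add, add_smul]
  lie_add x y z := smul_add _ _ _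
  leibniz_lie x y z := by
    change borelCharacter b θ lam x • borelCharacter b θ lam y • z =
      borelCharacter b θ lam ⁅x, y⁆ • z
        + borelCharacter b θ lam y • borelCharacter b θ lam x • z
    rw [borelCharacter_lie, zero_smul, zero_add, smul_comm]

lemma lie_oneDim (lam : Module.Dual ℂ (cartan B H)) (x : borel B b θ) (z : OneDim b θ lam) :
    ⁅x, z⁆ = borelCharacter b θ lam x • z := rfl

instance (lam : Module.Dual ℂ (cartan B H)) : LieModule ℂ (borel B b θ) (OneDim b θ lam) where
  smul_lie c x z := by rw [lie_oneDim, lie_oneDim, map_smul, smul_assoc]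
  lie_smul c x z := by rw [lie_oneDim, lie_oneDim, smul_comm]

end ExtDoubleAffine

end RootData

/-! ### Induced modules and the imaginary Verma module -/

section Induced

attribute [local instance 100] LieRing.ofAssociativeRing

variable {L : Type*} [LieRing L] [LieAlgebra ℂ L] (𝔟 : LieSubalgebra ℂ L)
  (V : Type*) [AddCommGroup V] [Module ℂ V] [LieRingModule 𝔟 V] [LieModule ℂ 𝔟 V]

/-- The algebra map `U(𝔟) → U(L)` induced by the inclusion of a Lie subalgebra. -/
def envelopingIncl : UniversalEnvelopingAlgebra ℂ 𝔟 →ₐ[ℂ] UniversalEnvelopingAlgebra ℂ L :=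
  UniversalEnvelopingAlgebra.lift ℂ ((UniversalEnvelopingAlgebra.ι ℂ).comp 𝔟.incl)

/-- The action `U(𝔟) → End V` of the enveloping algebra on a `𝔟`-module. -/
def envelopingAction : UniversalEnvelopingAlgebra ℂ 𝔟 →ₐ[ℂ] Module.End ℂ V :=
  UniversalEnvelopingAlgebra.lift ℂ (LieModule.toEnd ℂ 𝔟 V)

/-- The `U(L)`-submodule of `U(L) ⊗_ℂ V` generated by the elements `u b ⊗ v - u ⊗ b v` with
`b ∈ U(𝔟)`. -/
def balancingSubmodule :
    Submodule (UniversalEnvelopingAlgebra ℂ L) (UniversalEnvelopingAlgebra ℂ L ⊗[ℂ] V) :=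
  Submodule.span _ {w | ∃ (u : UniversalEnvelopingAlgebra ℂ L)
    (a : UniversalEnvelopingAlgebra ℂ 𝔟) (v : V),
    w = (u * envelopingIncl 𝔟 a) ⊗ₜ[ℂ] v - u ⊗ₜ[ℂ] envelopingAction 𝔟 V a v}

/-- The induced module `U(L) ⊗_{U(𝔟)} V`: the balanced tensor product, that is the quotient of
`U(L) ⊗_ℂ V` by the relations `u b ⊗ v = u ⊗ b v`, `b ∈ U(𝔟)`. -/
abbrev InducedModule : Type _ :=
  (UniversalEnvelopingAlgebra ℂ L ⊗[ℂ] V) ⧸ balancingSubmodule 𝔟 V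

end Induced

/-- The imaginary Verma module `U(𝔗) ⊗_{U(𝔟_𝓘)} ℂ1_λ`, a module over `U(𝔗)`, equivalently over
`𝔗`. -/
abbrev ImaginaryVermaModule {𝔤 : Type*} [LieRing 𝔤] [LieAlgebra ℂ 𝔤] [FiniteDimensional ℂ 𝔤]
    [LieAlgebra.IsSimple ℂ 𝔤] {B : InvariantForm 𝔤} {H : LieSubalgebra ℂ 𝔤}
    [H.IsCartanSubalgebra] (b : (LieAlgebra.IsKilling.rootSystem H).Base) (θ : H.root)
    (lam : Module.Dual ℂ (ExtDoubleAffine.cartan B H)) : Type _ :=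
  InducedModule (ExtDoubleAffine.borel B b θ) (ExtDoubleAffine.OneDim b θ lam)

end

/-!
# Irreducibility of imaginary Verma modules

Let `ρ ∈ 𝔥` be the element with `α(ρ) = 1` for all simple roots `α`, and grade `𝔗` by the
eigenvalues of `ρ + (ht θ + 1) d₁` and of `d₂`, that is by `ℤ × ℤ` with the lexicographic order;
the first eigenvalue, here called the level, is `φ` on the root spaces. Since the heights of the
roots are less than `ht θ + 1` in absolute value, the pieces of degree zero, of positive degree and
of negative degree are the Cartan subalgebra, the subspace `𝔗_𝓘`, and a subalgebra `𝔞`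
complementary to the imaginary Borel subalgebra (`HomogeneousBasis.grading`,
`HomogeneousBasis.isCompl_borel`).

The Poincaré–Birkhoff–Witt theorem is not needed. A Lie algebra `𝔞 ⊕ 𝔟` with a character of `𝔟`
acts on `U(𝔞)` such that `𝔞` acts by left multiplication and `𝔟` acts on `1` by the character
(`complRep`). So the imaginary Verma module maps to `U(𝔞)` and its generator `w` maps to `1`; in
particular `w ≠ 0`.

Suppose that `λ(c₂) ≠ 0`. It suffices that every nonzero vector `v` generates `w`
(`TriangularGrading.mem_of_ne_zero`). Filter the module by the words in a homogeneous basis `y_j`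
of `𝔞`, first by level and then by length. Modulo lower terms `v` is the image of a nonzero
polynomial in commuting variables `X_j`, its symbol. An element `x` of positive level acts on
symbols by the derivation `X_j ↦ [x, y_j] mod 𝔟`. If the symbol has negative level, an `x` of very
negative degree in `t₂` can be chosen such that its derivation does not kill the symbol: it
introduces variables that do not occur in the symbol, and their coefficients are combinations of
partial derivatives which can be prescribed (`HomogeneousBasis.exists_adDer_ne_zero_of_level_neg`).
Since the level is at most zero, it can be raised to zero in this way. At level zero there are only
the variables of `𝔥 ⊗ t₂⁻¹ℂ[t₂⁻¹]`, and `h(0, n)` with `n > 0` acts by `λ(c₂)` times a nonzero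
multiple of a partial derivative, so that the symbol can be lowered to a nonzero constant
(`HomogeneousBasis.detects`).

Suppose that `λ(c₂) = 0`. Then `u = h(0, -1) w` with `0 ≠ h ∈ 𝔥` is killed by `𝔗_𝓘` and is a weight
vector, so the submodule generated by `u` is spanned by the words in `𝔞` applied to `u`. Its image
in `U(𝔞)` is in the kernel of the augmentation and does not contain `1`. A character of `𝔞` shows
that `u ≠ 0` (`HomogeneousBasis.exists_negPart_character`), so the submodule is proper and nonzero.
-/

noncomputable section

/-! ### The module of a complement of a subalgebra with a character -/

section ComplementModule

attribute [local instance 100] LieRing.ofAssociativeRing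

open UniversalEnvelopingAlgebra

namespace UniversalEnvelopingAlgebra

variable {R L : Type*} [CommRing R] [LieRing L] [LieAlgebra R L]

lemma adjoin_range_ι :
    Algebra.adjoin R (Set.range (ι R : L → UniversalEnvelopingAlgebra R L)) = ⊤ := by
  set S := Algebra.adjoin R (Set.range (ι R : L → UniversalEnvelopingAlgebra R L)) with hS
  let f : L →ₗ⁅R⁆ S :=
    { toFun := fun x => ⟨ι R x, Algebra.subset_adjoin ⟨x, rfl⟩⟩
      map_add' := fun x y => Subtype.ext (by simp)
      map_smul' := fun c x => Subtype.ext (by simp)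
      map_lie' := fun {x y} => Subtype.ext (by
        rw [LieRing.of_associative_ring_bracket]
        simp [LieRing.of_associative_ring_bracket]) }
  have h : S.val.comp (lift R f) = AlgHom.id R _ := by
    apply hom_ext
    ext x
    simp only [LieHom.comp_apply, AlgHom.coe_toLieHom, AlgHom.comp_apply, lift_ι_apply]
    rfl
  refine eq_top_iff.mpr fun u _ => ?_
  have := DFunLike.congr_fun h u
  rw [AlgHom.id_apply] at this
  rw [← this]
  exact (lift R f u).2

/-- Induction on `U(L)` by left multiplication with elements of `L`, starting from `1`. -/
lemma induction_left {P : UniversalEnvelopingAlgebra R L → Prop} (one : P 1)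
    (add : ∀ u v, P u → P v → P (u + v)) (smul : ∀ (c : R) u, P u → P (c • u))
    (mul : ∀ x u, P u → P (ι R x * u)) (u : UniversalEnvelopingAlgebra R L) : P u := by
  have zero : P 0 := by simpa using smul 0 1 one
  have key : ∀ a : UniversalEnvelopingAlgebra R L, ∀ u, P u → P (a * u) := by
    intro a
    have ha : a ∈ Algebra.adjoin R (Set.range (ι R : L → UniversalEnvelopingAlgebra R L)) := by
      rw [adjoin_range_ι]; trivial
    induction ha using Algebra.adjoin_induction with
    | mem x hx => obtain ⟨x, rfl⟩ := hx; exact mul x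
    | algebraMap r => intro u hu; rw [← Algebra.smul_def]; exact smul r u hu
    | add x y _ _ hx hy => intro u hu; rw [add_mul]; exact add _ _ (hx u hu) (hy u hu)
    | mul x y _ _ hx hy => intro u hu; rw [mul_assoc]; exact hx _ (hy u hu)
  simpa using key u 1 one

end UniversalEnvelopingAlgebra

section Construction

variable {R L : Type*} [CommRing R] [LieRing L] [LieAlgebra R L] {𝔞 𝔟 : LieSubalgebra R L}
  (hc : IsCompl 𝔞.toSubmodule 𝔟.toSubmodule)

/-- The component in `𝔞` of an element of `L = 𝔞 ⊕ 𝔟`. -/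
abbrev projLeft : L →ₗ[R] 𝔞 := Submodule.projectionOnto _ _ hc

/-- The component in `𝔟` of an element of `L = 𝔞 ⊕ 𝔟`. -/
abbrev projRight : L →ₗ[R] 𝔟 := Submodule.projectionOnto _ _ hc.symm

lemma projLeft_left (a : 𝔞) : projLeft hc (a : L) = a := Submodule.projectionOnto_apply_left hc a

lemma projLeft_right (b : 𝔟) : projLeft hc (b : L) = 0 :=
  (Submodule.projectionOnto_apply_eq_zero_iff hc).mpr b.2

lemma projRight_right (b : 𝔟) : projRight hc (b : L) = b :=
  Submodule.projectionOnto_apply_left hc.symm b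

lemma projRight_left (a : 𝔞) : projRight hc (a : L) = 0 :=
  (Submodule.projectionOnto_apply_eq_zero_iff hc.symm).mpr a.2

lemma projLeft_add_projRight (x : L) : (projLeft hc x : L) + (projRight hc x : L) = x := by
  have h := (Submodule.prodEquivOfIsCompl _ _ hc).apply_symm_apply x
  have e : projRight hc x = ((Submodule.prodEquivOfIsCompl _ _ hc).symm x).2 := by
    conv_lhs => rw [← h]
    rw [Submodule.coe_prodEquivOfIsCompl', map_add]
    exact (congrArg₂ (· + ·) (projRight_left hc _) (projRight_right hc _)).trans (zero_add _)
  rw [e]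
  exact h

/-- The action of `𝔞` on pairs `(u, r)` of an element `u` of `U(𝔞)` and a linear map
`r : 𝔟 → U(𝔞)`. The second component is dictated by the requirement that, if `r b` is to be
`b • u`, then the new second component has to send `b` to
`b • (a • u) = a • (b • u) + [b, a] • u`. -/
def pairAction : 𝔞 →ₗ[R] Module.End R
    (UniversalEnvelopingAlgebra R 𝔞 × (𝔟 →ₗ[R] UniversalEnvelopingAlgebra R 𝔞)) :=
  LinearMap.mk₂ R
    (fun a p => (ι R a * p.1,
      LinearMap.mulLeft R (ι R a) ∘ₗ p.2
        + (LinearMap.mulRight R p.1 ∘ₗ (ι R : 𝔞 →ₗ⁅R⁆ _).toLinearMap ∘ₗ projLeft hc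
            + p.2 ∘ₗ projRight hc) ∘ₗ (LieModule.toEnd R L L : L →ₗ[R] L →ₗ[R] L).flip a ∘ₗ
              𝔟.toSubmodule.subtype))
    (fun a a' p => by
      refine Prod.ext (by simp [add_mul]) (LinearMap.ext fun b => ?_)
      simp [add_mul]; abel)
    (fun c a p => by
      refine Prod.ext (by simp) (LinearMap.ext fun b => ?_)
      simp [smul_add])
    (fun a p q => by
      refine Prod.ext (by simp [mul_add]) (LinearMap.ext fun b => ?_)
      simp [mul_add]; abel)
    (fun c a p => by
      refine Prod.ext (by simp) (LinearMap.ext fun b => ?_)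
      simp [smul_add])

lemma pairAction_fst (a : 𝔞)
    (p : UniversalEnvelopingAlgebra R 𝔞 × (𝔟 →ₗ[R] UniversalEnvelopingAlgebra R 𝔞)) :
    (pairAction hc a p).1 = ι R a * p.1 := rfl

lemma pairAction_snd (a : 𝔞)
    (p : UniversalEnvelopingAlgebra R 𝔞 × (𝔟 →ₗ[R] UniversalEnvelopingAlgebra R 𝔞)) (b : 𝔟) :
    (pairAction hc a p).2 b = ι R a * p.2 b + ι R (projLeft hc ⁅(b : L), (a : L)⁆) * p.1
      + p.2 (projRight hc ⁅(b : L), (a : L)⁆) := by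
  simp [pairAction, add_assoc]
  rfl

lemma pairAction_lie (a a' : 𝔞) :
    pairAction hc ⁅a, a'⁆ = ⁅pairAction hc a, pairAction hc a'⁆ := by
  refine LinearMap.ext fun p => Prod.ext ?_ (LinearMap.ext fun b => ?_)
  · rw [LieRing.of_associative_ring_bracket]
    simp only [LinearMap.sub_apply, Module.End.mul_apply, Prod.fst_sub, pairAction_fst,
      LieHom.map_lie, LieRing.of_associative_ring_bracket, sub_mul, mul_assoc]
  · rw [LieRing.of_associative_ring_bracket]
    have hj : ⁅(b : L), ((⁅a, a'⁆ : 𝔞) : L)⁆ =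
        (⁅projLeft hc ⁅(b : L), (a : L)⁆, a'⁆ : 𝔞)
        + ⁅(projRight hc ⁅(b : L), (a : L)⁆ : L), (a' : L)⁆
        - ((⁅projLeft hc ⁅(b : L), (a' : L)⁆, a⁆ : 𝔞)
        + ⁅(projRight hc ⁅(b : L), (a' : L)⁆ : L), (a : L)⁆) := by
      simp only [LieSubalgebra.coe_bracket, ← add_lie, projLeft_add_projRight]
      rw [leibniz_lie, ← lie_skew ⁅(b : L), (a' : L)⁆]; abel
    simp only [LinearMap.sub_apply, Module.End.mul_apply, Prod.snd_sub, pairAction_snd,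
      pairAction_fst]
    rw [hj]
    simp only [map_add, map_sub, projLeft_left, projRight_left,
      LieHom.map_lie, LieRing.of_associative_ring_bracket]
    noncomm_ring

/-- `pairAction` as a representation of `𝔞`. -/
def pairRep : 𝔞 →ₗ⁅R⁆ Module.End R
    (UniversalEnvelopingAlgebra R 𝔞 × (𝔟 →ₗ[R] UniversalEnvelopingAlgebra R 𝔞)) :=
  { pairAction hc with map_lie' := fun {a a'} => pairAction_lie hc a a' }

variable (χ : 𝔟 →ₗ[R] R)

/-- The orbit map of `U(𝔞)` through `(1, χ)` for `pairAction`. -/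
def pairOrbit : UniversalEnvelopingAlgebra R 𝔞 →ₗ[R]
    UniversalEnvelopingAlgebra R 𝔞 × (𝔟 →ₗ[R] UniversalEnvelopingAlgebra R 𝔞) :=
  (LinearMap.toSpanSingleton R (UniversalEnvelopingAlgebra R 𝔞) 1 ∘ₗ χ |>
    fun r => LinearMap.applyₗ (1, r)) ∘ₗ (lift R (pairRep hc)).toLinearMap

lemma pairOrbit_one : pairOrbit hc χ 1 = (1, LinearMap.toSpanSingleton R _ 1 ∘ₗ χ) := by
  simp [pairOrbit]

lemma pairOrbit_ι_mul (a : 𝔞) (u : UniversalEnvelopingAlgebra R 𝔞) :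
    pairOrbit hc χ (ι R a * u) = pairAction hc a (pairOrbit hc χ u) := by
  simp only [pairOrbit, LinearMap.comp_apply, AlgHom.toLinearMap_apply, map_mul, lift_ι_apply,
    LinearMap.applyₗ_apply_apply, Module.End.mul_apply]
  rfl

lemma pairOrbit_fst (u : UniversalEnvelopingAlgebra R 𝔞) : (pairOrbit hc χ u).1 = u := by
  induction u using induction_left with
  | one => rw [pairOrbit_one]
  | add u v hu hv => rw [map_add, Prod.fst_add, hu, hv]
  | smul c u hu => rw [map_smul, Prod.smul_fst, hu]
  | mul a u hu => rw [pairOrbit_ι_mul, pairAction_fst, hu]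

/-- The action of `L = 𝔞 ⊕ 𝔟` on `U(𝔞)` for which `𝔞` acts by left multiplication and `b ∈ 𝔟`
acts on `1` by the scalar `χ b`. -/
def complAction : L →ₗ[R] Module.End R (UniversalEnvelopingAlgebra R 𝔞) :=
  LinearMap.mul R _ ∘ₗ (ι R : 𝔞 →ₗ⁅R⁆ _).toLinearMap ∘ₗ projLeft hc
    + (LinearMap.snd R _ _ ∘ₗ pairOrbit hc χ).flip ∘ₗ projRight hc

lemma complAction_left (a : 𝔞) (u : UniversalEnvelopingAlgebra R 𝔞) :
    complAction hc χ a u = ι R a * u := by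
  simp only [complAction, LinearMap.add_apply, LinearMap.comp_apply, projLeft_left,
    projRight_left, map_zero, add_zero]
  rfl

lemma complAction_right (b : 𝔟) (u : UniversalEnvelopingAlgebra R 𝔞) :
    complAction hc χ b u = (pairOrbit hc χ u).2 b := by
  simp only [complAction, LinearMap.add_apply, LinearMap.comp_apply, projLeft_right,
    projRight_right, map_zero, zero_add]
  rfl

lemma complAction_one (b : 𝔟) :
    complAction hc χ b 1 = χ b • (1 : UniversalEnvelopingAlgebra R 𝔞) := by
  rw [complAction_right, pairOrbit_one]; rfl

/-- The relation that the definition of `pairAction` enforces. -/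
lemma complAction_comm_left (x : L) (a : 𝔞) (u : UniversalEnvelopingAlgebra R 𝔞) :
    complAction hc χ x (complAction hc χ a u) =
      complAction hc χ a (complAction hc χ x u) + complAction hc χ ⁅x, (a : L)⁆ u := by
  have split : ∀ (y : L) v, complAction hc χ y v =
      ι R (projLeft hc y) * v + (pairOrbit hc χ v).2 (projRight hc y) := fun y v => by
    conv_lhs => rw [← projLeft_add_projRight hc y, map_add, LinearMap.add_apply,
      complAction_left, complAction_right]
  conv_lhs => rw [← projLeft_add_projRight hc x]
  rw [map_add, LinearMap.add_apply, complAction_left, complAction_left, complAction_right,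
    pairOrbit_ι_mul, pairAction_snd, pairOrbit_fst]
  rw [complAction_left, split x u, add_assoc, ← split]
  have hx : ⁅x, (a : L)⁆ = (⁅projLeft hc x, a⁆ : 𝔞) + ⁅(projRight hc x : L), (a : L)⁆ := by
    rw [LieSubalgebra.coe_bracket, ← add_lie, projLeft_add_projRight]
  rw [hx, map_add, LinearMap.add_apply, complAction_left, LieHom.map_lie,
    LieRing.of_associative_ring_bracket]
  noncomm_ring

/-- For `x` and `y` acting on `1` only the pair `x, y ∈ 𝔟` is not an instance of
`complAction_comm_left`, and there the character property enters; the identity then propagates from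
`u` to `ι a * u` by the Jacobi identity. -/
lemma complAction_lie (hχ : ∀ b b' : 𝔟, χ ⁅b, b'⁆ = 0) (x y : L)
    (u : UniversalEnvelopingAlgebra R 𝔞) :
    complAction hc χ ⁅x, y⁆ u =
      complAction hc χ x (complAction hc χ y u) - complAction hc χ y (complAction hc χ x u) := by
  induction u using induction_left generalizing x y with
  | one =>
    have h₁ : ∀ (x : L) (a : 𝔞), complAction hc χ ⁅x, (a : L)⁆ 1 =
        complAction hc χ x (complAction hc χ a 1) - complAction hc χ a (complAction hc χ x 1) :=
      fun x a => by rw [complAction_comm_left]; abel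
    have h₂ : ∀ (x : L) (a : 𝔞), complAction hc χ ⁅(a : L), x⁆ 1 =
        complAction hc χ a (complAction hc χ x 1) - complAction hc χ x (complAction hc χ a 1) :=
      fun x a => by rw [← lie_skew, map_neg, LinearMap.neg_apply, h₁, neg_sub]
    have h₃ : ∀ b b' : 𝔟, complAction hc χ ⁅(b : L), (b' : L)⁆ 1 =
        complAction hc χ b (complAction hc χ b' 1) - complAction hc χ b' (complAction hc χ b 1) :=
      fun b b' => by
        rw [← LieSubalgebra.coe_bracket, complAction_one, hχ, zero_smul, complAction_one,
          complAction_one, map_smul, map_smul, complAction_one, complAction_one, smul_comm,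
          sub_self]
    rw [← projLeft_add_projRight hc x, ← projLeft_add_projRight hc y]
    simp only [add_lie, lie_add, map_add, LinearMap.add_apply]
    rw [h₁, h₁, h₂, h₃]
    abel
  | add u v hu hv => simp only [map_add, hu, hv]; abel
  | smul c u hu => simp only [map_smul, hu, smul_sub]
  | mul a u hu =>
    rw [← complAction_left hc χ, complAction_comm_left, complAction_comm_left hc χ y,
      complAction_comm_left hc χ x, map_add, map_add, complAction_comm_left,
      complAction_comm_left, hu, map_sub]
    have e : ⁅⁅x, y⁆, (a : L)⁆ = ⁅x, ⁅y, (a : L)⁆⁆ - ⁅y, ⁅x, (a : L)⁆⁆ := lie_lie x y (a : L)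
    rw [e, map_sub, LinearMap.sub_apply, hu x ⁅y, (a : L)⁆, hu y ⁅x, (a : L)⁆]
    abel

/-- `complAction` as a representation of `L`: the module induced from the character `χ` of `𝔟`,
realized on `U(𝔞)`. -/
def complRep (hχ : ∀ b b' : 𝔟, χ ⁅b, b'⁆ = 0) :
    L →ₗ⁅R⁆ Module.End R (UniversalEnvelopingAlgebra R 𝔞) :=
  { complAction hc χ with
    map_lie' := fun {x y} => LinearMap.ext fun u => complAction_lie hc χ hχ x y u }

end Construction

end ComplementModule

/-! ### Representations on induced modules -/

section InducedRepresentation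

attribute [local instance 100] LieRing.ofAssociativeRing

open UniversalEnvelopingAlgebra

variable {L : Type*} [LieRing L] [LieAlgebra ℂ L]

variable (L) in
/-- The representation of `L` on a module over `U(L)`. -/
def envelopingRep (M : Type*) [AddCommGroup M] [Module ℂ M]
    [Module (UniversalEnvelopingAlgebra ℂ L) M] [IsScalarTower ℂ (UniversalEnvelopingAlgebra ℂ L) M]
    [SMulCommClass (UniversalEnvelopingAlgebra ℂ L) ℂ M] :
    L →ₗ⁅ℂ⁆ Module.End ℂ M :=
  (Algebra.lsmul ℂ ℂ M : UniversalEnvelopingAlgebra ℂ L →ₐ[ℂ] Module.End ℂ M).toLieHom.comp (ι ℂ)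

section

variable {M : Type*} [AddCommGroup M] [Module ℂ M]
    [Module (UniversalEnvelopingAlgebra ℂ L) M] [IsScalarTower ℂ (UniversalEnvelopingAlgebra ℂ L) M]
    [SMulCommClass (UniversalEnvelopingAlgebra ℂ L) ℂ M]

lemma envelopingRep_apply (x : L) (m : M) : envelopingRep L M x m = ι ℂ x • m := rfl

lemma smul_mem_of_envelopingRep_mem (W : Submodule ℂ M)
    (hW : ∀ x : L, ∀ m ∈ W, envelopingRep L M x m ∈ W) (u : UniversalEnvelopingAlgebra ℂ L)
    {m : M} (hm : m ∈ W) : u • m ∈ W := by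
  induction u using induction_left with
  | one => rwa [one_smul]
  | add u v hu hv => rw [add_smul]; exact add_mem hu hv
  | smul c u hu => rw [smul_assoc]; exact W.smul_mem c hu
  | mul x u hu => rw [mul_smul]; exact hW x _ hu

lemma eq_top_of_isSimpleModule [IsSimpleModule (UniversalEnvelopingAlgebra ℂ L) M]
    (W : Submodule ℂ M) (hW : ∀ x : L, ∀ m ∈ W, envelopingRep L M x m ∈ W) {m : M} (hm : m ∈ W)
    (hm0 : m ≠ 0) : W = ⊤ := by
  let W' : Submodule (UniversalEnvelopingAlgebra ℂ L) M :=
    { W with smul_mem' := fun u _ hm => smul_mem_of_envelopingRep_mem W hW u hm }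
  have h : W' = ⊤ := (eq_bot_or_eq_top W').resolve_left fun h =>
    hm0 ((Submodule.mem_bot _).mp (h ▸ (show m ∈ W' from hm)))
  exact eq_top_iff.mpr fun m _ => (show m ∈ W' from h ▸ Submodule.mem_top)

end

variable (𝔟 : LieSubalgebra ℂ L)
  {V : Type*} [AddCommGroup V] [Module ℂ V] [LieRingModule 𝔟 V] [LieModule ℂ 𝔟 V]

lemma mk_mul_envelopingIncl (u : UniversalEnvelopingAlgebra ℂ L)
    (a : UniversalEnvelopingAlgebra ℂ 𝔟) (v : V) :
    (Submodule.Quotient.mk ((u * envelopingIncl 𝔟 a) ⊗ₜ[ℂ] v) : InducedModule 𝔟 V) =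
      Submodule.Quotient.mk (u ⊗ₜ[ℂ] envelopingAction 𝔟 V a v) :=
  (Submodule.Quotient.eq _).mpr (Submodule.subset_span ⟨u, a, v, rfl⟩)

lemma envelopingRep_mk (x : 𝔟) (v : V) :
    envelopingRep L (InducedModule 𝔟 V) x (Submodule.Quotient.mk (1 ⊗ₜ[ℂ] v)) =
      Submodule.Quotient.mk (1 ⊗ₜ[ℂ] ⁅x, v⁆) := by
  have h := mk_mul_envelopingIncl 𝔟 1 (ι ℂ x) v
  rw [one_mul, envelopingIncl, envelopingAction, lift_ι_apply, lift_ι_apply] at h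
  rw [envelopingRep_apply, ← Submodule.Quotient.mk_smul, TensorProduct.smul_tmul', smul_eq_mul,
    mul_one]
  exact h

lemma eq_top_of_mk_mem (W : Submodule ℂ (InducedModule 𝔟 V))
    (hW : ∀ x : L, ∀ m ∈ W, envelopingRep L (InducedModule 𝔟 V) x m ∈ W)
    (h : ∀ v : V, Submodule.Quotient.mk (1 ⊗ₜ[ℂ] v) ∈ W) : W = ⊤ := by
  refine eq_top_iff.mpr fun m _ => ?_
  obtain ⟨t, rfl⟩ := Submodule.Quotient.mk_surjective _ m
  induction t with
  | zero => exact zero_mem _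
  | add s t hs ht =>
    rw [Submodule.Quotient.mk_add]
    exact add_mem (hs trivial) (ht trivial)
  | tmul u v =>
    have := smul_mem_of_envelopingRep_mem W hW u (h v)
    rwa [← Submodule.Quotient.mk_smul, TensorProduct.smul_tmul', smul_eq_mul, mul_one] at this

/-- Frobenius reciprocity: a `𝔟`-equivariant map from `V` to a representation of `L` extends to
the induced module. -/
lemma exists_inducedModule_lift {N : Type*} [AddCommGroup N] [Module ℂ N]
    (f : L →ₗ⁅ℂ⁆ Module.End ℂ N) (g : V →ₗ[ℂ] N) (hg : ∀ (x : 𝔟) v, f x (g v) = g ⁅x, v⁆) :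
    ∃ G : InducedModule 𝔟 V →ₗ[ℂ] N,
      (∀ x m, G (envelopingRep L (InducedModule 𝔟 V) x m) = f x (G m)) ∧
      ∀ v : V, G (Submodule.Quotient.mk (1 ⊗ₜ[ℂ] v)) = g v := by
  let φ : UniversalEnvelopingAlgebra ℂ L ⊗[ℂ] V →ₗ[ℂ] N :=
    TensorProduct.lift ((LinearMap.lcomp ℂ N g).comp (lift ℂ f).toLinearMap)
  have hφ : ∀ u v, φ (u ⊗ₜ v) = lift ℂ f u (g v) := fun u v => rfl
  have hsmul : ∀ (u : UniversalEnvelopingAlgebra ℂ L) (t : UniversalEnvelopingAlgebra ℂ L ⊗[ℂ] V),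
      φ (u • t) = lift ℂ f u (φ t) := by
    intro u t
    induction t with
    | zero => simp
    | add s t hs ht => rw [smul_add, map_add, map_add, map_add, hs, ht]
    | tmul a v => rw [TensorProduct.smul_tmul', smul_eq_mul, hφ, hφ, map_mul]; rfl
  have hact : ∀ (a : UniversalEnvelopingAlgebra ℂ 𝔟) v,
      lift ℂ f (envelopingIncl 𝔟 a) (g v) = g (envelopingAction 𝔟 V a v) := by
    intro a
    induction a using induction_left with
    | one => intro v; simp
    | add a b ha hb => intro v; simp [ha, hb]
    | smul c a ha => intro v; simp [ha]
    | mul x a ha =>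
      intro v
      rw [map_mul, map_mul, Module.End.mul_apply, ha, map_mul, Module.End.mul_apply,
        envelopingIncl, lift_ι_apply, LieHom.comp_apply, lift_ι_apply]
      conv_rhs => rw [envelopingAction, lift_ι_apply]
      exact hg x _
  have hker : (balancingSubmodule 𝔟 V).restrictScalars ℂ ≤ LinearMap.ker φ := by
    intro t ht
    rw [LinearMap.mem_ker]
    rw [Submodule.restrictScalars_mem] at ht
    induction ht using Submodule.span_induction with
    | mem t ht =>
      obtain ⟨u, a, v, rfl⟩ := ht
      rw [map_sub, hφ, hφ, map_mul, Module.End.mul_apply, hact, sub_self]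
    | zero => exact map_zero _
    | add s t _ _ hs ht => rw [map_add, hs, ht, add_zero]
    | smul u t _ ht => rw [hsmul, ht, map_zero]
  refine ⟨Submodule.liftQ _ φ hker ∘ₗ
    (Submodule.Quotient.restrictScalarsEquiv ℂ (balancingSubmodule 𝔟 V)).symm.toLinearMap,
    fun x m => ?_, fun v => ?_⟩
  · obtain ⟨t, rfl⟩ := Submodule.Quotient.mk_surjective _ m
    exact (hsmul (ι ℂ x) t).trans (by rw [lift_ι_apply]; rfl)
  · exact (hφ 1 v).trans (by rw [map_one]; rfl)

end InducedRepresentation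

/-! ### Words in the negative part of a graded Lie algebra -/

section SymbolCalculus

attribute [local instance 100] LieRing.ofAssociativeRing

/-- A grading of a Lie algebra by an ordered abelian group `Γ`, with a basis `vec` of the sum of
the pieces of negative degree, and a monotone homomorphism `level : Γ → ℤ` that coarsens the
grading. -/
structure TriangularGrading (L : Type*) [LieRing L] [LieAlgebra ℂ L] (J Γ : Type*)
    [AddCommGroup Γ] [LinearOrder Γ] [IsOrderedAddMonoid Γ] where
  /-- The graded pieces. -/
  piece : Γ → Submodule ℂ L
  lie_mem : ∀ {D E : Γ} {x y : L}, x ∈ piece D → y ∈ piece E → ⁅x, y⁆ ∈ piece (D + E)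
  iSup_piece : ⨆ D, piece D = ⊤
  /-- The coarsening of the degree. -/
  level : Γ →+ ℤ
  level_mono : Monotone level
  /-- The homogeneous basis of the negative part. -/
  vec : J → L
  /-- The degrees of the basis vectors. -/
  deg : J → Γ
  vec_mem : ∀ j, vec j ∈ piece (deg j)
  deg_neg : ∀ j, deg j < 0
  /-- The coordinates of the negative part of a vector. -/
  coord : L →ₗ[ℂ] J →₀ ℂ
  coord_vec : ∀ j, coord (vec j) = Finsupp.single j 1
  coord_of_nonneg : ∀ {D : Γ} {x : L}, 0 ≤ D → x ∈ piece D → coord x = 0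
  eq_sum_coord : ∀ {D : Γ} {x : L}, D < 0 → x ∈ piece D →
    x = (coord x).sum fun j a => a • vec j
  deg_of_coord : ∀ {D : Γ} {x : L} {j : J}, x ∈ piece D → coord x j ≠ 0 → deg j = D

namespace TriangularGrading

variable {L : Type*} [LieRing L] [LieAlgebra ℂ L] {J Γ : Type*}
    [AddCommGroup Γ] [LinearOrder Γ] [IsOrderedAddMonoid Γ] (S : TriangularGrading L J Γ)
  {M : Type*} [AddCommGroup M] [Module ℂ M] (ρ : L →ₗ⁅ℂ⁆ Module.End ℂ M) (w : M)

lemma rep_comm (x y : L) (m : M) : ρ x (ρ y m) = ρ y (ρ x m) + ρ ⁅x, y⁆ m := by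
  rw [LieHom.map_lie, LieRing.of_associative_ring_bracket]
  simp

/-- A vector `w` of a representation that is killed by the positive part of `L` and is a common
eigenvector for the part of degree zero. -/
structure IsHighest : Prop where
  pos : ∀ {D : Γ} {x : L}, 0 < D → x ∈ S.piece D → ρ x w = 0
  zero : ∀ {x : L}, x ∈ S.piece 0 → ∃ c : ℂ, ρ x w = c • w

/-- The vector obtained from `w` by applying the basis vectors indexed by a list. -/
def word : List J → M
  | [] => w
  | j :: l => ρ (S.vec j) (word l)

/-- The total level of a list. -/
def wt (l : List J) : ℤ := (l.map fun j => S.level (S.deg j)).sum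

@[simp] lemma wt_nil : S.wt [] = 0 := rfl
@[simp] lemma wt_cons (j : J) (l : List J) : S.wt (j :: l) = S.level (S.deg j) + S.wt l := by
  simp [wt]

lemma level_deg_nonpos (j : J) : S.level (S.deg j) ≤ 0 := by
  simpa using S.level_mono (S.deg_neg j).le

lemma wt_nonpos (l : List J) : S.wt l ≤ 0 := by
  induction l with
  | nil => simp
  | cons j l ih => rw [wt_cons]; have := S.level_deg_nonpos j; omega

/-- The span of the words of total level `c` and length less than `k`. -/
def short (c : ℤ) (k : ℕ) : Submodule ℂ M :=
  Submodule.span ℂ (S.word ρ w '' {l | S.wt l = c ∧ l.length < k})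

/-- The span of the words that precede those of total level `c` and length `k`: the words of
higher level, and those of level `c` and length less than `k`. -/
def lower (c : ℤ) (k : ℕ) : Submodule ℂ M :=
  Submodule.span ℂ (S.word ρ w '' {l | c < S.wt l ∨ S.wt l = c ∧ l.length < k})

variable {ρ w}

lemma word_mem_short {l : List J} {c : ℤ} {k : ℕ} (hc : S.wt l = c) (hk : l.length < k) :
    S.word ρ w l ∈ S.short ρ w c k :=
  Submodule.subset_span ⟨l, ⟨hc, hk⟩, rfl⟩

lemma short_mono {c : ℤ} {k k' : ℕ} (h : k ≤ k') : S.short ρ w c k ≤ S.short ρ w c k' :=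
  Submodule.span_mono (Set.image_mono fun _ hl => ⟨hl.1, hl.2.trans_le h⟩)

lemma short_le_lower {c : ℤ} {k : ℕ} : S.short ρ w c k ≤ S.lower ρ w c k :=
  Submodule.span_mono (Set.image_mono fun _ hl => Or.inr hl)

lemma short_le_lower_of_lt {c c' : ℤ} {k k' : ℕ} (h : c' < c) :
    S.short ρ w c k ≤ S.lower ρ w c' k' :=
  Submodule.span_mono (Set.image_mono fun _ hl => Or.inl (hl.1 ▸ h))

lemma rep_mem_short_of_neg {D : Γ} {x : L} (hD : D < 0) (hx : x ∈ S.piece D) {c : ℤ} {k : ℕ}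
    {m : M} (hm : m ∈ S.short ρ w c k) : ρ x m ∈ S.short ρ w (S.level D + c) (k + 1) := by
  induction hm using Submodule.span_induction with
  | mem m hm =>
    obtain ⟨l, ⟨hl, hk⟩, rfl⟩ := hm
    rw [S.eq_sum_coord hD hx, map_finsuppSum, Finsupp.sum, LinearMap.sum_apply]
    refine Submodule.sum_mem _ fun j hj => ?_
    rw [map_smul, LinearMap.smul_apply]
    refine Submodule.smul_mem _ _ (Submodule.subset_span ⟨j :: l, ⟨?_, ?_⟩, rfl⟩)
    · rw [wt_cons, S.deg_of_coord hx (Finsupp.mem_support_iff.mp hj), hl]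
    · simpa using hk
  | zero => simp
  | add m m' _ _ h h' => rw [map_add]; exact add_mem h h'
  | smul a m _ h => rw [map_smul]; exact Submodule.smul_mem _ _ h

lemma rep_vec_mem_short (j : J) {c : ℤ} {k : ℕ} {m : M} (hm : m ∈ S.short ρ w c k) :
    ρ (S.vec j) m ∈ S.short ρ w (S.level (S.deg j) + c) (k + 1) :=
  S.rep_mem_short_of_neg (S.deg_neg j) (S.vec_mem j) hm

/-- An element of nonnegative degree does not increase the length of a word. -/
lemma rep_word_mem_short (hw : S.IsHighest ρ w) {D : Γ} {x : L} (hD : 0 ≤ D)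
    (hx : x ∈ S.piece D) (l : List J) :
    ρ x (S.word ρ w l) ∈ S.short ρ w (S.level D + S.wt l) (l.length + 1) := by
  induction l generalizing D x with
  | nil =>
    rcases hD.eq_or_lt with rfl | hD
    · obtain ⟨c, hc⟩ := hw.zero hx
      rw [word, hc]
      exact Submodule.smul_mem _ _ (S.word_mem_short (l := []) (by simp) (by simp))
    · rw [word, hw.pos hD hx]; exact zero_mem _
  | cons j l ih =>
    rw [word, rep_comm]
    refine add_mem ?_ ?_
    · have := S.rep_vec_mem_short j (ih hD hx)
      rw [wt_cons, add_left_comm]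
      exact this
    · have hxy := S.lie_mem hx (S.vec_mem j)
      rw [wt_cons, ← add_assoc, ← map_add]
      rcases lt_or_ge (D + S.deg j) 0 with h | h
      · exact S.rep_mem_short_of_neg h hxy (S.word_mem_short rfl (by simp))
      · exact S.short_mono (by simp) (ih h hxy)

lemma rep_mem_short (hw : S.IsHighest ρ w) {D : Γ} {x : L} (hD : 0 ≤ D)
    (hx : x ∈ S.piece D) {c : ℤ} {k : ℕ} {m : M} (hm : m ∈ S.short ρ w c k) :
    ρ x m ∈ S.short ρ w (S.level D + c) k := by
  induction hm using Submodule.span_induction with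
  | mem m hm =>
    obtain ⟨l, ⟨hl, hk⟩, rfl⟩ := hm
    have := S.rep_word_mem_short hw hD hx l
    rw [hl] at this
    exact S.short_mono hk this
  | zero => simp
  | add m m' _ _ h h' => rw [map_add]; exact add_mem h h'
  | smul a m _ h => rw [map_smul]; exact Submodule.smul_mem _ _ h

lemma rep_mem_lower (hw : S.IsHighest ρ w) {D : Γ} {x : L} (hD : 0 ≤ D)
    (hx : x ∈ S.piece D) {c : ℤ} {k : ℕ} {m : M} (hm : m ∈ S.lower ρ w c k) :
    ρ x m ∈ S.lower ρ w (S.level D + c) k := by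
  induction hm using Submodule.span_induction with
  | mem m hm =>
    obtain ⟨l, hl, rfl⟩ := hm
    have h := S.rep_word_mem_short hw hD hx l
    rcases hl with hl | ⟨hl, hk⟩
    · exact S.short_le_lower_of_lt (by omega) h
    · rw [hl] at h
      exact S.short_le_lower (S.short_mono hk h)
  | zero => simp
  | add m m' _ _ h h' => rw [map_add]; exact add_mem h h'
  | smul a m _ h => rw [map_smul]; exact Submodule.smul_mem _ _ h

variable (ρ w) in
/-- The span of all words. -/
def words : Submodule ℂ M := Submodule.span ℂ (Set.range (S.word ρ w))

lemma short_le_words {c : ℤ} {k : ℕ} : S.short ρ w c k ≤ S.words ρ w :=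
  Submodule.span_mono (by rintro _ ⟨l, _, rfl⟩; exact ⟨l, rfl⟩)

/-- The words span a subrepresentation. -/
lemma rep_mem_words (hw : S.IsHighest ρ w) (x : L) {m : M} (hm : m ∈ S.words ρ w) :
    ρ x m ∈ S.words ρ w := by
  have hx : x ∈ ⨆ D, S.piece D := by rw [S.iSup_piece]; trivial
  induction hm using Submodule.span_induction with
  | mem m hm =>
    obtain ⟨l, rfl⟩ := hm
    induction hx using Submodule.iSup_induction' with
    | mem D x hx =>
      rcases lt_or_ge D 0 with h | h
      · exact S.short_le_words (S.rep_mem_short_of_neg h hx (S.word_mem_short rfl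
          (Nat.lt_succ_self l.length)))
      · exact S.short_le_words (S.rep_word_mem_short hw h hx l)
    | zero => simp
    | add x y _ _ h h' => rw [map_add, LinearMap.add_apply]; exact add_mem h h'
  | zero => simp
  | add m m' _ _ h h' => rw [map_add]; exact add_mem h h'
  | smul a m _ h => rw [map_smul]; exact Submodule.smul_mem _ _ h

/-- Reordering a word changes it by shorter words of the same level. -/
lemma word_sub_word_mem_short {l l' : List J} (h : l.Perm l') :
    S.word ρ w l - S.word ρ w l' ∈ S.short ρ w (S.wt l) l.length := by
  induction h with
  | nil => simp
  | cons j _ ih =>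
    rw [word, word, ← map_sub, wt_cons]
    exact S.rep_vec_mem_short j ih
  | swap i j l =>
    rw [word, word, word, word, rep_comm ρ (S.vec j), add_sub_cancel_left, wt_cons, wt_cons,
      ← add_assoc, ← map_add]
    exact S.rep_mem_short_of_neg (add_neg (S.deg_neg j) (S.deg_neg i))
      (S.lie_mem (S.vec_mem j) (S.vec_mem i)) (S.word_mem_short rfl (Nat.lt_succ_self _))
  | @trans l₁ l₂ l₃ h₁ _ ih ih' =>
    have hwt : S.wt l₁ = S.wt l₂ := (h₁.map _).sum_eq
    rw [← sub_add_sub_cancel]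
    rw [← hwt, ← h₁.length_eq] at ih'
    exact add_mem ih ih'

/-! ### Symbols of words -/

open MvPolynomial

/-- The commutative monomial of a list. -/
def mono (l : List J) : MvPolynomial J ℂ := (l.map X).prod

@[simp] lemma mono_nil : mono ([] : List J) = 1 := rfl
@[simp] lemma mono_cons (j : J) (l : List J) : mono (j :: l) = X j * mono l := by simp [mono]

open Classical in
lemma mono_eq_monomial (l : List J) :
    mono l = monomial (Multiset.toFinsupp (l : Multiset J)) 1 := by
  induction l with
  | nil => simp
  | cons j l ih =>
    rw [mono_cons, ih, ← Multiset.cons_coe, ← Multiset.singleton_add, map_add,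
      Multiset.toFinsupp_singleton, X, monomial_mul, one_mul]

variable (ρ w) in
/-- Quantization, a linear section of the symbol map: each commutative monomial is sent to the word
of some list that represents it. -/
def quant : MvPolynomial J ℂ →ₗ[ℂ] M :=
  (basisMonomials J ℂ).constr ℂ fun s => S.word ρ w (Finsupp.toMultiset s).toList

lemma quant_mono_sub_word (l : List J) :
    S.quant ρ w (mono l) - S.word ρ w l ∈ S.short ρ w (S.wt l) l.length := by
  classical
  have h : S.quant ρ w (mono l) = S.word ρ w (l : Multiset J).toList := by
    have := (basisMonomials J ℂ).constr_basis ℂ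
      (fun s => S.word ρ w (Finsupp.toMultiset s).toList) (Multiset.toFinsupp (l : Multiset J))
    rw [coe_basisMonomials] at this
    beta_reduce at this
    rw [← mono_eq_monomial] at this
    rw [quant, this, Multiset.toFinsupp_toMultiset]
  rw [h, ← neg_sub]
  refine neg_mem (S.word_sub_word_mem_short ?_)
  exact Multiset.coe_eq_coe.mp (Multiset.coe_toList _).symm

/-- The commutative polynomials that are homogeneous of level `c` and degree `k`. -/
def symbols (c : ℤ) (k : ℕ) : Submodule ℂ (MvPolynomial J ℂ) :=
  Submodule.span ℂ (mono '' {l | S.wt l = c ∧ l.length = k})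

lemma mono_mem_symbols (l : List J) : mono l ∈ S.symbols (S.wt l) l.length :=
  Submodule.subset_span ⟨l, ⟨rfl, rfl⟩, rfl⟩

lemma symbols_eq_bot_of_pos {c : ℤ} (hc : 0 < c) (k : ℕ) : S.symbols c k = ⊥ := by
  rw [symbols, Submodule.span_eq_bot]
  rintro _ ⟨l, ⟨hl, -⟩, rfl⟩
  have := S.wt_nonpos l
  omega

lemma X_mul_mem_symbols (j : J) {c : ℤ} {k : ℕ} {p : MvPolynomial J ℂ} (hp : p ∈ S.symbols c k) :
    X j * p ∈ S.symbols (S.level (S.deg j) + c) (k + 1) := by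
  induction hp using Submodule.span_induction with
  | mem p hp =>
    obtain ⟨l, ⟨hl, hk⟩, rfl⟩ := hp
    exact Submodule.subset_span ⟨j :: l, ⟨by simp [hl], by simp [hk]⟩, by simp⟩
  | zero => simp
  | add p q _ _ h h' => rw [mul_add]; exact add_mem h h'
  | smul a p _ h => rw [mul_smul_comm]; exact Submodule.smul_mem _ _ h

/-- On symbols, a basis vector acts through multiplication by its variable. -/
lemma rep_vec_quant (j : J) {c : ℤ} {k : ℕ} {p : MvPolynomial J ℂ} (hp : p ∈ S.symbols c k) :
    ρ (S.vec j) (S.quant ρ w p) - S.quant ρ w (X j * p) ∈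
      S.short ρ w (S.level (S.deg j) + c) (k + 1) := by
  induction hp using Submodule.span_induction with
  | mem p hp =>
    obtain ⟨l, ⟨rfl, rfl⟩, rfl⟩ := hp
    have h₁ := S.rep_vec_mem_short j (S.quant_mono_sub_word (ρ := ρ) (w := w) l)
    have h₂ := S.quant_mono_sub_word (ρ := ρ) (w := w) (j :: l)
    rw [mono_cons, wt_cons, List.length_cons] at h₂
    rw [map_sub] at h₁
    have := sub_mem h₁ h₂
    rwa [word, sub_sub_sub_cancel_right] at this
  | zero => simp
  | add p q _ _ h h' =>
    rw [mul_add, map_add, map_add, map_add, add_sub_add_comm]; exact add_mem h h'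
  | smul a p _ h =>
    rw [mul_smul_comm, map_smul, map_smul, map_smul, ← smul_sub]; exact Submodule.smul_mem _ _ h

/-- The linear form on `L` with values in linear polynomials: the class modulo the nonnegative
part of the grading. -/
def linSymbol : L →ₗ[ℂ] MvPolynomial J ℂ :=
  Finsupp.lsum ℂ (fun j => LinearMap.toSpanSingleton ℂ _ (X j)) ∘ₗ S.coord

lemma linSymbol_apply (x : L) : S.linSymbol x = (S.coord x).sum fun j a => a • X j := rfl

/-- The derivation of the polynomial ring induced by `ad x` modulo the nonnegative part. -/
def adDer (x : L) : Derivation ℂ (MvPolynomial J ℂ) (MvPolynomial J ℂ) :=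
  mkDerivation ℂ fun j => S.linSymbol ⁅x, S.vec j⁆

lemma adDer_X (x : L) (j : J) : S.adDer x (X j) = S.linSymbol ⁅x, S.vec j⁆ := mkDerivation_X _ _ _

lemma linSymbol_mul_mem_symbols {D : Γ} {x : L} (hx : x ∈ S.piece D) {c : ℤ} {k : ℕ}
    {p : MvPolynomial J ℂ} (hp : p ∈ S.symbols c k) :
    S.linSymbol x * p ∈ S.symbols (S.level D + c) (k + 1) := by
  rw [linSymbol_apply, Finsupp.sum, Finset.sum_mul]
  refine Submodule.sum_mem _ fun j hj => ?_
  rw [smul_mul_assoc]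
  refine Submodule.smul_mem _ _ ?_
  rw [← S.deg_of_coord hx (Finsupp.mem_support_iff.mp hj)]
  exact S.X_mul_mem_symbols j hp

lemma adDer_mem_symbols {D : Γ} {x : L} (hx : x ∈ S.piece D) {c : ℤ} {k : ℕ}
    {p : MvPolynomial J ℂ} (hp : p ∈ S.symbols c k) :
    S.adDer x p ∈ S.symbols (S.level D + c) k := by
  induction hp using Submodule.span_induction with
  | mem p hp =>
    obtain ⟨l, ⟨rfl, rfl⟩, rfl⟩ := hp
    induction l with
    | nil => simp
    | cons j l ih =>
      rw [mono_cons, Derivation.leibniz, smul_eq_mul, smul_eq_mul, adDer_X, wt_cons,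
        List.length_cons]
      refine add_mem ?_ ?_
      · rw [add_left_comm]; exact S.X_mul_mem_symbols j ih
      · rw [← add_assoc, ← map_add, mul_comm]
        exact S.linSymbol_mul_mem_symbols (S.lie_mem hx (S.vec_mem j)) (S.mono_mem_symbols l)
  | zero => simp
  | add p q _ _ h h' => rw [map_add]; exact add_mem h h'
  | smul a p _ h => rw [Derivation.map_smul]; exact Submodule.smul_mem _ _ h

lemma rep_word_sub_linSymbol_mul (hw : S.IsHighest ρ w) {D : Γ} {x : L} (hx : x ∈ S.piece D)
    (l : List J) : ρ x (S.word ρ w l) - S.quant ρ w (S.linSymbol x * mono l) ∈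
      S.short ρ w (S.level D + S.wt l) (l.length + 1) := by
  rcases lt_or_ge D 0 with h | h
  · have e : ρ x (S.word ρ w l) =
        (S.coord x).sum fun j a => a • S.word ρ w (j :: l) := by
      conv_lhs => rw [S.eq_sum_coord h hx]
      rw [map_finsuppSum, Finsupp.sum, LinearMap.sum_apply, Finsupp.sum]
      exact Finset.sum_congr rfl fun j _ => by rw [map_smul, LinearMap.smul_apply]; rfl
    rw [e, linSymbol_apply, Finsupp.sum, Finsupp.sum, Finset.sum_mul, map_sum,
      ← Finset.sum_sub_distrib]
    refine Submodule.sum_mem _ fun j hj => ?_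
    rw [smul_mul_assoc, map_smul, ← smul_sub]
    refine Submodule.smul_mem _ _ ?_
    have := neg_mem (S.quant_mono_sub_word (ρ := ρ) (w := w) (j :: l))
    rwa [neg_sub, wt_cons, S.deg_of_coord hx (Finsupp.mem_support_iff.mp hj), mono_cons,
      List.length_cons] at this
  · rw [linSymbol_apply, S.coord_of_nonneg h hx, Finsupp.sum_zero_index, zero_mul, map_zero,
      sub_zero]
    exact S.rep_word_mem_short hw h hx l

lemma rep_word_sub_adDer (hw : S.IsHighest ρ w) {D : Γ} {x : L} (hD : 0 < D)
    (hx : x ∈ S.piece D) (l : List J) :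
    ρ x (S.word ρ w l) - S.quant ρ w (S.adDer x (mono l)) ∈
      S.short ρ w (S.level D + S.wt l) l.length := by
  induction l with
  | nil => simp [word, hw.pos hD hx]
  | cons j l ih =>
    have h₁ := S.rep_vec_mem_short j ih
    have h₂ := S.rep_vec_quant (ρ := ρ) (w := w) j (S.adDer_mem_symbols hx (S.mono_mem_symbols l))
    have h₃ := S.rep_word_sub_linSymbol_mul hw (S.lie_mem hx (S.vec_mem j)) l
    rw [map_sub] at h₁
    rw [map_add, add_assoc, add_left_comm] at h₃
    have h := add_mem (add_mem h₁ h₂) h₃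
    rw [word, rep_comm, mono_cons, Derivation.leibniz, smul_eq_mul, smul_eq_mul, adDer_X, wt_cons,
      List.length_cons, add_left_comm, mul_comm (mono l), map_add]
    convert h using 1
    abel

/-- On symbols, a positive element `x` acts through the derivation `adDer x`. -/
lemma rep_quant_sub_adDer (hw : S.IsHighest ρ w) {D : Γ} {x : L} (hD : 0 < D)
    (hx : x ∈ S.piece D) {c : ℤ} {k : ℕ} {p : MvPolynomial J ℂ} (hp : p ∈ S.symbols c k) :
    ρ x (S.quant ρ w p) - S.quant ρ w (S.adDer x p) ∈ S.short ρ w (S.level D + c) k := by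
  induction hp using Submodule.span_induction with
  | mem p hp =>
    obtain ⟨l, ⟨rfl, rfl⟩, rfl⟩ := hp
    have h₁ := S.rep_mem_short hw hD.le hx (S.quant_mono_sub_word (ρ := ρ) (w := w) l)
    have h₂ := S.rep_word_sub_adDer hw hD hx l
    rw [map_sub] at h₁
    have := add_mem h₁ h₂
    rwa [sub_add_sub_cancel] at this
  | zero => simp
  | add p q _ _ h h' => simp only [map_add, add_sub_add_comm]; exact add_mem h h'
  | smul a p _ h =>
    simp only [map_smul, Derivation.map_smul, ← smul_sub]; exact Submodule.smul_mem _ _ h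

lemma quant_mem_short {c : ℤ} {k : ℕ} {p : MvPolynomial J ℂ} (hp : p ∈ S.symbols c k) :
    S.quant ρ w p ∈ S.short ρ w c (k + 1) := by
  induction hp using Submodule.span_induction with
  | mem p hp =>
    obtain ⟨l, ⟨rfl, rfl⟩, rfl⟩ := hp
    have h := add_mem (S.short_mono (Nat.le_succ _) (S.quant_mono_sub_word (ρ := ρ) (w := w) l))
      (S.word_mem_short (ρ := ρ) (w := w) (l := l) rfl (Nat.lt_succ_self _))
    rwa [sub_add_cancel] at h
  | zero => simp
  | add p q _ _ h h' => rw [map_add]; exact add_mem h h'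
  | smul a p _ h => rw [map_smul]; exact Submodule.smul_mem _ _ h

/-- The derivation of the polynomial ring with prescribed constant values on the variables. -/
def constDer (κ : J → ℂ) : Derivation ℂ (MvPolynomial J ℂ) (MvPolynomial J ℂ) :=
  mkDerivation ℂ fun j => C (κ j)

lemma constDer_X (κ : J → ℂ) (j : J) : constDer κ (X j) = C (κ j) := mkDerivation_X _ _ _

lemma constDer_mono_mem_symbols (κ : J → ℂ) {k : ℕ} {l : List J} (hl : S.wt l = 0)
    (hk : l.length = k + 1) : constDer κ (mono l) ∈ S.symbols 0 k := by
  induction k generalizing l with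
  | zero =>
    obtain ⟨j, rfl⟩ := List.length_eq_one_iff.mp hk
    have h := Submodule.smul_mem _ (κ j) (S.mono_mem_symbols [])
    simpa [constDer_X, ← MvPolynomial.algebraMap_eq, Algebra.algebraMap_eq_smul_one] using h
  | succ k ih =>
    obtain ⟨j, l, rfl⟩ := List.exists_cons_of_length_eq_add_one hk
    have hj := S.level_deg_nonpos j
    have hl' := S.wt_nonpos l
    rw [wt_cons] at hl
    have hj0 : S.level (S.deg j) = 0 := by omega
    have hl0 : S.wt l = 0 := by omega
    have hk' : l.length = k + 1 := by simpa using hk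
    rw [mono_cons, Derivation.leibniz, smul_eq_mul, smul_eq_mul, constDer_X, mul_comm (mono l),
      ← smul_eq_C_mul]
    refine add_mem ?_ (Submodule.smul_mem _ _ ?_)
    · simpa [hj0] using S.X_mul_mem_symbols j (ih hl0 hk')
    · rw [← hl0, ← hk']; exact S.mono_mem_symbols l

lemma rep_word_sub_constDer (hw : S.IsHighest ρ w) {D : Γ} {x : L} (hD : 0 < D)
    (hx : x ∈ S.piece D) {κ : J → ℂ}
    (hκ : ∀ j, S.level (S.deg j) = 0 → ∀ m, ρ ⁅x, S.vec j⁆ m = κ j • m)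
    {k : ℕ} {l : List J} (hl : S.wt l = 0) (hk : l.length = k + 1) :
    ρ x (S.word ρ w l) - S.quant ρ w (constDer κ (mono l)) ∈ S.short ρ w 0 k := by
  induction k generalizing l with
  | zero =>
    obtain ⟨j, rfl⟩ := List.length_eq_one_iff.mp hk
    have hj0 : S.level (S.deg j) = 0 := by simpa using hl
    have h := Submodule.smul_mem _ (-κ j) (S.quant_mono_sub_word (ρ := ρ) (w := w) [])
    rw [word, word, rep_comm, hw.pos hD hx, map_zero, zero_add, hκ j hj0, mono_cons, mono_nil,
      mul_one, constDer_X, ← MvPolynomial.algebraMap_eq, Algebra.algebraMap_eq_smul_one, map_smul,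
      ← smul_sub]
    rw [neg_smul, ← smul_neg, neg_sub] at h
    exact h
  | succ k ih =>
    obtain ⟨j, l, rfl⟩ := List.exists_cons_of_length_eq_add_one hk
    have hj := S.level_deg_nonpos j
    have hl' := S.wt_nonpos l
    rw [wt_cons] at hl
    have hj0 : S.level (S.deg j) = 0 := by omega
    have hl0 : S.wt l = 0 := by omega
    have hk' : l.length = k + 1 := by simpa using hk
    have h₁ := S.rep_vec_mem_short j (ih hl0 hk')
    have h₂ := S.rep_vec_quant (ρ := ρ) (w := w) j (S.constDer_mono_mem_symbols κ hl0 hk')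
    have h₃ := Submodule.smul_mem _ (-κ j) (S.quant_mono_sub_word (ρ := ρ) (w := w) l)
    rw [hj0, zero_add] at h₁ h₂
    rw [hl0, hk'] at h₃
    rw [map_sub] at h₁
    have h := add_mem (add_mem h₁ h₂) h₃
    rw [word, rep_comm, hκ j hj0, mono_cons, Derivation.leibniz, smul_eq_mul, smul_eq_mul,
      constDer_X, mul_comm (mono l), ← smul_eq_C_mul, map_add, map_smul]
    convert h using 1
    rw [smul_sub, neg_smul, neg_smul]
    abel

/-- On words of level zero, the elements that act through constant derivations shorten words. -/
lemma rep_mem_short_zero (hw : S.IsHighest ρ w) {D : Γ} {x : L} (hD : 0 < D)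
    (hx : x ∈ S.piece D) {κ : J → ℂ}
    (hκ : ∀ j, S.level (S.deg j) = 0 → ∀ m, ρ ⁅x, S.vec j⁆ m = κ j • m)
    {k : ℕ} {m : M} (hm : m ∈ S.short ρ w 0 (k + 1)) : ρ x m ∈ S.short ρ w 0 k := by
  induction hm using Submodule.span_induction with
  | mem m hm =>
    obtain ⟨l, ⟨hl, hk⟩, rfl⟩ := hm
    rcases Nat.eq_zero_or_eq_succ_pred l.length with h | h
    · rw [List.length_eq_zero_iff.mp h, word, hw.pos hD hx]; exact zero_mem _
    · have h₁ := S.rep_word_sub_constDer hw hD hx hκ hl h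
      have h₂ := S.quant_mem_short (ρ := ρ) (w := w) (S.constDer_mono_mem_symbols κ hl h)
      have h₃ := add_mem (S.short_mono (Nat.le_succ _) h₁) h₂
      rw [sub_add_cancel] at h₃
      exact S.short_mono (by omega) h₃
  | zero => simp
  | add m m' _ _ h h' => rw [map_add]; exact add_mem h h'
  | smul a m _ h => rw [map_smul]; exact Submodule.smul_mem _ _ h

/-- A positive element `x` of level zero that commutes up to scalars with the basis vectors of
level zero acts on symbols of level zero through a derivation with constant coefficients. -/
lemma rep_quant_sub_constDer (hw : S.IsHighest ρ w) {D : Γ} {x : L} (hD : 0 < D)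
    (hx : x ∈ S.piece D) {κ : J → ℂ}
    (hκ : ∀ j, S.level (S.deg j) = 0 → ∀ m, ρ ⁅x, S.vec j⁆ m = κ j • m)
    {k : ℕ} {p : MvPolynomial J ℂ} (hp : p ∈ S.symbols 0 (k + 1)) :
    constDer κ p ∈ S.symbols 0 k ∧
      ρ x (S.quant ρ w p) - S.quant ρ w (constDer κ p) ∈ S.short ρ w 0 k := by
  induction hp using Submodule.span_induction with
  | mem p hp =>
    obtain ⟨l, ⟨hl, hk⟩, rfl⟩ := hp
    refine ⟨S.constDer_mono_mem_symbols κ hl hk, ?_⟩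
    have h := S.quant_mono_sub_word (ρ := ρ) (w := w) l
    rw [hl, hk] at h
    have h₁ := S.rep_mem_short_zero hw hD hx hκ h
    have h₂ := S.rep_word_sub_constDer hw hD hx hκ hl hk
    rw [map_sub] at h₁
    have := add_mem h₁ h₂
    rwa [sub_add_sub_cancel] at this
  | zero => simp
  | add p q _ _ h h' =>
    simp only [map_add, add_sub_add_comm]; exact ⟨add_mem h.1 h'.1, add_mem h.2 h'.2⟩
  | smul a p _ h =>
    simp only [map_smul, Derivation.map_smul, ← smul_sub]
    exact ⟨Submodule.smul_mem _ _ h.1, Submodule.smul_mem _ _ h.2⟩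

lemma lower_zero (k : ℕ) : S.lower ρ w 0 k = S.short ρ w 0 k := by
  refine le_antisymm (Submodule.span_mono (Set.image_mono ?_)) S.short_le_lower
  rintro l (hl | hl)
  · have := S.wt_nonpos l; omega
  · exact hl

lemma lower_zero_zero : S.lower ρ w 0 0 = ⊥ := by
  rw [lower_zero, short]; simp

lemma lower_mono {c c' : ℤ} {k k' : ℕ} (hc : c' ≤ c) (hk : k ≤ k') :
    S.lower ρ w c k ≤ S.lower ρ w c' k' := by
  refine Submodule.span_mono (Set.image_mono ?_)
  rintro l (hl | ⟨hl, hk⟩)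
  · exact Or.inl (by omega)
  · rcases hc.eq_or_lt with rfl | hc
    · exact Or.inr ⟨hl, by omega⟩
    · exact Or.inl (by omega)

lemma exists_mem_lower {v : M} (hv : v ∈ S.words ρ w) : ∃ d : ℕ, v ∈ S.lower ρ w (-d) 0 := by
  induction hv using Submodule.span_induction with
  | mem v hv =>
    obtain ⟨l, rfl⟩ := hv
    exact ⟨(1 - S.wt l).toNat, Submodule.subset_span ⟨l, Or.inl (by omega), rfl⟩⟩
  | zero => exact ⟨0, zero_mem _⟩
  | add v v' _ _ h h' =>
    obtain ⟨d, h⟩ := h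
    obtain ⟨d', h'⟩ := h'
    exact ⟨max d d', add_mem (S.lower_mono (by omega) le_rfl h) (S.lower_mono (by omega) le_rfl h')⟩
  | smul a v _ h =>
    obtain ⟨d, h⟩ := h
    exact ⟨d, Submodule.smul_mem _ _ h⟩

lemma exists_length_of_mem_lower {c : ℤ} {v : M} (hv : v ∈ S.lower ρ w c 0) :
    ∃ k : ℕ, v ∈ S.lower ρ w (c + 1) k := by
  induction hv using Submodule.span_induction with
  | mem v hv =>
    obtain ⟨l, hl, rfl⟩ := hv
    refine ⟨l.length + 1, Submodule.subset_span ⟨l, ?_, rfl⟩⟩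
    rcases hl with hl | ⟨_, hl⟩
    · rcases (Int.add_one_le_iff.mpr hl).eq_or_lt with h | h
      · exact Or.inr ⟨h.symm, Nat.lt_succ_self _⟩
      · exact Or.inl h
    · exact absurd hl (Nat.not_lt_zero _)
  | zero => exact ⟨0, zero_mem _⟩
  | add v v' _ _ h h' =>
    obtain ⟨d, h⟩ := h
    obtain ⟨d', h'⟩ := h'
    exact ⟨max d d', add_mem (S.lower_mono le_rfl (by omega) h) (S.lower_mono le_rfl (by omega) h')⟩
  | smul a v _ h =>
    obtain ⟨d, h⟩ := h
    exact ⟨d, Submodule.smul_mem _ _ h⟩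

lemma exists_symbol_of_mem_lower_succ {c : ℤ} {k : ℕ} {v : M}
    (hv : v ∈ S.lower ρ w c (k + 1)) :
    ∃ p ∈ S.symbols c k, v - S.quant ρ w p ∈ S.lower ρ w c k := by
  induction hv using Submodule.span_induction with
  | mem v hv =>
    obtain ⟨l, hl, rfl⟩ := hv
    by_cases h : S.wt l = c ∧ l.length = k
    · obtain ⟨rfl, rfl⟩ := h
      refine ⟨mono l, S.mono_mem_symbols l, ?_⟩
      rw [← neg_sub]
      exact neg_mem (S.short_le_lower (S.quant_mono_sub_word l))
    · refine ⟨0, zero_mem _, ?_⟩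
      rw [map_zero, sub_zero]
      exact Submodule.subset_span ⟨l, by simp only [Set.mem_ofPred_eq] at hl ⊢; omega, rfl⟩
  | zero => exact ⟨0, zero_mem _, by simp⟩
  | add v v' _ _ h h' =>
    obtain ⟨p, hp, h⟩ := h
    obtain ⟨p', hp', h'⟩ := h'
    refine ⟨p + p', add_mem hp hp', ?_⟩
    rw [map_add, add_sub_add_comm]
    exact add_mem h h'
  | smul a v _ h =>
    obtain ⟨p, hp, h⟩ := h
    refine ⟨a • p, Submodule.smul_mem _ _ hp, ?_⟩
    rw [map_smul, ← smul_sub]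
    exact Submodule.smul_mem _ _ h

/-- Every nonzero combination of words has a nonzero symbol. -/
lemma exists_symbol {v : M} (hv : v ∈ S.words ρ w) (hv0 : v ≠ 0) :
    ∃ (d k : ℕ) (p : MvPolynomial J ℂ), p ∈ S.symbols (-d) k ∧ p ≠ 0 ∧
      v - S.quant ρ w p ∈ S.lower ρ w (-d) k := by
  have key : ∀ d k : ℕ, v ∈ S.lower ρ w (-d) k → ∃ (d k : ℕ) (p : MvPolynomial J ℂ),
      p ∈ S.symbols (-d) k ∧ p ≠ 0 ∧ v - S.quant ρ w p ∈ S.lower ρ w (-d) k := by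
    intro d
    induction d with
    | zero =>
      intro k
      induction k with
      | zero =>
        intro h
        rw [Nat.cast_zero, neg_zero, lower_zero_zero] at h
        exact absurd h hv0
      | succ k ih =>
        intro h
        obtain ⟨p, hp, h⟩ := S.exists_symbol_of_mem_lower_succ h
        by_cases hp0 : p = 0
        · rw [hp0, map_zero, sub_zero] at h; exact ih h
        · exact ⟨_, _, p, hp, hp0, h⟩
    | succ d ihd =>
      intro k
      induction k with
      | zero =>
        intro h
        obtain ⟨k, h⟩ := S.exists_length_of_mem_lower h
        refine ihd k ?_
        rwa [show -((d + 1 : ℕ) : ℤ) + 1 = -d by push_cast; ring] at h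
      | succ k ih =>
        intro h
        obtain ⟨p, hp, h⟩ := S.exists_symbol_of_mem_lower_succ h
        by_cases hp0 : p = 0
        · rw [hp0, map_zero, sub_zero] at h; exact ih h
        · exact ⟨_, _, p, hp, hp0, h⟩
  obtain ⟨d, h⟩ := S.exists_mem_lower hv
  exact key d 0 h

variable (ρ) in
/-- Polynomials of negative level are detected by derivations `adDer x` with `x` of positive level,
and nonconstant ones of level zero by derivations with constant coefficients that come from
elements `x` commuting up to scalars with the basis vectors of level zero. -/
structure Detects : Prop where
  neg : ∀ {c : ℤ} {k : ℕ} {p : MvPolynomial J ℂ}, c < 0 → p ∈ S.symbols c k → p ≠ 0 →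
    ∃ (D : Γ) (x : L), x ∈ S.piece D ∧ 0 < S.level D ∧ S.adDer x p ≠ 0
  zero : ∀ {k : ℕ} {p : MvPolynomial J ℂ}, p ∈ S.symbols 0 (k + 1) → p ≠ 0 →
    ∃ (D : Γ) (x : L) (κ : J → ℂ), 0 < D ∧ S.level D = 0 ∧ x ∈ S.piece D ∧
      (∀ j, S.level (S.deg j) = 0 → ∀ m, ρ ⁅x, S.vec j⁆ m = κ j • m) ∧ constDer κ p ≠ 0

/-- A vector with nonzero symbol generates the highest vector: positive elements of `L` lower the
symbol until it is a nonzero constant. -/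
lemma mem_of_symbol_ne_zero (hw : S.IsHighest ρ w) (hdet : S.Detects ρ) (W : Submodule ℂ M)
    (hW : ∀ x : L, ∀ m ∈ W, ρ x m ∈ W) (d k : ℕ) {p : MvPolynomial J ℂ} {v : M} (hv : v ∈ W)
    (hp : p ∈ S.symbols (-d) k) (hp0 : p ≠ 0) (h : v - S.quant ρ w p ∈ S.lower ρ w (-d) k) :
    w ∈ W := by
  induction d using Nat.strong_induction_on generalizing k p v with
  | _ d ihd =>
  rcases Nat.eq_zero_or_pos d with rfl | hd
  · rw [Nat.cast_zero, neg_zero] at hp h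
    clear ihd
    rw [lower_zero] at h
    induction k generalizing p v with
    | zero =>
      have e : S.symbols 0 0 ≤ Submodule.span ℂ {1} := by
        refine Submodule.span_mono ?_
        rintro _ ⟨l, ⟨-, hl⟩, rfl⟩
        rw [List.length_eq_zero_iff.mp hl]; rfl
      obtain ⟨a, rfl⟩ := Submodule.mem_span_singleton.mp (e hp)
      have h₁ : v - S.quant ρ w (a • 1) = 0 := by
        rw [← lower_zero, lower_zero_zero] at h; exact h
      have h₂ : S.quant ρ w 1 - w = 0 := by
        have := S.quant_mono_sub_word (ρ := ρ) (w := w) []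
        rw [wt_nil, List.length_nil, ← lower_zero, lower_zero_zero] at this
        exact this
      rw [map_smul, sub_eq_zero.mp h₂, sub_eq_zero] at h₁
      have ha : a ≠ 0 := by rintro rfl; simp at hp0
      rw [h₁] at hv
      exact (Submodule.smul_mem_iff _ ha).mp hv
    | succ k ih =>
      obtain ⟨D, x, κ, hD, hD0, hx, hκ, hne⟩ := hdet.zero hp hp0
      obtain ⟨h₁, h₂⟩ := S.rep_quant_sub_constDer hw hD hx hκ hp
      have h₃ := S.rep_mem_short_zero hw hD hx hκ h
      refine ih (hW x v hv) hne h₁ ?_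
      rw [map_sub] at h₃
      have := add_mem h₃ h₂
      rwa [sub_add_sub_cancel] at this
  · obtain ⟨D, x, hx, hD, hne⟩ := hdet.neg (by omega) hp hp0
    have hD' : 0 < D := by
      by_contra hcon
      have := S.level_mono (not_lt.mp hcon)
      rw [map_zero] at this
      omega
    have h₁ := S.adDer_mem_symbols hx hp
    have h₂ := S.rep_quant_sub_adDer (ρ := ρ) (w := w) hw hD' hx hp
    have h₃ := S.rep_mem_lower hw hD'.le hx h
    have hle : S.level D + -(d : ℤ) ≤ 0 := by
      by_contra hcon
      rw [S.symbols_eq_bot_of_pos (not_le.mp hcon)] at h₁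
      exact hne h₁
    obtain ⟨d', hd'⟩ : ∃ d' : ℕ, S.level D + -(d : ℤ) = -d' :=
      ⟨(d - S.level D).toNat, by omega⟩
    rw [hd'] at h₁ h₂ h₃
    refine ihd d' (by omega) k (hW x v hv) h₁ hne ?_
    rw [map_sub] at h₃
    have := add_mem h₃ (S.short_le_lower h₂)
    rwa [sub_add_sub_cancel] at this

/-- If the words span the representation, every nonzero vector generates the highest vector. -/
lemma mem_of_ne_zero (hw : S.IsHighest ρ w) (hdet : S.Detects ρ) (W : Submodule ℂ M)
    (hW : ∀ x : L, ∀ m ∈ W, ρ x m ∈ W) {v : M} (hv : v ∈ W) (hv0 : v ≠ 0)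
    (hwords : v ∈ S.words ρ w) : w ∈ W := by
  obtain ⟨d, k, p, hp, hp0, h⟩ := S.exists_symbol hwords hv0
  exact S.mem_of_symbol_ne_zero hw hdet W hW d k hv hp hp0 h

end TriangularGrading

end SymbolCalculus

/-! ### The principal grading of a simple Lie algebra -/

section PrincipalGrading

attribute [local instance 100] LieRing.ofAssociativeRing

open LieAlgebra LieAlgebra.IsKilling Module

namespace InvariantForm

variable {𝔤 : Type*} [LieRing 𝔤] [LieAlgebra ℂ 𝔤] (B : InvariantForm 𝔤)

lemma form_lie_left (x y z : 𝔤) : B.form ⁅x, y⁆ z = -B.form y ⁅x, z⁆ := by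
  rw [← lie_skew, map_neg, LinearMap.neg_apply, B.invariant]

/-- The kernel of an invariant form is an ideal. -/
lemma eq_zero_of_form_eq_zero [LieAlgebra.IsSimple ℂ 𝔤] {x : 𝔤} (hx : ∀ y, B.form x y = 0) :
    x = 0 := by
  let I : LieIdeal ℂ 𝔤 :=
    { LinearMap.ker B.form with
      lie_mem := fun {y z} hz => by
        change B.form ⁅y, z⁆ = 0
        have hz' : B.form z = 0 := hz
        ext t
        rw [B.form_lie_left, hz']
        simp }
  have hI : x ∈ I := LinearMap.mem_ker.mpr (LinearMap.ext hx)
  rcases LieAlgebra.IsSimple.eq_bot_or_eq_top I with h | h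
  · rw [h] at hI
    exact (LieSubmodule.mem_bot x).mp hI
  · refine absurd (LinearMap.ext fun y => ?_) B.ne_zero
    have hy : y ∈ I := by rw [h]; exact LieSubmodule.mem_top y
    exact hy

lemma form_nondegenerate [LieAlgebra.IsSimple ℂ 𝔤] : B.form.Nondegenerate := by
  refine ⟨fun x hx => B.eq_zero_of_form_eq_zero hx, fun x hx => B.eq_zero_of_form_eq_zero
    fun y => by rw [B.symm]; exact hx y⟩

end InvariantForm

variable {𝔤 : Type*} [LieRing 𝔤] [LieAlgebra ℂ 𝔤]

/-- A basis of `𝔤` that consists of weight vectors for the Cartan subalgebra `H` and is graded by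
the integral eigenvalues of an element `rho ∈ H`, all of absolute value less than `N`, such that
the part of degree zero is `H`. -/
structure HomogeneousBasis (H : LieSubalgebra ℂ 𝔤) (rho : H) (N : ℤ) (ι : Type*) where
  /-- The basis. -/
  e : Basis ι ℂ 𝔤
  /-- The weights of the basis vectors. -/
  weight : ι → Dual ℂ H
  /-- The degrees of the basis vectors. -/
  deg : ι → ℤ
  lie_e : ∀ (h : H) i, ⁅(h : 𝔤), e i⁆ = weight i h • e i
  weight_rho : ∀ i, weight i rho = deg i
  deg_lt : ∀ i, |deg i| < N
  mem_of_deg : ∀ {i}, deg i = 0 → e i ∈ H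

namespace HomogeneousBasis

variable {H : LieSubalgebra ℂ 𝔤} {ι : Type*} {rho : H} {N : ℤ}
  (E : HomogeneousBasis H rho N ι) (B : InvariantForm 𝔤)

lemma lie_rho_e (i : ι) : ⁅(rho : 𝔤), E.e i⁆ = (E.deg i : ℂ) • E.e i := by
  rw [E.lie_e, E.weight_rho]

lemma form_rho_lie (i : ι) (x : 𝔤) {k : ℂ} (hx : ⁅(rho : 𝔤), x⁆ = k • x)
    (h : B.form x (E.e i) ≠ 0) : k + E.deg i = 0 := by
  have h₁ := B.form_lie_left rho x (E.e i)
  rw [hx, E.lie_rho_e, map_smul, map_smul, LinearMap.smul_apply, smul_eq_mul, smul_eq_mul] at h₁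
  have h₂ : (k + E.deg i) * B.form x (E.e i) = 0 := by rw [add_mul, h₁]; ring
  exact (mul_eq_zero.mp h₂).resolve_right h

variable [LieAlgebra.IsSimple ℂ 𝔤] [Finite ι] [DecidableEq ι]

/-- The basis dual to `E.e` for the invariant form. -/
def dual : Basis ι ℂ 𝔤 := B.form.dualBasis B.form_nondegenerate E.e

lemma form_dual_e (i j : ι) :
    B.form (E.dual B i) (E.e j) = if j = i then 1 else 0 :=
  LinearMap.BilinForm.apply_dualBasis_left B.form_nondegenerate E.e i j

lemma lie_rho_dual (i : ι) :
    ⁅(rho : 𝔤), E.dual B i⁆ = (-E.deg i : ℂ) • E.dual B i := by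
  rw [← sub_eq_zero]
  refine B.eq_zero_of_form_eq_zero fun z => ?_
  suffices B.form (⁅(rho : 𝔤), E.dual B i⁆ - (-E.deg i : ℂ) • E.dual B i) = 0 by
    rw [this, LinearMap.zero_apply]
  refine E.e.ext fun j => ?_
  rw [map_sub, map_smul, LinearMap.sub_apply, LinearMap.smul_apply, B.form_lie_left, E.lie_rho_e,
    map_smul, E.form_dual_e]
  split_ifs with h
  · rw [h]; simp
  · simp

end HomogeneousBasis

open Classical in
lemma isInternal_rootSpace [FiniteDimensional ℂ 𝔤] [IsKilling ℂ 𝔤] (H : LieSubalgebra ℂ 𝔤)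
    [H.IsCartanSubalgebra] :
    DirectSum.IsInternal fun α : LieModule.Weight ℂ H 𝔤 =>
      (LieAlgebra.rootSpace H α).toSubmodule := by
  refine DirectSum.isInternal_submodule_of_iSupIndep_of_iSup_eq_top
    (LieSubmodule.iSupIndep_toSubmodule.mpr (LieModule.iSupIndep_genWeightSpace' ℂ H 𝔤)) ?_
  rw [← LieSubmodule.iSup_toSubmodule, LieModule.iSup_genWeightSpace_eq_top' ℂ H 𝔤]
  rfl

variable [FiniteDimensional ℂ 𝔤] [LieAlgebra.IsSimple ℂ 𝔤]
  {H : LieSubalgebra ℂ 𝔤} [H.IsCartanSubalgebra]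

/-- The element of the Cartan subalgebra on which all simple roots take the value `1`. -/
def weylCovector (b : (rootSystem H).Base) : H :=
  (evalEquiv ℂ H).symm (∑ i : b.support, b.toWeightBasis.coord i)

lemma apply_weylCovector (b : (rootSystem H).Base) (γ : Dual ℂ H) :
    γ (weylCovector b) = ∑ i : b.support, b.toWeightBasis.coord i γ := by
  have h := (evalEquiv ℂ H).apply_symm_apply (∑ i : b.support, b.toWeightBasis.coord i)
  have := LinearMap.congr_fun h γ
  rw [LinearMap.sum_apply] at this
  exact this

lemma root_weylCovector (b : (rootSystem H).Base) (α : H.root) :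
    (rootSystem H).root α (weylCovector b) = (b.height α : ℂ) := by
  rw [apply_weylCovector, ← ExtDoubleAffine.sum_coord_root]
  rfl

open Classical in
/-- The height of a weight: the height of the root if the weight is not zero, and `0` otherwise. -/
def weightHeight (b : (rootSystem H).Base) (α : LieModule.Weight ℂ H 𝔤) : ℤ :=
  if h : α ∈ H.root then b.height ⟨α, h⟩ else 0

/-- The root space decomposition, graded by the height of roots, gives a homogeneous basis. -/
theorem exists_homogeneousBasis (b : (rootSystem H).Base) {θ : H.root} (hθ : IsLongestRoot b θ) :
    ∃ n : ℕ, Nonempty (HomogeneousBasis H (weylCovector b) (b.height θ + 1) (Fin n)) := by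
  classical
  let v := fun α : LieModule.Weight ℂ H 𝔤 => finBasis ℂ (LieAlgebra.rootSpace H α).toSubmodule
  let e₀ := (isInternal_rootSpace H).collectedBasis v
  let σ := Fintype.equivFin (Σ α : LieModule.Weight ℂ H 𝔤,
    Fin (finrank ℂ (LieAlgebra.rootSpace H α).toSubmodule))
  have hmem : ∀ i, e₀ i ∈ LieAlgebra.rootSpace H i.1 := fun i =>
    (isInternal_rootSpace H).collectedBasis_mem v i
  have hzero : ∀ α : LieModule.Weight ℂ H 𝔤, α ∉ H.root → (α : H → ℂ) = 0 := fun α hα => by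
    by_contra h
    exact hα (Finset.mem_filter.mpr ⟨Finset.mem_univ _, h⟩)
  have hneg : ∀ α : H.root, b.height ((rootSystem H).reflectionPerm α α) = -b.height α :=
    b.height_reflectionPerm_self
  have hpos : 0 ≤ b.height θ := by
    have h := hθ ((rootSystem H).reflectionPerm θ θ)
    rw [hneg] at h
    omega
  refine ⟨_, ⟨{ e := e₀.reindex σ, weight := fun i => (σ.symm i).1.toLinear
                deg := fun i => weightHeight b (σ.symm i).1, lie_e := ?_, weight_rho := ?_
                deg_lt := ?_, mem_of_deg := ?_ }⟩⟩
  · intro h i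
    rw [Basis.reindex_apply]
    exact lie_eq_smul_of_mem_rootSpace (hmem _) h
  · intro i
    generalize (σ.symm i).1 = α
    by_cases hα : α ∈ H.root
    · rw [weightHeight, dif_pos hα, ← root_weylCovector]; rfl
    · rw [weightHeight, dif_neg hα]
      rw [Int.cast_zero]
      exact congrFun (hzero α hα) (weylCovector b)
  · intro i
    generalize (σ.symm i).1 = α
    by_cases hα : α ∈ H.root
    · rw [weightHeight, dif_pos hα, abs_lt]
      have h₁ := hθ ⟨α, hα⟩
      have h₂ := hθ ((rootSystem H).reflectionPerm ⟨α, hα⟩ ⟨α, hα⟩)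
      rw [hneg] at h₂
      omega
    · rw [weightHeight, dif_neg hα, abs_zero]; omega
  · intro i hi
    rw [Basis.reindex_apply]
    by_cases hα : (σ.symm i).1 ∈ H.root
    · rw [weightHeight, dif_pos hα] at hi
      exact absurd hi (b.height_ne_zero _)
    · have h := hmem (σ.symm i)
      rw [hzero _ hα, LieAlgebra.rootSpace_zero_eq] at h
      exact h

namespace HomogeneousBasis

variable {ι : Type*} {rho : H} {N : ℤ} (E : HomogeneousBasis H rho N ι) (B : InvariantForm 𝔤)

lemma lie_eq_zero_of_deg_eq_zero {i : ι} (hi : E.deg i = 0) {x : 𝔤} (hx : x ∈ H) :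
    ⁅x, E.e i⁆ = 0 := by
  have h : (⁅(⟨x, hx⟩ : H), (⟨E.e i, E.mem_of_deg hi⟩ : H)⁆ : H) = 0 := trivial_lie_zero _ _ _ _
  simpa using congrArg ((↑) : H → 𝔤) h

/-- The part of degree zero is spanned by the brackets of homogeneous elements of opposite nonzero
degrees. This is the dual statement: an element of `H` that is orthogonal to all these brackets
vanishes, because it is central. -/
lemma eq_zero_of_form_lie_eq_zero {y : 𝔤} (hy : y ∈ H)
    (h : ∀ i j, 0 < E.deg i → E.deg j = -E.deg i → B.form ⁅E.e j, E.e i⁆ y = 0) : y = 0 := by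
  have hwt : ∀ i, ⁅(rho : 𝔤), ⁅E.e i, y⁆⁆ = (E.deg i : ℂ) • ⁅E.e i, y⁆ := fun i => by
    have h₀ : ⁅(rho : 𝔤), y⁆ = 0 := by
      have h : (⁅rho, (⟨y, hy⟩ : H)⁆ : H) = 0 := trivial_lie_zero _ _ _ _
      simpa using congrArg ((↑) : H → 𝔤) h
    rw [leibniz_lie, E.lie_rho_e, h₀, lie_zero, add_zero, smul_lie]
  have hcomm : ∀ i, ⁅E.e i, y⁆ = 0 := by
    intro i
    refine B.eq_zero_of_form_eq_zero fun z => ?_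
    suffices B.form ⁅E.e i, y⁆ = 0 by rw [this, LinearMap.zero_apply]
    refine E.e.ext fun j => ?_
    rw [LinearMap.zero_apply]
    by_contra hne
    have hdeg := E.form_rho_lie B j _ (hwt i) hne
    have hdeg' : E.deg i + E.deg j = 0 := by exact_mod_cast hdeg
    have e₁ : B.form ⁅E.e i, y⁆ (E.e j) = B.form ⁅E.e j, E.e i⁆ y := by
      rw [B.symm, B.invariant]
    rcases lt_trichotomy (E.deg i) 0 with hi | hi | hi
    · have := h j i (by omega) (by omega)
      rw [e₁, ← lie_skew, map_neg, LinearMap.neg_apply, this, neg_zero] at hne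
      exact hne rfl
    · rw [← lie_skew, E.lie_eq_zero_of_deg_eq_zero hi hy] at hne
      simp at hne
    · rw [e₁, h i j hi (by omega)] at hne
      exact hne rfl
  have hcen : y ∈ LieAlgebra.center ℂ 𝔤 := by
    rw [LieModule.mem_maxTrivSubmodule]
    intro x
    have h₀ : (-LieAlgebra.ad ℂ 𝔤 y : Module.End ℂ 𝔤) = 0 := by
      refine E.e.ext fun i => ?_
      rw [LinearMap.neg_apply, LieAlgebra.ad_apply, lie_skew, hcomm, LinearMap.zero_apply]
    have := LinearMap.congr_fun h₀ x
    rwa [LinearMap.neg_apply, LieAlgebra.ad_apply, lie_skew] at this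
  rw [LieAlgebra.center_eq_bot] at hcen
  exact (LieSubmodule.mem_bot y).mp hcen

end HomogeneousBasis

end PrincipalGrading

/-! ### The grading of the extended double affine Lie algebra -/

section DoubleAffineGrading

attribute [local instance 100] LieRing.ofAssociativeRing

open LieAlgebra LieAlgebra.IsKilling Module ExtDoubleAffine

variable {𝔤 : Type*} [LieRing 𝔤] [LieAlgebra ℂ 𝔤]

lemma TwoLoop.bracket_single_zero_apply (x : 𝔤) (f : TwoLoop 𝔤) (m : ℤ × ℤ) :
    TwoLoop.bracket (Finsupp.single 0 x) f m = ⁅x, f m⁆ := by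
  classical
  induction f using Finsupp.induction_linear with
  | zero => simp
  | add f g hf hg => rw [map_add, Finsupp.add_apply, hf, hg, Finsupp.add_apply, lie_add]
  | single n y =>
    rw [TwoLoop.bracket_single, zero_add, Finsupp.single_apply, Finsupp.single_apply]
    split_ifs <;> simp

lemma TwoLoop.deriv_apply (d : ℂ × ℂ) (f : TwoLoop 𝔤) (m : ℤ × ℤ) :
    TwoLoop.deriv d f m = (d.1 * m.1 + d.2 * m.2) • f m := by
  classical
  induction f using Finsupp.induction_linear with
  | zero => simp
  | add f g hf hg => rw [map_add, Finsupp.add_apply, hf, hg, Finsupp.add_apply, smul_add]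
  | single n y =>
    rw [TwoLoop.deriv_single, Finsupp.single_apply, Finsupp.single_apply]
    split_ifs with h
    · rw [h]
    · rw [smul_zero]

lemma TwoLoop.cocycle_single_zero (B : InvariantForm 𝔤) (x : 𝔤) (f : TwoLoop 𝔤) :
    TwoLoop.cocycle B (Finsupp.single 0 x) f = 0 := by
  induction f using Finsupp.induction_linear with
  | zero => simp
  | add f g hf hg => rw [map_add, hf, hg, add_zero]
  | single n y => rw [TwoLoop.cocycle_single]; split_ifs <;> simp

namespace HomogeneousBasis

variable {H : LieSubalgebra ℂ 𝔤} {rho : H} {N : ℤ} {ι : Type*} (B : InvariantForm 𝔤)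
  (E : HomogeneousBasis H rho N ι)

variable (rho N) in
/-- The element `rho + N d₁` of `𝔥^`. If the simple roots take the value `1` on `rho` and `N - 1` is
the height of the longest root, its eigenvalue on `𝔗_β` is `φ(β)`. -/
def gradingElt : ExtDoubleAffine B := elt B 0 0 (rho : 𝔤) + (N : ℂ) • d₁ B

lemma gradingElt_mem_cartan : gradingElt rho N B ∈ cartan B H :=
  add_mem (elt_mem_cartan B H rho) (Submodule.smul_mem _ _ (d₁_mem_cartan B H))

lemma loop_gradingElt : loop (gradingElt rho N B) = Finsupp.single 0 (rho : 𝔤) := by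
  rw [gradingElt, map_add, map_smul]
  change Finsupp.single 0 (rho : 𝔤) + (N : ℂ) • 0 = _
  rw [smul_zero, add_zero]

lemma der_gradingElt : der (gradingElt rho N B) = ((N : ℂ), 0) := by
  rw [gradingElt, map_add, map_smul]
  change (0 : ℂ × ℂ) + (N : ℂ) • ((1 : ℂ), (0 : ℂ)) = _
  simp

/-- The degree of `e i (m, n)`, where `t = (i, (m, n))`: the eigenvalues of `rho + N d₁` and `d₂`,
ordered lexicographically. -/
def degree (t : ι × ℤ × ℤ) : ℤ ×ₗ ℤ := toLex (E.deg t.1 + N * t.2.1, t.2.2)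

/-- The element `e i (m, n)`, where `t = (i, (m, n))`. -/
def loopVec (t : ι × ℤ × ℤ) : ExtDoubleAffine B := elt B t.2.1 t.2.2 (E.e t.1)

/-- The coordinates of the 2-loop part with respect to the elements `e i (m, n)`. -/
def loopCoord : ExtDoubleAffine B →ₗ[ℂ] (ι × ℤ × ℤ) →₀ ℂ :=
  Finsupp.lsum ℂ (fun m : ℤ × ℤ => Finsupp.lmapDomain ℂ ℂ (fun i : ι => (i, m)) ∘ₗ
    E.e.repr.toLinearMap) ∘ₗ loop

lemma loopCoord_apply (x : ExtDoubleAffine B) (t : ι × ℤ × ℤ) :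
    E.loopCoord B x t = E.e.repr (loop x t.2) t.1 := by
  classical
  rw [loopCoord, LinearMap.comp_apply]
  generalize loop x = f
  induction f using Finsupp.induction_linear with
  | zero => simp
  | add f g hf hg =>
    rw [map_add, Finsupp.add_apply, hf, hg, Finsupp.add_apply, map_add, Finsupp.add_apply]
  | single n y =>
    obtain ⟨i, m⟩ := t
    rw [Finsupp.lsum_single, LinearMap.comp_apply, Finsupp.lmapDomain_apply, Finsupp.single_apply]
    split_ifs with h
    · subst h
      exact Finsupp.mapDomain_apply (Prod.mk_left_injective n) _ i
    · rw [map_zero, Finsupp.zero_apply]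
      refine Finsupp.mapDomain_of_notMem_range _ _ ?_
      rintro ⟨i', h'⟩
      exact h (congrArg Prod.snd h')

lemma loopCoord_loopVec (t : ι × ℤ × ℤ) :
    E.loopCoord B (E.loopVec B t) = Finsupp.single t 1 := by
  obtain ⟨i, m⟩ := t
  rw [loopCoord, LinearMap.comp_apply]
  change Finsupp.lsum ℂ _ (Finsupp.single m (E.e i)) = _
  rw [Finsupp.lsum_single, LinearMap.comp_apply, LinearEquiv.coe_coe, Basis.repr_self,
    Finsupp.lmapDomain_apply, Finsupp.mapDomain_single]

variable {B} in
lemma loopVec_ne_zero (t : ι × ℤ × ℤ) : E.loopVec B t ≠ 0 := by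
  intro h
  have := E.loopCoord_loopVec B t
  rw [h, map_zero] at this
  exact one_ne_zero (Finsupp.single_eq_zero.mp this.symm)

variable {B} in
lemma eq_of_loopCoord_eq {x y : ExtDoubleAffine B} (h : E.loopCoord B x = E.loopCoord B y)
    (h₁ : cen x = cen y) (h₂ : der x = der y) : x = y := by
  refine ExtDoubleAffine.ext (Finsupp.ext fun m => E.e.repr.injective (Finsupp.ext fun i => ?_))
    h₁ h₂
  have := DFunLike.congr_fun h (i, m)
  rwa [loopCoord_apply, loopCoord_apply] at this

variable {B} in
lemma eq_sum_loopCoord (x : ExtDoubleAffine B) :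
    x = ExtDoubleAffine.mk 0 (cen x) (der x) +
      Finsupp.linearCombination ℂ (E.loopVec B) (E.loopCoord B x) := by
  have hl : ∀ f, E.loopCoord B (Finsupp.linearCombination ℂ (E.loopVec B) f) = f := fun f => by
    have h : Finsupp.linearCombination ℂ (E.loopCoord B ∘ E.loopVec B) = LinearMap.id := by
      ext t : 2
      simp [loopCoord_loopVec]
    rw [Finsupp.apply_linearCombination, h, LinearMap.id_apply]
  have hc : ∀ f, cen (Finsupp.linearCombination ℂ (E.loopVec B) f) = 0 := fun f => by
    rw [Finsupp.linearCombination_apply, map_finsuppSum]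
    exact Finset.sum_eq_zero fun t _ => by
      beta_reduce; rw [map_smul]; exact smul_zero _
  have hd : ∀ f, der (Finsupp.linearCombination ℂ (E.loopVec B) f) = 0 := fun f => by
    rw [Finsupp.linearCombination_apply, map_finsuppSum]
    exact Finset.sum_eq_zero fun t _ => by
      beta_reduce; rw [map_smul]; exact smul_zero _
  refine E.eq_of_loopCoord_eq ?_ ?_ ?_
  · rw [map_add, hl]
    refine (Eq.trans ?_ (zero_add _)).symm
    congr 1
  · rw [map_add, hc, cen_mk, add_zero]
  · rw [map_add, hd, der_mk, add_zero]

lemma repr_lie_rho (x : 𝔤) (i : ι) : E.e.repr ⁅(rho : 𝔤), x⁆ i = E.deg i * E.e.repr x i := by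
  have : E.e.coord i ∘ₗ (LieAlgebra.ad ℂ 𝔤 (rho : 𝔤) : Module.End ℂ 𝔤) =
      (E.deg i : ℂ) • E.e.coord i := by
    refine E.e.ext fun j => ?_
    rw [LinearMap.comp_apply, LieAlgebra.ad_apply, E.lie_rho_e, map_smul, LinearMap.smul_apply,
      Basis.coord_apply, Basis.repr_self, smul_eq_mul, smul_eq_mul]
    by_cases h : j = i
    · rw [h]
    · rw [Finsupp.single_eq_of_ne (Ne.symm h), mul_zero, mul_zero]
  exact LinearMap.congr_fun this x

lemma loopCoord_lie_gradingElt (x : ExtDoubleAffine B) (t : ι × ℤ × ℤ) :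
    E.loopCoord B ⁅gradingElt rho N B, x⁆ t =
      ((E.deg t.1 + N * t.2.1 : ℤ) : ℂ) * E.loopCoord B x t := by
  rw [loopCoord_apply, loopCoord_apply, loop_lie]
  have h₃ : TwoLoop.deriv (der x) (Finsupp.single (0 : ℤ × ℤ) (rho : 𝔤)) = 0 := by
    rw [TwoLoop.deriv_single]; simp
  rw [loop_gradingElt, der_gradingElt, h₃, sub_zero, Finsupp.add_apply,
    TwoLoop.bracket_single_zero_apply, TwoLoop.deriv_apply, map_add, Finsupp.add_apply,
    repr_lie_rho, map_smul, Finsupp.smul_apply, smul_eq_mul]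
  push_cast
  ring

lemma cen_lie_gradingElt (x : ExtDoubleAffine B) : cen ⁅gradingElt rho N B, x⁆ = 0 := by
  rw [cen_lie, loop_gradingElt, TwoLoop.cocycle_single_zero]

lemma loopCoord_lie_d₂ (x : ExtDoubleAffine B) (t : ι × ℤ × ℤ) :
    E.loopCoord B ⁅d₂ B, x⁆ t = (t.2.2 : ℂ) * E.loopCoord B x t := by
  rw [loopCoord_apply, loopCoord_apply, loop_lie]
  simp [d₂, TwoLoop.deriv_apply]

lemma cen_lie_d₂ (x : ExtDoubleAffine B) : cen ⁅d₂ B, x⁆ = 0 := by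
  rw [cen_lie, d₂, loop_mk, map_zero, LinearMap.zero_apply]

variable (rho N) in
/-- The simultaneous eigenspaces of `rho + N d₁` and `d₂`. -/
def eigen (D : ℤ ×ₗ ℤ) : Submodule ℂ (ExtDoubleAffine B) where
  carrier := {x |
    ⁅gradingElt rho N B, x⁆ = ((ofLex D).1 : ℂ) • x ∧ ⁅d₂ B, x⁆ = ((ofLex D).2 : ℂ) • x}
  add_mem' {x y} hx hy := by
    refine ⟨?_, ?_⟩
    · rw [lie_add, hx.1, hy.1, smul_add]
    · rw [lie_add, hx.2, hy.2, smul_add]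
  zero_mem' := by simp
  smul_mem' c x hx := by
    refine ⟨?_, ?_⟩
    · rw [lie_smul, hx.1, smul_comm]
    · rw [lie_smul, hx.2, smul_comm]

variable {B}

lemma mem_eigen {D : ℤ ×ₗ ℤ} {x : ExtDoubleAffine B} : x ∈ eigen rho N B D ↔
    ⁅gradingElt rho N B, x⁆ = ((ofLex D).1 : ℂ) • x ∧ ⁅d₂ B, x⁆ = ((ofLex D).2 : ℂ) • x := Iff.rfl

lemma lie_mem_eigen {D D' : ℤ ×ₗ ℤ} {x y : ExtDoubleAffine B} (hx : x ∈ eigen rho N B D)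
    (hy : y ∈ eigen rho N B D') : ⁅x, y⁆ ∈ eigen rho N B (D + D') := by
  refine mem_eigen.mpr ⟨?_, ?_⟩
  · rw [leibniz_lie, hx.1, hy.1, smul_lie, lie_smul, ← add_smul, ofLex_add, Prod.fst_add,
      Int.cast_add]
  · rw [leibniz_lie, hx.2, hy.2, smul_lie, lie_smul, ← add_smul, ofLex_add, Prod.snd_add,
      Int.cast_add]

lemma mem_eigen_of_loopCoord {D : ℤ ×ₗ ℤ} {x : ExtDoubleAffine B}
    (h : ∀ t, E.loopCoord B x t ≠ 0 → E.degree t = D) (h₁ : cen x = 0 ∨ D = 0)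
    (h₂ : der x = 0 ∨ D = 0) : x ∈ eigen rho N B D := by
  have aux : ∀ (u : ExtDoubleAffine B) (k : ℤ) (a : ExtDoubleAffine B →ₗ[ℂ] ℂ × ℂ),
      a u = 0 → (a x = 0 ∨ k = 0) → a u = a ((k : ℂ) • x) := by
    rintro u k a h (h' | rfl)
    · rw [map_smul, h, h', smul_zero]
    · rw [h, Int.cast_zero, zero_smul, map_zero]
  refine mem_eigen.mpr ⟨?_, ?_⟩
  · refine E.eq_of_loopCoord_eq (Finsupp.ext fun t => ?_)
      (aux _ _ _ (cen_lie_gradingElt B x) (h₁.imp_right fun h => by rw [h]; rfl))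
      (aux _ _ _ rfl (h₂.imp_right fun h => by rw [h]; rfl))
    rw [loopCoord_lie_gradingElt, map_smul, Finsupp.smul_apply, smul_eq_mul]
    by_cases h0 : E.loopCoord B x t = 0
    · rw [h0, mul_zero, mul_zero]
    · rw [← h t h0]; rfl
  · refine E.eq_of_loopCoord_eq (Finsupp.ext fun t => ?_)
      (aux _ _ _ (cen_lie_d₂ B x) (h₁.imp_right fun h => by rw [h]; rfl))
      (aux _ _ _ rfl (h₂.imp_right fun h => by rw [h]; rfl))
    rw [loopCoord_lie_d₂, map_smul, Finsupp.smul_apply, smul_eq_mul]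
    by_cases h0 : E.loopCoord B x t = 0
    · rw [h0, mul_zero, mul_zero]
    · rw [← h t h0]; rfl

lemma loopVec_mem_eigen (t : ι × ℤ × ℤ) : E.loopVec B t ∈ eigen rho N B (E.degree t) := by
  refine E.mem_eigen_of_loopCoord (fun s hs => ?_) (Or.inl rfl) (Or.inl rfl)
  rw [loopCoord_loopVec] at hs
  by_contra hne
  refine hs (Finsupp.single_eq_of_ne ?_)
  rintro rfl
  exact hne rfl

lemma mk_zero_mem_eigen (c d : ℂ × ℂ) :
    (ExtDoubleAffine.mk 0 c d : ExtDoubleAffine B) ∈ eigen rho N B 0 := by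
  refine mem_eigen.mpr ⟨?_, ?_⟩
  · rw [ofLex_zero, Prod.fst_zero, Int.cast_zero, zero_smul]
    refine ExtDoubleAffine.ext ?_ (by rw [cen_lie_gradingElt]; rfl) rfl
    rw [loop_lie, loop_mk, der_mk]
    rw [loop_gradingElt, TwoLoop.deriv_single]; simp
  · rw [ofLex_zero, Prod.snd_zero, Int.cast_zero, zero_smul]
    refine ExtDoubleAffine.ext ?_ (by rw [cen_lie_d₂]; rfl) rfl
    simp [d₂]

lemma degree_of_loopCoord {D : ℤ ×ₗ ℤ} {x : ExtDoubleAffine B} (hx : x ∈ eigen rho N B D)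
    {t : ι × ℤ × ℤ} (ht : E.loopCoord B x t ≠ 0) : E.degree t = D := by
  have h₁ := E.loopCoord_lie_gradingElt B x t
  have h₂ := E.loopCoord_lie_d₂ B x t
  rw [hx.1, map_smul, Finsupp.smul_apply, smul_eq_mul] at h₁
  rw [hx.2, map_smul, Finsupp.smul_apply, smul_eq_mul] at h₂
  refine ofLex_inj.mp (Prod.ext ?_ ?_)
  · exact_mod_cast (mul_right_cancel₀ ht h₁).symm
  · exact_mod_cast (mul_right_cancel₀ ht h₂).symm

lemma cen_der_eq_zero_of_mem_eigen {D : ℤ ×ₗ ℤ} {x : ExtDoubleAffine B} (hx : x ∈ eigen rho N B D)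
    (hD : D ≠ 0) : cen x = 0 ∧ der x = 0 := by
  have h₁ := congrArg cen hx.1
  have h₂ := congrArg cen hx.2
  have h₃ := congrArg der hx.1
  have h₄ := congrArg der hx.2
  rw [cen_lie_gradingElt, map_smul] at h₁
  rw [cen_lie_d₂, map_smul] at h₂
  rw [der_lie, map_smul] at h₃ h₄
  by_cases h : (ofLex D).1 = 0
  · have h' : ((ofLex D).2 : ℂ) ≠ 0 := fun h' =>
      hD (ofLex_inj.mp (Prod.ext h (by exact_mod_cast h')))
    exact ⟨(smul_eq_zero.mp h₂.symm).resolve_left h', (smul_eq_zero.mp h₄.symm).resolve_left h'⟩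
  · have h' : ((ofLex D).1 : ℂ) ≠ 0 := by exact_mod_cast h
    exact ⟨(smul_eq_zero.mp h₁.symm).resolve_left h', (smul_eq_zero.mp h₃.symm).resolve_left h'⟩

lemma eq_sum_of_mem_eigen {D : ℤ ×ₗ ℤ} {x : ExtDoubleAffine B} (hx : x ∈ eigen rho N B D)
    (hD : D ≠ 0) : x = Finsupp.linearCombination ℂ (E.loopVec B) (E.loopCoord B x) := by
  conv_lhs => rw [E.eq_sum_loopCoord x, (cen_der_eq_zero_of_mem_eigen hx hD).1,
    (cen_der_eq_zero_of_mem_eigen hx hD).2]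
  exact zero_add _

lemma iSup_eigen (E : HomogeneousBasis H rho N ι) : ⨆ D, eigen rho N B D = ⊤ := by
  refine eq_top_iff.mpr fun x _ => ?_
  rw [E.eq_sum_loopCoord x]
  refine add_mem (Submodule.mem_iSup_of_mem 0 (mk_zero_mem_eigen _ _)) ?_
  rw [Finsupp.linearCombination_apply]
  exact Submodule.sum_mem _ fun t _ => Submodule.smul_mem _ _
    (Submodule.mem_iSup_of_mem _ (E.loopVec_mem_eigen t))

variable (B)

/-- The indices of the basis vectors `e i (m, n)` of negative degree. -/
abbrev NegIndex : Type _ := {t : ι × ℤ × ℤ // t ∈ {t | E.degree t < 0}}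

/-- The coordinates along the basis vectors of negative degree. -/
def negCoord : ExtDoubleAffine B →ₗ[ℂ] E.NegIndex →₀ ℂ :=
  Finsupp.lsubtypeDomain {t | E.degree t < 0} ∘ₗ E.loopCoord B

lemma negCoord_apply (x : ExtDoubleAffine B) (j : E.NegIndex) :
    E.negCoord B x j = E.loopCoord B x j.1 := rfl

/-- The grading of `𝔗` by the eigenvalues of `rho + N d₁` and `d₂`. -/
def grading : TriangularGrading (ExtDoubleAffine B) E.NegIndex (ℤ ×ₗ ℤ) where
  piece := eigen rho N B
  lie_mem := lie_mem_eigen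
  iSup_piece := E.iSup_eigen
  level :=
    { toFun := fun D => (ofLex D).1
      map_zero' := rfl
      map_add' := fun _ _ => rfl }
  level_mono := by
    intro D D' h
    rcases Prod.Lex.le_iff.mp h with h | h
    · exact h.le
    · exact h.1.le
  vec := fun j => E.loopVec B j.1
  deg := fun j => E.degree j.1
  vec_mem := fun j => E.loopVec_mem_eigen j.1
  deg_neg := fun j => j.2
  coord := E.negCoord B
  coord_vec := by
    classical
    intro j
    ext j'
    rw [negCoord_apply, loopCoord_loopVec, Finsupp.single_apply, Finsupp.single_apply]
    simp only [Subtype.ext_iff]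
  coord_of_nonneg := by
    intro D x hD hx
    ext j
    by_contra h
    have := E.degree_of_loopCoord hx h
    have hj : E.degree j.1 < 0 := j.2
    rw [this] at hj
    exact absurd hj (not_lt.mpr hD)
  eq_sum_coord := by
    intro D x hD hx
    conv_lhs => rw [E.eq_sum_of_mem_eigen hx hD.ne]
    rw [Finsupp.linearCombination_apply, ← Finsupp.sum_subtypeDomain_index
      (p := fun t => t ∈ {t | E.degree t < 0})]
    · rfl
    · intro t ht
      have := E.degree_of_loopCoord hx (Finsupp.mem_support_iff.mp ht)
      exact this.trans_lt hD
  deg_of_coord := fun hx h => E.degree_of_loopCoord hx h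

end HomogeneousBasis

end DoubleAffineGrading

/-! ### The imaginary Borel subalgebra as the nonnegative part -/

section Borel

attribute [local instance 100] LieRing.ofAssociativeRing

open LieAlgebra LieAlgebra.IsKilling Module ExtDoubleAffine

namespace TriangularGrading

variable {L : Type*} [LieRing L] [LieAlgebra ℂ L] {J Γ : Type*}
    [AddCommGroup Γ] [LinearOrder Γ] [IsOrderedAddMonoid Γ] (S : TriangularGrading L J Γ)

lemma mem_span_vec_of_neg {D : Γ} {x : L} (hD : D < 0) (hx : x ∈ S.piece D) :
    x ∈ Submodule.span ℂ (Set.range S.vec) := by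
  rw [S.eq_sum_coord hD hx]
  exact Submodule.sum_mem _ fun j _ => Submodule.smul_mem _ _ (Submodule.subset_span ⟨j, rfl⟩)

/-- The sum of the pieces of negative degree. -/
def negPart : LieSubalgebra ℂ L where
  __ := Submodule.span ℂ (Set.range S.vec)
  lie_mem' := by
    intro x y hx hy
    change x ∈ Submodule.span ℂ (Set.range S.vec) at hx
    change y ∈ Submodule.span ℂ (Set.range S.vec) at hy
    change ⁅x, y⁆ ∈ Submodule.span ℂ (Set.range S.vec)
    induction hx, hy using Submodule.span_induction₂ with
    | mem_mem x y hx hy =>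
      obtain ⟨j, rfl⟩ := hx
      obtain ⟨j', rfl⟩ := hy
      exact S.mem_span_vec_of_neg (add_neg (S.deg_neg j) (S.deg_neg j'))
        (S.lie_mem (S.vec_mem j) (S.vec_mem j'))
    | zero_left => simp
    | zero_right => simp
    | add_left x y z _ _ _ h h' => rw [add_lie]; exact add_mem h h'
    | add_right x y z _ _ _ h h' => rw [lie_add]; exact add_mem h h'
    | smul_left a x y _ _ h => rw [smul_lie]; exact Submodule.smul_mem _ _ h
    | smul_right a x y _ _ h => rw [lie_smul]; exact Submodule.smul_mem _ _ h

lemma vec_mem_negPart (j : J) : S.vec j ∈ S.negPart := Submodule.subset_span ⟨j, rfl⟩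

lemma eq_sum_coord_of_mem_negPart {x : L} (hx : x ∈ S.negPart) :
    x = Finsupp.linearCombination ℂ S.vec (S.coord x) := by
  change x ∈ Submodule.span ℂ (Set.range S.vec) at hx
  induction hx using Submodule.span_induction with
  | mem x hx =>
    obtain ⟨j, rfl⟩ := hx
    rw [S.coord_vec, Finsupp.linearCombination_single, one_smul]
  | zero => simp
  | add x y _ _ hx hy => rw [map_add, map_add, ← hx, ← hy]
  | smul a x _ hx => rw [map_smul, map_smul, ← hx]

/-- A subalgebra that contains the pieces of nonnegative degree and has zero coordinates along the
pieces of negative degree is a complement of the negative part. -/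
lemma isCompl_negPart {𝔟 : LieSubalgebra ℂ L} (h : ∀ {D}, 0 ≤ D → S.piece D ≤ 𝔟.toSubmodule)
    (h' : ∀ x ∈ 𝔟, S.coord x = 0) : IsCompl S.negPart.toSubmodule 𝔟.toSubmodule := by
  refine ⟨Submodule.disjoint_def.mpr fun x hx hb => ?_, codisjoint_iff.mpr ?_⟩
  · rw [S.eq_sum_coord_of_mem_negPart hx, h' x hb, map_zero]
  · rw [eq_top_iff, ← S.iSup_piece]
    refine iSup_le fun D => ?_
    rcases lt_or_ge D 0 with hD | hD
    · exact le_sup_of_le_left fun x hx => S.mem_span_vec_of_neg hD hx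
    · exact le_sup_of_le_right (h hD)

end TriangularGrading

variable {𝔤 : Type*} [LieRing 𝔤] [LieAlgebra ℂ 𝔤] [FiniteDimensional ℂ 𝔤]
  [LieAlgebra.IsSimple ℂ 𝔤] {B : InvariantForm 𝔤} {H : LieSubalgebra ℂ 𝔤} [H.IsCartanSubalgebra]
  {b : (rootSystem H).Base} {θ : H.root} {ι : Type*}
  (E : HomogeneousBasis H (weylCovector b) (b.height θ + 1) ι)

namespace HomogeneousBasis

/-- `φ` is evaluation at the grading element `rho + (ht θ + 1) d₁`. -/
lemma phi_eq_apply_gradingElt (β : Dual ℂ (cartan B H)) :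
    phi b θ β = β ⟨gradingElt (weylCovector b) (b.height θ + 1) B, gradingElt_mem_cartan B⟩ := by
  have h₁ :
      (⟨gradingElt (weylCovector b) (b.height θ + 1) B, gradingElt_mem_cartan B⟩ : cartan B H) =
      ⟨elt B 0 0 (weylCovector b : 𝔤), elt_mem_cartan B H _⟩
        + ((b.height θ + 1 : ℤ) : ℂ) • ⟨d₁ B, d₁_mem_cartan B H⟩ := rfl
  have h₂ : β ⟨elt B 0 0 (weylCovector b : 𝔤), elt_mem_cartan B H _⟩ =
      ∑ i : b.support, b.toWeightBasis.coord i (restrict β) := by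
    rw [← apply_weylCovector]; rfl
  have h₃ : ∑ i : b.support, b.toWeightBasis.coord i ((rootSystem H).root θ) = (b.height θ : ℂ) :=
    sum_coord_root b θ
  rw [h₁, map_add, h₂, map_smul, smul_eq_mul]
  simp only [phi, dualSimple, dualSimpleZero, dualSimpleNegOne, LinearMap.sub_apply,
    LinearMap.add_apply, LinearMap.sum_apply, LinearMap.comp_apply, LinearMap.smul_apply,
    Dual.eval_apply, smul_eq_mul, Finset.sum_add_distrib, ← Finset.sum_mul]
  rw [h₃]
  push_cast
  ring

/-- The component in `H` of an element of `𝔥^`. -/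
def cartanProj : cartan B H →ₗ[ℂ] H :=
  LinearMap.codRestrict H.toSubmodule
    ((Finsupp.lapply (0 : ℤ × ℤ) : TwoLoop 𝔤 →ₗ[ℂ] 𝔤) ∘ₗ loop ∘ₗ (cartan B H).subtype)
    (fun x => by
      obtain ⟨a, c, d, h⟩ := exists_of_mem_cartan x.2
      simp only [LinearMap.comp_apply, Submodule.subtype_apply]
      rw [h, loop_mk, Finsupp.lapply_apply, Finsupp.single_eq_same]
      exact a.2)

/-- The weight of `e i (m, n)` with respect to `𝔥^`. -/
def cartanWeight (t : ι × ℤ × ℤ) : Dual ℂ (cartan B H) :=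
  E.weight t.1 ∘ₗ cartanProj
    + (t.2.1 : ℂ) • (LinearMap.fst ℂ ℂ ℂ ∘ₗ der ∘ₗ (cartan B H).subtype) + (t.2.2 : ℂ) • δ₂

lemma loopVec_mem_rootSpace (t : ι × ℤ × ℤ) : E.loopVec B t ∈ rootSpace (E.cartanWeight t) := by
  intro h
  obtain ⟨h, hh⟩ := h
  obtain ⟨a, c, d, rfl⟩ := exists_of_mem_cartan hh
  have ha : cartanProj (B := B) ⟨_, hh⟩ = a := Subtype.ext Finsupp.single_eq_same
  have hw : E.cartanWeight (B := B) t ⟨_, hh⟩ =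
      E.weight t.1 a + t.2.1 * d.1 + t.2.2 * d.2 := by
    conv_rhs => rw [← ha]
    rfl
  rw [hw]
  refine ExtDoubleAffine.ext ?_ ?_ ?_
  · rw [loop_lie, map_smul]
    simp only [loopVec, elt, LinearMap.coe_mk, AddHom.coe_mk, loop_mk, der_mk,
      TwoLoop.bracket_single, TwoLoop.deriv_single, zero_add, map_zero, LinearMap.zero_apply,
      sub_zero, E.lie_e, ← Finsupp.single_add, ← add_smul, Finsupp.smul_single]
    congr 2
    ring
  · rw [cen_lie, loop_mk, TwoLoop.cocycle_single_zero, map_smul]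
    exact (smul_zero _).symm
  · rw [der_lie, map_smul]
    exact (smul_zero _).symm

lemma phi_cartanWeight (t : ι × ℤ × ℤ) :
    phi b θ (E.cartanWeight (B := B) t) = ((E.deg t.1 + (b.height θ + 1) * t.2.1 : ℤ) : ℂ) := by
  rw [phi_eq_apply_gradingElt]
  refine smul_left_injective ℂ (E.loopVec_ne_zero (B := B) t) ?_
  beta_reduce
  rw [← E.loopVec_mem_rootSpace t]
  exact (E.loopVec_mem_eigen t).1

/-- Since all degrees have absolute value less than `ht θ + 1`, the level vanishes only on
`𝔥 ⊗ ℂ[t₂^±1]`. -/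
lemma deg_eq_zero_and_eq_zero {i : ι} {m : ℤ} (h : E.deg i + (b.height θ + 1) * m = 0) :
    E.deg i = 0 ∧ m = 0 := by
  have h₁ := abs_lt.mp (E.deg_lt i)
  have hm : m = 0 := by
    rcases lt_trichotomy m 0 with hm | hm | hm
    · nlinarith
    · exact hm
    · nlinarith
  subst hm
  exact ⟨by simpa using h, rfl⟩

open scoped ComplexOrder in
lemma loopVec_mem_posPart {t : ι × ℤ × ℤ} (ht : 0 < E.degree t) :
    E.loopVec B t ∈ posPart B b θ := by
  refine Submodule.mem_iSup_of_mem (E.cartanWeight t) (Submodule.mem_iSup_of_mem ?_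
    (E.loopVec_mem_rootSpace t))
  rcases Prod.Lex.lt_iff.mp ht with h | ⟨h, hn⟩
  · have hφ : (0 : ℂ) < phi b θ (E.cartanWeight (B := B) t) := by
      rw [E.phi_cartanWeight]
      exact_mod_cast h
    refine Or.inl ⟨⟨fun h0 => ?_, ?_⟩, hφ⟩
    · rw [h0, map_zero] at hφ
      exact lt_irrefl _ hφ
    · exact (Submodule.ne_bot_iff _).mpr ⟨_, E.loopVec_mem_rootSpace t, E.loopVec_ne_zero t⟩
  · obtain ⟨i, m, n⟩ := t
    obtain ⟨hi, rfl⟩ := E.deg_eq_zero_and_eq_zero h.symm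
    have hn' : 0 < n := hn
    refine Or.inr ⟨n.toNat, by omega, ?_⟩
    have hw : E.weight i = 0 := by
      ext h
      have := E.lie_e h i
      rw [E.lie_eq_zero_of_deg_eq_zero hi h.2] at this
      exact (smul_eq_zero.mp this.symm).resolve_right (E.e.ne_zero i)
    have hc : ((n.toNat : ℕ) : ℂ) = (n : ℂ) := by
      exact_mod_cast congrArg (Int.cast : ℤ → ℂ) (Int.toNat_of_nonneg hn'.le)
    rw [cartanWeight, hw, hc]
    simp

lemma mem_posPart_of_mem_eigen {D : ℤ ×ₗ ℤ} (hD : 0 < D) {x : ExtDoubleAffine B}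
    (hx : x ∈ (E.grading B).piece D) : x ∈ posPart B b θ := by
  rw [E.eq_sum_of_mem_eigen hx hD.ne', Finsupp.linearCombination_apply]
  refine Submodule.sum_mem _ fun t ht => Submodule.smul_mem _ _ (E.loopVec_mem_posPart ?_)
  rwa [E.degree_of_loopCoord hx (Finsupp.mem_support_iff.mp ht)]

lemma mem_cartan_of_mem_eigen_zero {x : ExtDoubleAffine B} (hx : x ∈ (E.grading B).piece 0) :
    x ∈ cartan B H := by
  have hmk : ∀ c d : ℂ × ℂ, (ExtDoubleAffine.mk 0 c d : ExtDoubleAffine B) ∈ cartan B H := by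
    intro c d
    have : (ExtDoubleAffine.mk 0 c d : ExtDoubleAffine B) =
        c.1 • c₁ B + c.2 • c₂ B + d.1 • d₁ B + d.2 • d₂ B := by
      refine ExtDoubleAffine.ext ?_ ?_ ?_ <;>
        simp [c₁, c₂, d₁, d₂]
    rw [this]
    exact add_mem (add_mem (add_mem (Submodule.smul_mem _ _ (c₁_mem_cartan B H))
      (Submodule.smul_mem _ _ (c₂_mem_cartan B H))) (Submodule.smul_mem _ _ (d₁_mem_cartan B H)))
      (Submodule.smul_mem _ _ (d₂_mem_cartan B H))
  rw [E.eq_sum_loopCoord x, Finsupp.linearCombination_apply]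
  refine add_mem (hmk _ _) (Submodule.sum_mem _ fun t ht => Submodule.smul_mem _ _ ?_)
  have h := E.degree_of_loopCoord hx (Finsupp.mem_support_iff.mp ht)
  obtain ⟨i, m, n⟩ := t
  obtain ⟨hi, rfl⟩ := E.deg_eq_zero_and_eq_zero (congrArg (fun D => (ofLex D).1) h)
  obtain rfl : n = 0 := congrArg (fun D => (ofLex D).2) h
  exact elt_mem_cartan B H ⟨E.e i, E.mem_of_deg hi⟩

open scoped ComplexOrder in
/-- A root vector of `𝔗_𝓘` is an eigenvector of the grading element and of `d₂`, so the coordinates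
of nonpositive degree vanish. -/
lemma degree_pos_of_mem_posPart {x : ExtDoubleAffine B} (hx : x ∈ posPart B b θ)
    {t : ι × ℤ × ℤ} (ht : E.loopCoord B x t ≠ 0) : 0 < E.degree t := by
  by_contra hneg
  refine ht ?_
  have hle : posPart B b θ ≤ LinearMap.ker (Finsupp.lapply t ∘ₗ E.loopCoord B) := by
    refine iSup₂_le fun β hβ y hy => ?_
    rw [LinearMap.mem_ker, LinearMap.comp_apply, Finsupp.lapply_apply]
    by_contra h
    refine hneg ?_
    have h₁ : ((E.deg t.1 + (b.height θ + 1) * t.2.1 : ℤ) : ℂ) = phi b θ β := by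
      rw [phi_eq_apply_gradingElt]
      refine mul_right_cancel₀ h ?_
      rw [← loopCoord_lie_gradingElt, hy ⟨gradingElt (weylCovector b) (b.height θ + 1) B,
        gradingElt_mem_cartan B⟩, map_smul]
      rfl
    have h₂ : (t.2.2 : ℂ) = β ⟨d₂ B, d₂_mem_cartan B H⟩ := by
      refine mul_right_cancel₀ h ?_
      rw [← loopCoord_lie_d₂, hy ⟨d₂ B, d₂_mem_cartan B H⟩, map_smul]
      rfl
    rcases hβ with hβ | ⟨n, hn, rfl⟩
    · have h₃ := hβ.2
      rw [← h₁] at h₃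
      exact Prod.Lex.lt_iff.mpr (Or.inl (by exact_mod_cast h₃))
    · rw [map_smul, phi_delta_two, smul_zero] at h₁
      have h₃ : (δ₂ : Dual ℂ (cartan B H)) ⟨d₂ B, d₂_mem_cartan B H⟩ = 1 := rfl
      rw [LinearMap.smul_apply, h₃, smul_eq_mul, mul_one] at h₂
      have h₄ : t.2.2 = n := by exact_mod_cast h₂
      refine Prod.Lex.lt_iff.mpr (Or.inr ⟨(by exact_mod_cast h₁.symm), ?_⟩)
      change 0 < t.2.2
      omega
  exact hle hx

lemma coord_of_mem_borel {x : ExtDoubleAffine B} (hx : x ∈ borel B b θ) :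
    (E.grading B).coord x = 0 := by
  obtain ⟨y, hy, z, hz, rfl⟩ := Submodule.mem_sup.mp
    (show x ∈ cartan B H ⊔ posPart B b θ from hx)
  rw [map_add, (E.grading B).coord_of_nonneg le_rfl, zero_add]
  · ext j
    by_contra h
    exact (E.degree_pos_of_mem_posPart hz h).not_gt ((E.grading B).deg_neg j)
  · obtain ⟨a, c, d, rfl⟩ := exists_of_mem_cartan hy
    refine E.mem_eigen_of_loopCoord (fun t ht => ?_) (Or.inr rfl) (Or.inr rfl)
    rw [loopCoord_apply, loop_mk] at ht
    have ht2 : t.2 = 0 := by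
      by_contra h
      rw [Finsupp.single_eq_of_ne h, map_zero] at ht
      exact ht rfl
    rw [ht2, Finsupp.single_eq_same] at ht
    have hdeg : E.deg t.1 = 0 := by
      have h := E.repr_lie_rho (a : 𝔤) t.1
      have h0 : ⁅(weylCovector b : 𝔤), (a : 𝔤)⁆ = 0 := by
        rw [← LieSubalgebra.coe_bracket, trivial_lie_zero, ZeroMemClass.coe_zero]
      rw [h0, map_zero, Finsupp.zero_apply] at h
      exact_mod_cast (mul_eq_zero.mp h.symm).resolve_right ht
    rw [degree, ht2, hdeg]
    simp

lemma piece_le_borel {D : ℤ ×ₗ ℤ} (hD : 0 ≤ D) :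
    (E.grading B).piece D ≤ (borel B b θ).toSubmodule := by
  intro x hx
  rcases hD.eq_or_lt with rfl | hD
  · exact Submodule.mem_sup_left (E.mem_cartan_of_mem_eigen_zero hx)
  · exact Submodule.mem_sup_right (E.mem_posPart_of_mem_eigen hD hx)

lemma isCompl_borel : IsCompl (E.grading B).negPart.toSubmodule (borel B b θ).toSubmodule :=
  (E.grading B).isCompl_negPart E.piece_le_borel fun _ => E.coord_of_mem_borel

end HomogeneousBasis

end Borel

/-! ### Derivations that detect polynomials -/

section Detection

attribute [local instance 100] LieRing.ofAssociativeRing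

open LieAlgebra LieAlgebra.IsKilling Module ExtDoubleAffine MvPolynomial

namespace TriangularGrading

/-- The chain rule for derivations of a polynomial ring. -/
lemma derivation_eq_sum_pderiv {J : Type*}
    (D : Derivation ℂ (MvPolynomial J ℂ) (MvPolynomial J ℂ)) (p : MvPolynomial J ℂ) :
    D p = ∑ j ∈ p.vars, D (X j) * pderiv j p := by
  classical
  let D' : Derivation ℂ (MvPolynomial J ℂ) (MvPolynomial J ℂ) :=
    ∑ j ∈ p.vars, D (X j) • pderiv j
  have hD' : ∀ q, D' q = ∑ j ∈ p.vars, D (X j) * pderiv j q := fun q => by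
    have h := congrFun (map_sum Derivation.coeFnAddMonoidHom
      (fun j => D (X j) • pderiv (R := ℂ) j) p.vars) q
    rw [Finset.sum_apply] at h
    exact h
  rw [← hD']
  refine derivation_eq_of_forall_mem_vars fun i hi => ?_
  rw [hD', Finset.sum_eq_single_of_mem i hi]
  · rw [pderiv_X_self, mul_one]
  · intro j _ hj
    rw [pderiv_X_of_ne hj.symm, mul_zero]

lemma constDer_pderiv {J : Type*} (κ : J → ℂ) (j : J) (p : MvPolynomial J ℂ) :
    constDer κ (pderiv j p) = pderiv j (constDer κ p) := by
  classical
  have h : ⁅constDer κ, pderiv (R := ℂ) j⁆ = 0 := by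
    refine derivation_ext fun i => ?_
    rw [Derivation.commutator_apply, constDer_X, pderiv_C, pderiv_X, sub_zero,
      Derivation.zero_apply]
    by_cases hij : i = j
    · subst hij; rw [Pi.single_eq_same, Derivation.map_one_eq_zero]
    · rw [Pi.single_eq_of_ne hij, map_zero]
  have := DFunLike.congr_fun h p
  rwa [Derivation.commutator_apply, Derivation.zero_apply, sub_eq_zero] at this

variable {L : Type*} [LieRing L] [LieAlgebra ℂ L] {J Γ : Type*}
    [AddCommGroup Γ] [LinearOrder Γ] [IsOrderedAddMonoid Γ] (S : TriangularGrading L J Γ)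

/-- Euler's identity for the level: `∑ level(j) X_j ∂p/∂X_j = c p`. -/
lemma exists_pderiv_ne_zero_of_neg {c : ℤ} {k : ℕ} {p : MvPolynomial J ℂ} (hc : c < 0)
    (hp : p ∈ S.symbols c k) (hp0 : p ≠ 0) :
    ∃ j ∈ p.vars, S.level (S.deg j) < 0 ∧ pderiv j p ≠ 0 := by
  let D : Derivation ℂ (MvPolynomial J ℂ) (MvPolynomial J ℂ) :=
    mkDerivation ℂ fun j => (S.level (S.deg j) : ℂ) • X j
  have hD : D p = (c : ℂ) • p := by
    clear hp0
    induction hp using Submodule.span_induction with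
    | mem p hp =>
      obtain ⟨l, ⟨rfl, rfl⟩, rfl⟩ := hp
      clear hc
      induction l with
      | nil => simp
      | cons j l ih =>
        rw [mono_cons, Derivation.leibniz, ih, mkDerivation_X, wt_cons, Int.cast_add, add_smul,
          smul_eq_mul, smul_eq_mul, mul_smul_comm, mul_smul_comm, mul_comm (mono l), add_comm]
    | zero => simp
    | add p q _ _ h h' => rw [map_add, h, h', smul_add]
    | smul a p _ h => rw [Derivation.map_smul, h, smul_comm]
  rw [derivation_eq_sum_pderiv] at hD
  have hne : (c : ℂ) • p ≠ 0 := smul_ne_zero (by exact_mod_cast hc.ne) hp0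
  rw [← hD] at hne
  obtain ⟨j, hj, hj0⟩ := Finset.exists_ne_zero_of_sum_ne_zero hne
  refine ⟨j, hj, lt_of_le_of_ne (S.level_deg_nonpos j) fun h => hj0 ?_, fun h => hj0 ?_⟩
  · rw [mkDerivation_X, h]; simp
  · rw [h, mul_zero]

/-- Euler's identity for the degree, `∑ X_j ∂p/∂X_j = (k + 1) p`, restricted to the variables of
level zero; all variables of `p` have level zero because no level is positive. -/
lemma exists_pderiv_ne_zero_of_level_zero {k : ℕ} {p : MvPolynomial J ℂ}
    (hp : p ∈ S.symbols 0 (k + 1)) (hp0 : p ≠ 0) :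
    ∃ j, S.level (S.deg j) = 0 ∧ pderiv j p ≠ 0 := by
  let a : J → ℂ := fun j => if S.level (S.deg j) = 0 then 1 else 0
  let D : Derivation ℂ (MvPolynomial J ℂ) (MvPolynomial J ℂ) := mkDerivation ℂ fun j => a j • X j
  have hD : D p = ((k + 1 : ℕ) : ℂ) • p := by
    clear hp0
    induction hp using Submodule.span_induction with
    | mem p hp =>
      obtain ⟨l, ⟨hl, hk⟩, rfl⟩ := hp
      rw [← hk]
      clear hk
      induction l with
      | nil => simp
      | cons j l ih =>
        have hj := S.level_deg_nonpos j
        have hl' := S.wt_nonpos l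
        rw [wt_cons] at hl
        have hj0 : S.level (S.deg j) = 0 := by omega
        have ha : a j = 1 := if_pos hj0
        rw [mono_cons, Derivation.leibniz, ih (by omega), mkDerivation_X, ha, one_smul,
          List.length_cons, Nat.cast_add, Nat.cast_one, add_smul, one_smul,
          smul_eq_mul, smul_eq_mul, mul_smul_comm, mul_comm (mono l)]
    | zero => simp
    | add p q _ _ h h' => rw [map_add, h, h', smul_add]
    | smul a p _ h => rw [Derivation.map_smul, h, smul_comm]
  rw [derivation_eq_sum_pderiv] at hD
  have hne : ((k + 1 : ℕ) : ℂ) • p ≠ 0 := smul_ne_zero (by exact_mod_cast k.succ_ne_zero) hp0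
  rw [← hD] at hne
  obtain ⟨j, -, hj0⟩ := Finset.exists_ne_zero_of_sum_ne_zero hne
  refine ⟨j, by_contra fun h => hj0 ?_, fun h => hj0 ?_⟩
  · rw [mkDerivation_X, show a j = 0 from if_neg h, zero_smul, zero_mul]
  · rw [h, mul_zero]

/-- A linear form that vanishes on the nonnegative pieces is determined by its values on the
basis of the negative part. -/
lemma sum_coord_mul (Λ : L →ₗ[ℂ] ℂ) (hΛ : ∀ {D x}, 0 ≤ D → x ∈ S.piece D → Λ x = 0) (x : L) :
    (S.coord x).sum (fun j a => a * Λ (S.vec j)) = Λ x := by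
  have h : (Finsupp.lsum ℂ fun j => LinearMap.toSpanSingleton ℂ ℂ (Λ (S.vec j))) ∘ₗ S.coord =
      Λ := by
    refine LinearMap.ext fun x => ?_
    have hx : x ∈ ⨆ D, S.piece D := by rw [S.iSup_piece]; trivial
    induction hx using Submodule.iSup_induction' with
    | mem D x hx =>
      rcases lt_or_ge D 0 with hD | hD
      · conv_rhs => rw [S.eq_sum_coord hD hx, map_finsuppSum]
        simp only [map_smul]
        rfl
      · rw [LinearMap.comp_apply, S.coord_of_nonneg hD hx, map_zero, hΛ hD hx]
    | zero => simp
    | add x y _ _ hx hy => rw [map_add, map_add, hx, hy]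
  exact LinearMap.congr_fun h x

/-- If the linear form `Λ` does not see the variables of `p`, the derivation that it defines picks
out of `adDer x p` the coefficients of the new variables. -/
lemma constDer_adDer (Λ : L →ₗ[ℂ] ℂ) (hΛ : ∀ {D x}, 0 ≤ D → x ∈ S.piece D → Λ x = 0)
    {p : MvPolynomial J ℂ} (hp : ∀ j ∈ p.vars, Λ (S.vec j) = 0) (x : L) :
    constDer (fun j => Λ (S.vec j)) (S.adDer x p) =
      ∑ j ∈ p.vars, Λ ⁅x, S.vec j⁆ • pderiv j p := by
  have h0 : constDer (fun j => Λ (S.vec j)) p = 0 :=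
    derivation_eq_zero_of_forall_mem_vars fun j hj => by rw [constDer_X, hp j hj, C_0]
  rw [derivation_eq_sum_pderiv (S.adDer x), map_sum]
  refine Finset.sum_congr rfl fun j _ => ?_
  have h1 : constDer (fun j => Λ (S.vec j)) (S.linSymbol ⁅x, S.vec j⁆) = C (Λ ⁅x, S.vec j⁆) := by
    rw [← S.sum_coord_mul Λ hΛ, linSymbol_apply, Finsupp.sum, Finsupp.sum, map_sum, map_sum]
    exact Finset.sum_congr rfl fun i _ => by
      rw [Derivation.map_smul, constDer_X, smul_eq_C_mul, ← C_mul]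
  rw [Derivation.leibniz, constDer_pderiv, h0, map_zero, smul_zero, zero_add, adDer_X, h1,
    smul_eq_mul, mul_comm, smul_eq_C_mul]

end TriangularGrading

/-! ### Detection of symbols in the double affine grading -/

namespace HomogeneousBasis

section

variable {𝔤 : Type*} [LieRing 𝔤] [LieAlgebra ℂ 𝔤] {B : InvariantForm 𝔤} {H : LieSubalgebra ℂ 𝔤}
  {rho : H} {N : ℤ} {ι : Type*} (E : HomogeneousBasis H rho N ι)

lemma deg_of_repr {x : 𝔤} {k : ℤ} (hx : ⁅(rho : 𝔤), x⁆ = (k : ℂ) • x) {i : ι}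
    (hi : E.e.repr x i ≠ 0) : E.deg i = k := by
  have h := E.repr_lie_rho x i
  rw [hx, map_smul, Finsupp.smul_apply, smul_eq_mul] at h
  exact_mod_cast (mul_right_cancel₀ hi h).symm

lemma elt_mem_piece {x : 𝔤} {k : ℤ} (hx : ⁅(rho : 𝔤), x⁆ = (k : ℂ) • x) (m n : ℤ) :
    elt B m n x ∈ (E.grading B).piece (toLex (k + N * m, n)) := by
  refine E.mem_eigen_of_loopCoord (fun t ht => ?_) (Or.inl rfl) (Or.inl rfl)
  rw [loopCoord_apply] at ht
  change E.e.repr (Finsupp.single (m, n) x t.2) t.1 ≠ 0 at ht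
  have h2 : t.2 = (m, n) := by
    by_contra h
    rw [Finsupp.single_eq_of_ne h, map_zero] at ht
    exact ht rfl
  rw [h2, Finsupp.single_eq_same] at ht
  rw [degree, h2, E.deg_of_repr hx ht]

variable (B) in
/-- The coefficient of `t₁^m t₂^n` paired with `z`. -/
def coeffForm (z : 𝔤) (m n : ℤ) : ExtDoubleAffine B →ₗ[ℂ] ℂ :=
  B.form z ∘ₗ (Finsupp.lapply (m, n) : TwoLoop 𝔤 →ₗ[ℂ] 𝔤) ∘ₗ loop

lemma coeffForm_elt (z x : 𝔤) (m n m' n' : ℤ) :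
    coeffForm B z m n (elt B m' n' x) = if m = m' ∧ n = n' then B.form z x else 0 := by
  change B.form z (Finsupp.single (m', n') x (m, n)) = _
  split_ifs with h
  · rw [h.1, h.2, Finsupp.single_eq_same]
  · rw [Finsupp.single_eq_of_ne (fun h' => h (Prod.mk_inj.mp h')), map_zero]

lemma coeffForm_lie_elt (z x y : 𝔤) (m n m₁ n₁ m₂ n₂ : ℤ) :
    coeffForm B z m n ⁅elt B m₁ n₁ x, elt B m₂ n₂ y⁆ =
      if m = m₁ + m₂ ∧ n = n₁ + n₂ then B.form ⁅z, x⁆ y else 0 := by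
  have h : coeffForm B z m n ⁅elt B m₁ n₁ x, elt B m₂ n₂ y⁆ =
      coeffForm B z m n (elt B (m₁ + m₂) (n₁ + n₂) ⁅x, y⁆) := by
    simp [coeffForm, elt]
  rw [h, coeffForm_elt, B.invariant]

/-- The form `coeffForm B z m n` is homogeneous, so it vanishes on the nonnegative pieces if the
degree of the elements on which it lives is negative. -/
lemma coeffForm_eq_zero {z : 𝔤} {k m n : ℤ} (hz : ⁅(rho : 𝔤), z⁆ = (k : ℂ) • z)
    (hm : -k + N * m ≤ 0) (hn : n < 0) {D : ℤ ×ₗ ℤ} {u : ExtDoubleAffine B} (hD : 0 ≤ D)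
    (hu : u ∈ (E.grading B).piece D) : coeffForm B z m n u = 0 := by
  change B.form z (loop u (m, n)) = 0
  rw [← E.e.linearCombination_repr (loop u (m, n)), Finsupp.linearCombination_apply,
    map_finsuppSum]
  refine Finset.sum_eq_zero fun i hi => ?_
  beta_reduce
  rw [map_smul]
  by_contra h
  have hne : B.form z (E.e i) ≠ 0 := right_ne_zero_of_smul h
  have hk : k + E.deg i = 0 := by exact_mod_cast E.form_rho_lie B i z hz hne
  have ht : E.loopCoord B u (i, (m, n)) ≠ 0 := by
    rw [loopCoord_apply]; exact Finsupp.mem_support_iff.mp hi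
  rw [← E.degree_of_loopCoord hu ht] at hD
  refine hD.not_gt (Prod.Lex.lt_iff.mpr ?_)
  change E.deg i + N * m < 0 ∨ E.deg i + N * m = 0 ∧ n < 0
  omega

variable (B)

/-- The linear map that sends `g` to the sum of the `(g | e i) ∂p/∂X_j` over the variables
`j = (i, (m, n))` of `p`, for fixed `(m, n)`. -/
def partialSum (p : MvPolynomial E.NegIndex ℂ) (mn : ℤ × ℤ) : 𝔤 →ₗ[ℂ] MvPolynomial E.NegIndex ℂ :=
  ∑ j ∈ p.vars with j.1.2 = mn,
    LinearMap.toSpanSingleton ℂ _ (pderiv j p) ∘ₗ B.form.flip (E.e j.1.1)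

lemma partialSum_apply (p : MvPolynomial E.NegIndex ℂ) (mn : ℤ × ℤ) (g : 𝔤) :
    E.partialSum B p mn g =
      ∑ j ∈ p.vars with j.1.2 = mn, B.form g (E.e j.1.1) • pderiv j p := by
  rw [partialSum, LinearMap.sum_apply]
  rfl

/-- For `x = x'(m', n')` with `n'` very negative, `adDer x p` contains variables of `t₂`-degree too
negative to occur in `p`. Their coefficients, which cannot cancel, are values of `partialSum`. -/
lemma exists_adDer_ne_zero (p : MvPolynomial E.NegIndex ℂ) {m₀ n₀ m' k k' : ℤ} {x' z : 𝔤}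
    (hx : ⁅(rho : 𝔤), x'⁆ = (k' : ℂ) • x') (hz : ⁅(rho : 𝔤), z⁆ = (k : ℂ) • z)
    (hpos : 0 < k' + N * m') (hneg : -k + N * (m' + m₀) ≤ 0)
    (hne : E.partialSum B p (m₀, n₀) ⁅z, x'⁆ ≠ 0) :
    ∃ (D : ℤ ×ₗ ℤ) (x : ExtDoubleAffine B), x ∈ (E.grading B).piece D ∧
      0 < (E.grading B).level D ∧ (E.grading B).adDer x p ≠ 0 := by
  -- No variable of `p` has `t₂`-degree `-K`; the exponent `-K - n₀` of `t₂` in `x` below produces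
  -- variables of this degree.
  set K : ℤ := 1 + ∑ j ∈ p.vars, |j.1.2.2| with hK
  have hK1 : ∀ j ∈ p.vars, |j.1.2.2| < K := fun j hj => by
    have := Finset.single_le_sum (f := fun j : E.NegIndex => |j.1.2.2|)
      (fun j _ => abs_nonneg _) hj
    beta_reduce at this
    omega
  have hK0 : 0 < K := by
    have := Finset.sum_nonneg (s := p.vars) (fun j : E.NegIndex => fun _ => abs_nonneg j.1.2.2)
    omega
  refine ⟨_, elt B m' (-K - n₀) x', E.elt_mem_piece hx _ _, hpos, fun h => hne ?_⟩
  have h₁ := (E.grading B).constDer_adDer (coeffForm B z (m' + m₀) (-K))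
    (fun hD hu => E.coeffForm_eq_zero hz hneg (by omega) hD hu) (p := p) ?_
    (elt B m' (-K - n₀) x')
  · rw [h, map_zero] at h₁
    rw [partialSum_apply, Finset.sum_filter]
    refine Eq.trans (Finset.sum_congr rfl fun j _ => ?_) h₁.symm
    have e : coeffForm B z (m' + m₀) (-K) ⁅elt B m' (-K - n₀) x', (E.grading B).vec j⁆ =
        if j.1.2 = (m₀, n₀) then B.form ⁅z, x'⁆ (E.e j.1.1) else 0 := by
      refine (coeffForm_lie_elt _ _ _ _ _ _ _ _ _).trans (if_congr ?_ rfl rfl)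
      rw [Prod.ext_iff]
      constructor <;> rintro ⟨h, h'⟩ <;> constructor <;> dsimp only at * <;> omega
    rw [e]
    split_ifs
    · rfl
    · rw [zero_smul]
  · intro j hj
    refine (coeffForm_elt _ _ _ _ _ _).trans (if_neg ?_)
    rintro ⟨-, h⟩
    have := (abs_lt.mp (hK1 j hj)).1
    omega

variable [LieAlgebra.IsSimple ℂ 𝔤] [Finite ι] [DecidableEq ι]

lemma partialSum_dual {p : MvPolynomial E.NegIndex ℂ} {j : E.NegIndex}
    (hj : j ∈ p.vars) : E.partialSum B p j.1.2 (E.dual B j.1.1) = pderiv j p := by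
  rw [partialSum_apply]
  have hj' : j ∈ p.vars.filter fun i => i.1.2 = j.1.2 := Finset.mem_filter.mpr ⟨hj, rfl⟩
  refine (Finset.sum_eq_single_of_mem j hj' ?_).trans ?_
  · intro i hi hij
    rw [form_dual_e, if_neg, zero_smul]
    intro h
    exact hij (Subtype.ext (Prod.ext h (Finset.mem_filter.mp hi).2))
  · rw [form_dual_e, if_pos rfl, one_smul]

lemma dual_mem_of_deg_eq_zero {i : ι} (hi : E.deg i = 0) : E.dual B i ∈ H := by
  rw [← E.e.linearCombination_repr (E.dual B i), Finsupp.linearCombination_apply]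
  refine H.toSubmodule.sum_mem fun j hj => H.toSubmodule.smul_mem _ (E.mem_of_deg ?_)
  have h := E.deg_of_repr (k := -E.deg i) (by rw [lie_rho_dual]; simp)
    (Finsupp.mem_support_iff.mp hj)
  rw [h, hi, neg_zero]

end

variable {𝔤 : Type*} [LieRing 𝔤] [LieAlgebra ℂ 𝔤] [FiniteDimensional ℂ 𝔤]
  [LieAlgebra.IsSimple ℂ 𝔤] (B : InvariantForm 𝔤) {H : LieSubalgebra ℂ 𝔤} [H.IsCartanSubalgebra]
  {rho : H} {N : ℤ} {ι : Type*} (E : HomogeneousBasis H rho N ι)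

variable [Finite ι]

/-- A nonzero partial derivative of negative level is detected. If `e i` has nonzero degree, the
bracket of `rho` with the dual vector is a nonzero multiple of the dual vector. If `e i ∈ 𝔥`, some
bracket of root vectors of opposite degrees pairs nontrivially with the partial derivatives. -/
lemma exists_adDer_ne_zero_of_level_neg {p : MvPolynomial E.NegIndex ℂ} {j : E.NegIndex}
    (hj : j ∈ p.vars) (hlevel : (E.grading B).level ((E.grading B).deg j) < 0)
    (hne : pderiv j p ≠ 0) :
    ∃ (D : ℤ ×ₗ ℤ) (x : ExtDoubleAffine B), x ∈ (E.grading B).piece D ∧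
      0 < (E.grading B).level D ∧ (E.grading B).adDer x p ≠ 0 := by
  classical
  obtain ⟨⟨i, m, n⟩, ht⟩ := j
  change E.deg i + N * m < 0 at hlevel
  have hdual := E.partialSum_dual B hj
  by_cases hi : E.deg i = 0
  · obtain ⟨s, hs⟩ := MvPolynomial.ne_zero_iff.mp hne
    -- The coefficient at `s` of `partialSum`, on elements of degree zero, is the form against `y`.
    let y : 𝔤 := ∑ j ∈ p.vars with j.1.2 = (m, n) ∧ E.deg j.1.1 = 0,
      coeff s (pderiv j p) • E.e j.1.1
    have hy : ∀ g, ⁅(rho : 𝔤), g⁆ = 0 →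
        B.form g y = coeff s (E.partialSum B p (m, n) g) := by
      intro g hg
      rw [partialSum_apply, map_sum, coeff_sum, ← Finset.filter_filter, Finset.sum_filter_of_ne]
      · exact Finset.sum_congr rfl fun j _ => by
          rw [map_smul, coeff_smul, smul_eq_mul, smul_eq_mul, mul_comm]
      · intro j _ hjne
        rw [map_smul] at hjne
        have := E.form_rho_lie B j.1.1 g (k := 0) (by rw [hg, zero_smul])
          (right_ne_zero_of_smul hjne)
        rw [zero_add] at this
        exact_mod_cast this
    have hyH : y ∈ H := H.toSubmodule.sum_mem fun j hj =>
      H.toSubmodule.smul_mem _ (E.mem_of_deg (Finset.mem_filter.mp hj).2.2)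
    have hy0 : y ≠ 0 := by
      intro h0
      have := hy (E.dual B i) (by rw [lie_rho_dual, hi]; simp)
      rw [h0, map_zero] at this
      exact hs (this.trans (congrArg (coeff s) hdual)).symm
    have hex : ∃ a c, 0 < E.deg a ∧ E.deg c = -E.deg a ∧ B.form ⁅E.e c, E.e a⁆ y ≠ 0 := by
      by_contra hcon
      push Not at hcon
      exact hy0 (E.eq_zero_of_form_lie_eq_zero B hyH hcon)
    obtain ⟨a, c, ha, hc, hac⟩ := hex
    have hlt := abs_lt.mp (E.deg_lt a)
    refine E.exists_adDer_ne_zero B p (m₀ := m) (n₀ := n) (m' := 0) (E.lie_rho_e a)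
      (E.lie_rho_e c) (by omega) ?_ ?_
    · rw [hi, zero_add] at hlevel
      have hm : m ≤ -1 := by nlinarith
      rw [hc]
      nlinarith
    · intro h0
      rw [hy, h0, coeff_zero] at hac
      · exact hac rfl
      · rw [leibniz_lie, E.lie_rho_e, E.lie_rho_e, smul_lie, lie_smul, ← add_smul, hc]
        simp
  · refine E.exists_adDer_ne_zero B p (m₀ := m) (n₀ := n) (m' := -m) (k' := -E.deg i) (k := 0)
      (z := rho) (x' := E.dual B i) (by rw [lie_rho_dual]; simp) (by simp) ?_ (by simp) ?_
    · linarith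
    · rw [lie_rho_dual, map_smul]
      refine smul_ne_zero (neg_ne_zero.mpr (by exact_mod_cast hi)) ?_
      exact hdual.symm ▸ hne

/-- The symbols are detected by the grading of `𝔗` in every representation in which `c₂` acts by a
nonzero scalar. At level zero only the variables of `𝔥 ⊗ t₂⁻¹ℂ[t₂⁻¹]` occur, and
`𝔥 ⊗ ℂ[t₂^±1] ⊕ ℂc₂` is a Heisenberg algebra up to its center: `h(0, n)` acts as a multiple of the
derivative along the dual variable. -/
theorem detects (hN : ∀ {i : ι} {m : ℤ}, E.deg i + N * m = 0 → E.deg i = 0 ∧ m = 0)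
    {M : Type*} [AddCommGroup M] [Module ℂ M] (ρ : ExtDoubleAffine B →ₗ⁅ℂ⁆ Module.End ℂ M)
    {c : ℂ} (hc : c ≠ 0) (hρ : ∀ m, ρ (c₂ B) m = c • m) : (E.grading B).Detects ρ where
  neg hlt hp hp0 := by
    obtain ⟨j, hj, hlevel, hne⟩ := (E.grading B).exists_pderiv_ne_zero_of_neg hlt hp hp0
    exact E.exists_adDer_ne_zero_of_level_neg B hj hlevel hne
  zero {k p} hp hp0 := by
    classical
    obtain ⟨j, hlevel, hne⟩ := (E.grading B).exists_pderiv_ne_zero_of_level_zero hp hp0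
    obtain ⟨⟨i, m, n⟩, ht⟩ := j
    obtain ⟨hi, rfl⟩ := hN (show E.deg i + N * m = 0 from hlevel)
    have hn : n < 0 := by
      rcases Prod.Lex.lt_iff.mp (show E.degree (i, 0, n) < 0 from ht) with h | h
      · exact absurd h hlevel.not_lt
      · exact h.2
    have hn0 : (-n : ℂ) * c ≠ 0 := mul_ne_zero (neg_ne_zero.mpr (by exact_mod_cast hn.ne)) hc
    let j : E.NegIndex := ⟨(i, 0, n), ht⟩
    refine ⟨_, elt B 0 (-n) (E.dual B i), fun j' => if j' = j then (-n : ℂ) * c else 0, ?_, ?_,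
      E.elt_mem_piece (k := -E.deg i) (by rw [lie_rho_dual]; simp) _ _, ?_, ?_⟩
    · rw [hi]
      refine Prod.Lex.lt_iff.mpr (Or.inr ⟨by simp, ?_⟩)
      change 0 < -n
      omega
    · change -E.deg i + N * 0 = 0
      rw [hi]; simp
    · rintro ⟨⟨i', m', n'⟩, ht'⟩ hlevel' v
      obtain ⟨hi', rfl⟩ := hN (show E.deg i' + N * m' = 0 from hlevel')
      have hbr : ⁅elt B 0 (-n) (E.dual B i), elt B 0 n' (E.e i')⁆ =
          (if (i', n') = (i, n) then (-n : ℂ) else 0) • c₂ B := by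
        refine ExtDoubleAffine.ext ?_ ?_ ?_
        · rw [map_smul]
          simp [elt, c₂, E.lie_eq_zero_of_deg_eq_zero hi' (E.dual_mem_of_deg_eq_zero B hi)]
        · simp only [elt, c₂, LinearMap.coe_mk, AddHom.coe_mk, cen_lie, loop_mk,
            TwoLoop.cocycle_single, form_dual_e, map_smul, cen_mk, Prod.mk_add_mk, Prod.mk_inj,
            Prod.mk_eq_zero]
          by_cases h1 : i' = i <;> by_cases h2 : n' = n
          · simp [h1, h2]
          · have : ¬ -n + n' = 0 := by omega
            simp [h2, this]
          · simp [h1]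
          · simp [h1]
        · rw [map_smul]
          simp [elt, c₂]
      change ρ ⁅elt B 0 (-n) (E.dual B i), elt B 0 n' (E.e i')⁆ v = _
      rw [hbr, map_smul, LinearMap.smul_apply, hρ, smul_smul]
      congr 1
      change _ = if (⟨(i', 0, n'), ht'⟩ : E.NegIndex) = j then _ else _
      by_cases h : i' = i ∧ n' = n
      · obtain ⟨rfl, rfl⟩ := h
        rw [if_pos rfl, if_pos rfl]
      · rw [if_neg (fun h' => h (Prod.mk_inj.mp h')), if_neg, zero_mul]
        intro h'
        have := congrArg Subtype.val h'
        simp only [j, Prod.mk_inj] at this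
        exact h ⟨this.1, this.2.2⟩
    · have : TriangularGrading.constDer (fun j' => if j' = j then (-n : ℂ) * c else 0) =
          ((-n : ℂ) * c) • pderiv (R := ℂ) j := by
        refine derivation_ext fun j' => ?_
        rw [TriangularGrading.constDer_X, Derivation.smul_apply]
        split_ifs with h
        · rw [h, pderiv_X_self, smul_eq_C_mul, mul_one]
        · rw [pderiv_X_of_ne h, smul_zero, C_0]
      rw [this, Derivation.smul_apply]
      exact smul_ne_zero hn0 hne

end HomogeneousBasis

end Detection

/-! ### The imaginary Verma module -/

section VermaModule

attribute [local instance 100] LieRing.ofAssociativeRing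

open LieAlgebra LieAlgebra.IsKilling Module ExtDoubleAffine UniversalEnvelopingAlgebra

lemma ExtDoubleAffine.c₂_lie {𝔤 : Type*} [LieRing 𝔤] [LieAlgebra ℂ 𝔤] {B : InvariantForm 𝔤}
    (x : ExtDoubleAffine B) : ⁅c₂ B, x⁆ = 0 := by
  ext1 <;> simp [c₂]

variable {𝔤 : Type*} [LieRing 𝔤] [LieAlgebra ℂ 𝔤] [FiniteDimensional ℂ 𝔤]
  [LieAlgebra.IsSimple ℂ 𝔤] {B : InvariantForm 𝔤} {H : LieSubalgebra ℂ 𝔤} [H.IsCartanSubalgebra]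

namespace ExtDoubleAffine

variable {b : (rootSystem H).Base} {θ : H.root} (lam : Dual ℂ (cartan B H))

lemma borelCharacter_of_mem_cartan {x : ExtDoubleAffine B} (hx : x ∈ cartan B H) :
    borelCharacter b θ lam ⟨x, Submodule.mem_sup_left hx⟩ = lam ⟨x, hx⟩ := by
  have h := borelCharacter_apply b θ lam hx (zero_mem _)
  simp only [add_zero] at h
  exact h

lemma borelCharacter_of_mem_posPart {x : ExtDoubleAffine B} (hx : x ∈ posPart B b θ) :
    borelCharacter b θ lam ⟨x, Submodule.mem_sup_right hx⟩ = 0 := by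
  have h := borelCharacter_apply b θ lam (zero_mem _) hx
  simp only [zero_add] at h
  exact h.trans (map_zero lam)

variable (b θ) in
/-- The representation of `𝔗` on the imaginary Verma module. -/
abbrev vermaRep : ExtDoubleAffine B →ₗ⁅ℂ⁆ Module.End ℂ (ImaginaryVermaModule b θ lam) :=
  envelopingRep (ExtDoubleAffine B) (ImaginaryVermaModule b θ lam)

variable (b θ) in
/-- The canonical generator `1 ⊗ 1_λ` of the imaginary Verma module. -/
def highestVector : ImaginaryVermaModule b θ lam :=
  Submodule.Quotient.mk (1 ⊗ₜ[ℂ] (show OneDim b θ lam from (1 : ℂ)))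

lemma mk_one_tmul (z : OneDim b θ lam) :
    (Submodule.Quotient.mk (1 ⊗ₜ[ℂ] z) : ImaginaryVermaModule b θ lam) =
      (show ℂ from z) • highestVector b θ lam := by
  rw [highestVector, ← Submodule.Quotient.mk_smul, ← TensorProduct.tmul_smul]
  congr 2
  exact (mul_one (show ℂ from z)).symm

lemma vermaRep_highestVector {x : ExtDoubleAffine B} (hx : x ∈ borel B b θ) :
    vermaRep b θ lam x (highestVector b θ lam) =
      borelCharacter b θ lam ⟨x, hx⟩ • highestVector b θ lam := by
  have h := envelopingRep_mk (borel B b θ) (⟨x, hx⟩ : borel B b θ)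
    (show OneDim b θ lam from (1 : ℂ))
  refine h.trans ((mk_one_tmul lam _).trans ?_)
  congr 1
  exact mul_one (borelCharacter b θ lam ⟨x, hx⟩)

lemma vermaRep_highestVector_cartan {x : ExtDoubleAffine B} (hx : x ∈ cartan B H) :
    vermaRep b θ lam x (highestVector b θ lam) = lam ⟨x, hx⟩ • highestVector b θ lam := by
  rw [vermaRep_highestVector lam (Submodule.mem_sup_left hx), borelCharacter_of_mem_cartan]

lemma vermaRep_highestVector_posPart {x : ExtDoubleAffine B} (hx : x ∈ posPart B b θ) :
    vermaRep b θ lam x (highestVector b θ lam) = 0 := by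
  rw [vermaRep_highestVector lam (Submodule.mem_sup_right hx), borelCharacter_of_mem_posPart lam hx,
    zero_smul]

lemma eq_top_of_highestVector_mem (W : Submodule ℂ (ImaginaryVermaModule b θ lam))
    (hW : ∀ x, ∀ m ∈ W, vermaRep b θ lam x m ∈ W) (h : highestVector b θ lam ∈ W) : W = ⊤ :=
  eq_top_of_mk_mem _ W hW fun z => mk_one_tmul lam z ▸ W.smul_mem _ h

lemma vermaRep_c₂ (m : ImaginaryVermaModule b θ lam) :
    vermaRep b θ lam (c₂ B) m = lam ⟨c₂ B, c₂_mem_cartan B H⟩ • m := by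
  have h := eq_top_of_highestVector_mem lam
    (LinearMap.ker (vermaRep b θ lam (c₂ B) - lam ⟨c₂ B, c₂_mem_cartan B H⟩ • LinearMap.id)) ?_ ?_
  · have : m ∈ (⊤ : Submodule ℂ (ImaginaryVermaModule b θ lam)) := trivial
    rw [← h, LinearMap.mem_ker, LinearMap.sub_apply, sub_eq_zero] at this
    exact this
  · intro x m hm
    rw [LinearMap.mem_ker, LinearMap.sub_apply, sub_eq_zero] at hm ⊢
    rw [TriangularGrading.rep_comm, c₂_lie, hm, map_zero, LinearMap.zero_apply, add_zero]
    exact (vermaRep b θ lam x).map_smul _ _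
  · rw [LinearMap.mem_ker, LinearMap.sub_apply, sub_eq_zero]
    exact vermaRep_highestVector_cartan lam _

end ExtDoubleAffine

namespace HomogeneousBasis

variable {b : (rootSystem H).Base} {θ : H.root} {ι : Type*}
  (E : HomogeneousBasis H (weylCovector b) (b.height θ + 1) ι) (lam : Dual ℂ (cartan B H))

lemma isHighest_highestVector :
    (E.grading B).IsHighest (vermaRep b θ lam) (highestVector b θ lam) where
  pos hD hx := vermaRep_highestVector_posPart lam (E.mem_posPart_of_mem_eigen hD hx)
  zero hx := ⟨_, vermaRep_highestVector_cartan lam (E.mem_cartan_of_mem_eigen_zero hx)⟩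

/-- The imaginary Verma module maps to `U(𝔞)`, where `𝔞` is the negative part of `𝔗`, compatibly
with the action of `𝔞`. This replaces the Poincaré–Birkhoff–Witt theorem. -/
lemma exists_verma_map : ∃ G : ImaginaryVermaModule b θ lam →ₗ[ℂ]
      UniversalEnvelopingAlgebra ℂ (E.grading B).negPart,
    (∀ (a : (E.grading B).negPart) m,
      G (vermaRep b θ lam a m) = UniversalEnvelopingAlgebra.ι ℂ a * G m) ∧
    G (highestVector b θ lam) = 1 := by
  let g : OneDim b θ lam →ₗ[ℂ] UniversalEnvelopingAlgebra ℂ (E.grading B).negPart :=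
    LinearMap.toSpanSingleton ℂ (UniversalEnvelopingAlgebra ℂ (E.grading B).negPart) 1
  obtain ⟨G, hG, hG₁⟩ := exists_inducedModule_lift (borel B b θ)
    (complRep E.isCompl_borel (borelCharacter b θ lam) (borelCharacter_lie b θ lam)) g
    (fun x v => by
      change complAction _ _ _ ((show ℂ from v) • 1) =
        (borelCharacter b θ lam x * (show ℂ from v)) • 1
      rw [map_smul, complAction_one, smul_smul, mul_comm])
  refine ⟨G, fun a m => (hG a m).trans (complAction_left E.isCompl_borel _ a _), ?_⟩
  exact (hG₁ _).trans (one_smul ℂ _)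

lemma highestVector_ne_zero (E : HomogeneousBasis H (weylCovector b) (b.height θ + 1) ι)
    (lam : Dual ℂ (cartan B H)) : highestVector b θ lam ≠ 0 := by
  obtain ⟨G, -, hG⟩ := E.exists_verma_map lam
  intro h
  rw [h, map_zero] at hG
  have := congrArg (lift ℂ (0 : (E.grading B).negPart →ₗ⁅ℂ⁆ ℂ)) hG
  rw [map_zero, map_one] at this
  exact zero_ne_one this

/-- Every nonzero submodule contains the highest vector. -/
theorem isSimpleModule_verma [Finite ι]
    (E : HomogeneousBasis H (weylCovector b) (b.height θ + 1) ι)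
    (lam : Dual ℂ (cartan B H)) (h : lam ⟨c₂ B, c₂_mem_cartan B H⟩ ≠ 0) :
    IsSimpleModule (UniversalEnvelopingAlgebra ℂ (ExtDoubleAffine B))
      (ImaginaryVermaModule b θ lam) := by
  have hw := E.isHighest_highestVector lam
  have hdet := E.detects B E.deg_eq_zero_and_eq_zero (vermaRep b θ lam) h (vermaRep_c₂ lam)
  have hwords : (E.grading B).words (vermaRep b θ lam) (highestVector b θ lam) = ⊤ :=
    eq_top_of_highestVector_mem lam _ (fun x _ hm => (E.grading B).rep_mem_words hw x hm)
      (Submodule.subset_span ⟨[], rfl⟩)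
  refine { exists_pair_ne := ⟨⊥, ⊤, fun h0 => E.highestVector_ne_zero lam ?_⟩,
           eq_bot_or_eq_top := fun W => ?_ }
  · exact (Submodule.mem_bot _).mp (h0 ▸ Submodule.mem_top)
  · refine or_iff_not_imp_left.mpr fun hW => ?_
    obtain ⟨v, hv, hv0⟩ := (Submodule.ne_bot_iff W).mp hW
    have hmem := (E.grading B).mem_of_ne_zero hw hdet (W.restrictScalars ℂ)
      (fun x m hm => W.smul_mem _ hm) hv hv0 (hwords ▸ Submodule.mem_top)
    have := eq_top_of_highestVector_mem lam (W.restrictScalars ℂ)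
      (fun x m hm => W.smul_mem _ hm) hmem
    exact (Submodule.restrictScalars_eq_top_iff ℂ _ _).mp this

lemma exists_deg_eq_zero : ∃ i, E.deg i = 0 := by
  have hne : (weylCovector b : 𝔤) ≠ 0 := fun h => by
    have h₁ := root_weylCovector b θ
    rw [show weylCovector b = 0 from Subtype.ext h, map_zero] at h₁
    exact b.height_ne_zero θ (by exact_mod_cast h₁.symm)
  obtain ⟨i, hi⟩ := Finsupp.ne_iff.mp (E.e.repr.map_ne_zero_iff.mpr hne)
  exact ⟨i, E.deg_of_repr (k := 0) (by rw [lie_self]; simp) hi⟩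

lemma degree_eq_zero_neg_one {i : ι} (hi : E.deg i = 0) : E.degree (i, 0, -1) = toLex (0, -1) := by
  rw [degree, hi]; simp

/-- If `c₂` acts by zero, the vectors `h(0, -1) w` with `h ∈ 𝔥` are highest vectors, too: an element
of positive degree `D` maps such a vector to a multiple of `w`, which vanishes unless
`D = (0, 1)`, and `[h'(0, 1), h(0, -1)] = (h'|h) c₂`. -/
lemma isHighest_loopVec (h : lam ⟨c₂ B, c₂_mem_cartan B H⟩ = 0) {i : ι} (hi : E.deg i = 0) :
    (E.grading B).IsHighest (vermaRep b θ lam)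
      (vermaRep b θ lam (E.loopVec B (i, 0, -1)) (highestVector b θ lam)) where
  pos {D x} hD hx := by
    have hw := E.isHighest_highestVector lam
    rw [TriangularGrading.rep_comm, hw.pos hD hx, map_zero, zero_add]
    have hxy := (E.grading B).lie_mem hx (E.loopVec_mem_eigen (B := B) (i, 0, -1))
    rw [E.degree_eq_zero_neg_one hi] at hxy
    by_cases h1 : 0 < D + toLex (0, -1)
    · exact hw.pos h1 hxy
    · -- The degrees `D > 0` with `D + (0, -1) ≤ 0` reduce to `(0, 1)`.
      have hD1 : D = toLex (0, 1) := by
        rw [Prod.Lex.lt_iff] at hD h1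
        change 0 < (ofLex D).1 ∨ 0 = (ofLex D).1 ∧ 0 < (ofLex D).2 at hD
        change ¬ (0 < (ofLex D).1 + 0 ∨ 0 = (ofLex D).1 + 0 ∧ 0 < (ofLex D).2 + -1) at h1
        refine ofLex_inj.mp (Prod.ext ?_ ?_)
        · change (ofLex D).1 = 0
          omega
        · change (ofLex D).2 = 1
          omega
      rw [E.eq_sum_of_mem_eigen hx hD.ne', Finsupp.linearCombination_apply, Finsupp.sum,
        sum_lie, map_sum, LinearMap.sum_apply]
      refine Finset.sum_eq_zero fun t ht => ?_
      have hdeg := E.degree_of_loopCoord hx (Finsupp.mem_support_iff.mp ht)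
      obtain ⟨i', m, n⟩ := t
      rw [hD1] at hdeg
      have h₁ : E.deg i' + (b.height θ + 1) * m = 0 := congrArg (fun D => (ofLex D).1) hdeg
      obtain rfl : n = 1 := congrArg (fun D => (ofLex D).2) hdeg
      obtain ⟨hi', rfl⟩ := E.deg_eq_zero_and_eq_zero h₁
      have hbr : ⁅E.loopVec B (i', 0, 1), E.loopVec B (i, 0, -1)⁆ =
          B.form (E.e i') (E.e i) • c₂ B := by
        refine ExtDoubleAffine.ext ?_ ?_ ?_
        · rw [map_smul]
          simp [loopVec, elt, c₂, E.lie_eq_zero_of_deg_eq_zero hi (E.mem_of_deg hi')]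
        · rw [map_smul]
          simp [loopVec, elt, c₂]
        · rw [map_smul]
          simp [loopVec, elt, c₂]
      rw [smul_lie, hbr, map_smul, map_smul, LinearMap.smul_apply, LinearMap.smul_apply,
        vermaRep_c₂, h, zero_smul, smul_zero, smul_zero]
  zero {x} hx := by
    have hxc := E.mem_cartan_of_mem_eigen_zero hx
    refine ⟨lam ⟨x, hxc⟩ + E.cartanWeight (i, 0, -1) ⟨x, hxc⟩, ?_⟩
    have hroot := E.loopVec_mem_rootSpace (B := B) (i, 0, -1) ⟨x, hxc⟩
    change ⁅x, _⁆ = _ at hroot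
    rw [TriangularGrading.rep_comm, vermaRep_highestVector_cartan lam hxc, hroot, map_smul,
      map_smul, LinearMap.smul_apply, add_smul]

/-- The form `x ↦ (dual i | coefficient of t₂⁻¹ in x)` is a character of the negative part `𝔞`: two
homogeneous elements of `𝔞` whose bracket is of degree `(0, -1)` lie in the commutative subalgebra
`𝔥 ⊗ t₂⁻¹ℂ[t₂⁻¹]`. -/
lemma exists_negPart_character [Finite ι] {i : ι} (hi : E.deg i = 0)
    (hneg : E.degree (i, 0, -1) < 0) :
    ∃ ψ : (E.grading B).negPart →ₗ⁅ℂ⁆ ℂ,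
      ψ ⟨E.loopVec B (i, 0, -1), (E.grading B).vec_mem_negPart ⟨_, hneg⟩⟩ ≠ 0 := by
  classical
  have hbr : ∀ x y : (E.grading B).negPart,
      coeffForm B (E.dual B i) 0 (-1) ⁅(x : ExtDoubleAffine B), (y : ExtDoubleAffine B)⁆ = 0 := by
    rintro ⟨x, hx⟩ ⟨y, hy⟩
    change x ∈ Submodule.span ℂ (Set.range (E.grading B).vec) at hx
    change y ∈ Submodule.span ℂ (Set.range (E.grading B).vec) at hy
    change coeffForm B (E.dual B i) 0 (-1) ⁅x, y⁆ = 0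
    induction hx using Submodule.span_induction with
    | mem x hx =>
      induction hy using Submodule.span_induction with
      | mem y hy =>
        obtain ⟨⟨⟨k, m, n⟩, ht⟩, rfl⟩ := hx
        obtain ⟨⟨⟨k', m', n'⟩, ht'⟩, rfl⟩ := hy
        refine (coeffForm_lie_elt _ _ _ _ _ _ _ _ _).trans ?_
        split_ifs with hm
        · by_contra hne
          have hk : (E.dual B i : 𝔤) ∈ H := E.dual_mem_of_deg_eq_zero B hi
          have hdeg : E.deg k + E.deg k' = 0 := by
            have h₁ : B.form (E.e k) (E.e k') ≠ 0 := by
              rw [show ⁅E.dual B i, E.e k⁆ = _ from E.lie_e ⟨_, hk⟩ k, map_smul,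
                LinearMap.smul_apply] at hne
              exact right_ne_zero_of_smul hne
            exact_mod_cast E.form_rho_lie B k' _ (E.lie_rho_e k) h₁
          have h₁ : E.deg k + (b.height θ + 1) * m ≤ 0 :=
            (E.grading B).level_deg_nonpos ⟨_, ht⟩
          have h₂ : E.deg k' + (b.height θ + 1) * m' ≤ 0 :=
            (E.grading B).level_deg_nonpos ⟨_, ht'⟩
          have h₃ : m' = -m := by linarith [hm.1]
          rw [h₃] at h₂
          have h₄ : E.deg k + (b.height θ + 1) * m = 0 := by linarith
          rw [E.lie_eq_zero_of_deg_eq_zero (E.deg_eq_zero_and_eq_zero h₄).1 hk, map_zero,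
            LinearMap.zero_apply] at hne
          exact hne rfl
        · rfl
      | zero => rw [lie_zero, map_zero]
      | add y z _ _ hy hz => rw [lie_add, map_add, hy, hz, add_zero]
      | smul c y _ hy => rw [lie_smul, map_smul, hy, smul_zero]
    | zero => rw [zero_lie, map_zero]
    | add y z _ _ hy hz => rw [add_lie, map_add, hy, hz, add_zero]
    | smul c y _ hy => rw [smul_lie, map_smul, hy, smul_zero]
  refine ⟨{ coeffForm B (E.dual B i) 0 (-1) ∘ₗ (E.grading B).negPart.toSubmodule.subtype with
      map_lie' := fun {x y} => (hbr x y).trans ?_ }, ?_⟩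
  · rw [LieRing.of_associative_ring_bracket, mul_comm, sub_self]
  · change coeffForm B (E.dual B i) 0 (-1) (elt B 0 (-1) (E.e i)) ≠ 0
    rw [coeffForm_elt, if_pos ⟨rfl, rfl⟩, form_dual_e, if_pos rfl]
    exact one_ne_zero

/-- For a nonzero `h ∈ 𝔥` the vector `h(0, -1) w` generates a proper nonzero submodule. -/
theorem not_isSimpleModule_verma [Finite ι]
    (E : HomogeneousBasis H (weylCovector b) (b.height θ + 1) ι)
    (lam : Dual ℂ (cartan B H)) (h : lam ⟨c₂ B, c₂_mem_cartan B H⟩ = 0) :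
    ¬ IsSimpleModule (UniversalEnvelopingAlgebra ℂ (ExtDoubleAffine B))
      (ImaginaryVermaModule b θ lam) := by
  intro hsimple
  obtain ⟨i, hi⟩ := E.exists_deg_eq_zero
  obtain ⟨G, hG, hG₁⟩ := E.exists_verma_map lam
  have hneg : E.degree (i, 0, -1) < 0 := by
    rw [E.degree_eq_zero_neg_one hi]
    exact Prod.Lex.lt_iff.mpr (Or.inr ⟨rfl, by decide⟩)
  obtain ⟨ψ, hψ⟩ := E.exists_negPart_character (B := B) hi hneg
  set a : (E.grading B).negPart :=
    ⟨E.loopVec B (i, 0, -1), (E.grading B).vec_mem_negPart ⟨_, hneg⟩⟩ with ha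
  have hu := E.isHighest_loopVec lam h hi
  set u := vermaRep b θ lam (E.loopVec B (i, 0, -1)) (highestVector b θ lam) with hu_def
  have hGu : G u = UniversalEnvelopingAlgebra.ι ℂ a := by
    rw [hu_def, show E.loopVec B (i, 0, -1) = (a : ExtDoubleAffine B) from rfl, hG, hG₁, mul_one]
  have hu0 : u ≠ 0 := fun h0 => hψ <| by
    rw [h0, map_zero] at hGu
    have := congrArg (lift ℂ ψ) hGu
    rw [map_zero, lift_ι_apply] at this
    exact this.symm
  have htop := eq_top_of_isSimpleModule ((E.grading B).words (vermaRep b θ lam) u)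
    (fun x _ hm => (E.grading B).rep_mem_words hu x hm) (Submodule.subset_span ⟨[], rfl⟩) hu0
  -- The words in `u` lie in the kernel of the augmentation, the highest vector does not.
  let ε := (lift ℂ (0 : (E.grading B).negPart →ₗ⁅ℂ⁆ ℂ)).toLinearMap ∘ₗ G
  have hle : (E.grading B).words (vermaRep b θ lam) u ≤ LinearMap.ker ε := by
    refine Submodule.span_le.mpr ?_
    rintro _ ⟨l, rfl⟩
    change lift ℂ (0 : (E.grading B).negPart →ₗ⁅ℂ⁆ ℂ) (G _) = 0
    cases l with
    | nil =>
      change lift ℂ (0 : (E.grading B).negPart →ₗ⁅ℂ⁆ ℂ) (G u) = 0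
      rw [hGu, lift_ι_apply, LieHom.zero_apply]
    | cons j l =>
      rw [TriangularGrading.word]
      have := hG ⟨_, (E.grading B).vec_mem_negPart j⟩
        ((E.grading B).word (vermaRep b θ lam) u l)
      rw [show G _ = _ from this, map_mul, lift_ι_apply, LieHom.zero_apply, zero_mul]
  have hmem : highestVector b θ lam ∈ LinearMap.ker ε := hle (htop ▸ Submodule.mem_top)
  rw [LinearMap.mem_ker] at hmem
  change lift ℂ (0 : (E.grading B).negPart →ₗ⁅ℂ⁆ ℂ) (G _) = 0 at hmem
  rw [hG₁, map_one] at hmem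
  exact one_ne_zero hmem

end HomogeneousBasis

end VermaModule

end

theorem mainTheorem1 {𝔤 : Type*} [LieRing 𝔤] [LieAlgebra ℂ 𝔤] [FiniteDimensional ℂ 𝔤]
    [LieAlgebra.IsSimple ℂ 𝔤] (B : InvariantForm 𝔤)
    (H : LieSubalgebra ℂ 𝔤) [H.IsCartanSubalgebra]
    (b : (LieAlgebra.IsKilling.rootSystem H).Base) (hb : b.cartanMatrix.IsSimplyLaced)
    (θ : H.root) (hθ : IsLongestRoot b θ)
    (lam : Module.Dual ℂ (ExtDoubleAffine.cartan B H)) :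
    IsSimpleModule (UniversalEnvelopingAlgebra ℂ (ExtDoubleAffine B))
        (ImaginaryVermaModule b θ lam) ↔
      lam ⟨ExtDoubleAffine.c₂ B, ExtDoubleAffine.c₂_mem_cartan B H⟩ ≠ 0 := by
  obtain ⟨n, ⟨E⟩⟩ := exists_homogeneousBasis b hθ
  exact ⟨fun h h0 => E.not_isSimpleModule_verma lam h0 h, E.isSimpleModule_verma lam⟩
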